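/- **Setting.** Let $R>0$, $r>R$, $a>0$, $d>R$, $k>0$ and an integer $N\ge 1$ be fixed. Let $\Omega=\{\mathbf x=(x,y,z)\in\mathbb R^3:|x|,|y|,|z|<R\}$ and $\Gamma=\{|x|,|y|<R,\ z=-R\}$. Let $\{\Psi_n\}_{n\ge 0}$ be the Gram–Schmidt orthonormalization in $L^2(-a,a)$ of the functions $\alpha^n e^{\alpha}$, $n\ge0$, and let $S_N=(s_{mn})_{m,n=0}^{N-1}$, $s_{mn}=\int_{-a}^a\Psi_n'\Psi_m\,d\alpha$ (an upper triangular matrix with unit diagonal). For $\alpha\in[-a,a]$ put $\mathbf x_\alpha=(\alpha,0,-d)$, $$\tilde{\mathbf x}_\alpha=\frac{\mathrm i k(\mathbf x-\mathbf x_\alpha)}{|\mathbf x-\mathbf x_\alpha|}-\frac{\mathbf x-\mathbf x_\alpha}{|\mathbf x-\mathbf x_\alpha|^2},\qquad \widehat{\mathbf x}_\alpha=\partial_\alpha\tilde{\mathbf x}_\alpha .$$ For $V=(v_0,\dots,v_{N-1}):\Omega\to\mathbb C^N$ let $L(V)=\Delta V+S_N^{-1}f(\nabla V)$, where, for $0\le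 m\le N-1$ and with the bilinear product $p\cdot q=\sum_i p_iq_i$, $$f_m(\nabla V)=2\sum_{n,l=0}^{N-1}\nabla v_n\cdot\nabla v_l\int_{-a}^a\Psi_m\Psi_n\Psi_l'\,d\alpha+2\sum_{n=0}^{N-1}\int_{-a}^a\Psi_m\Psi_n'\,\nabla v_n\cdot\tilde{\mathbf x}_\alpha\,d\alpha+2\sum_{n=0}^{N-1}\int_{-a}^a\Psi_m\Psi_n\,\widehat{\mathbf x}_\alpha\cdot\nabla v_n\,d\alpha .$$ Identify $\mathbb C^N$-valued functions with $2N$-dimensional real vector functions, and let $H^s_{2N}(\Omega)$ be the corresponding (real) Sobolev space with $\|V\|^2_{H^s_{2N}}=\sum_n\sum_{|\beta|\le s}\|D^\beta v_n\|^2_{L^2(\Omega)}$. For $\lambda>0$ and $\gamma\in(0,1)$ define on $H^3_{2N}(\Omega)$ the functional $$J_{\lambda,\gamma}(V)=e^{-2\lambda(R+r)^2}\int_\Omega|L(V)|^2e^{2\lambda(z-r)^2}\,d\mathbf x+\gamma\|V\|^2_{H^3_{2N}(\Omega)} .$$ For $M>0$ and boundary data $\psi_0$ on $\partial\Omega$,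 $\psi_1$ on $\Gamma$ let $$B(M)=\{V\in H^3_{2N}(\Omega):\ \|V\|_{H^3_{2N}(\Omega)}<M,\ V|_{\partial\Omega}=\psi_0,\ \partial_zV|_\Gamma=\psi_1\},$$ where the boundary values are those of the representatives of $V$ and $\partial_zV$ continuous on $\overline\Omega$, and let $\overline{B(M)}$ be its closure in $H^3_{2N}(\Omega)$. **Theorem 5.1.** Let $M>0$. (i) For all $\lambda>0$, $\gamma\in(0,1)$ the integral defining $J_{\lambda,\gamma}(V)$ converges absolutely for every $V\in H^3_{2N}(\Omega)$, and, for all $\psi_0,\psi_1$, the functional $J_{\lambda,\gamma}:H^3_{2N}(\Omega)\to\mathbb R$ has a Fréchet derivative $J'_{\lambda,\gamma}(V)$ at every point $V\in\overline{B(M)}$. (ii) For every $\lambda_0>1$ there are numbers $\lambda_2\ge\lambda_0$ and $C>0$, depending only on $\lambda_0,M,N,r,R$ and the fixed parameters $a,d,k$ (and not on $\lambda,\gamma,\psi_0,\psi_1$), such that for all $\lambda\ge\lambda_2$, all $\gamma\in(0,1)$ and all $\psi_0,\psi_1$ the functional $J_{\lambda,\gamma}$ is strictly convex on $\overline{B(M)}$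 and, more precisely, for all $V^{(1)},V^{(2)}\in\overline{B(M)}$, $$J_{\lambda,\gamma}(V^{(2)})-J_{\lambda,\gamma}(V^{(1)})-J'_{\lambda,\gamma}(V^{(1)})(V^{(2)}-V^{(1)})\ \ge\ C_\lambda\|V^{(2)}-V^{(1)}\|^2_{H^2_{2N}(\Omega)}+\gamma\|V^{(2)}-V^{(1)}\|^2_{H^3_{2N}(\Omega)},\qquad C_\lambda=C\,\frac{e^{-8\lambda Rr}}{\lambda}>0 .$$ -/

import Mathlib

open MeasureTheory Set
open scoped ContDiff

noncomputable section

namespace Convexification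

/-- Points `𝐱 = (x, y, z)` of three-dimensional Euclidean space: `x = 𝐱 0`, `y = 𝐱 1`,
`z = 𝐱 2`. -/
abbrev Space : Type := EuclideanSpace ℝ (Fin 3)

/-- The open cube `Ω = {|x|, |y|, |z| < R}`. -/
def cube (R : ℝ) : Set Space := {x | ∀ i, |x i| < R}

/-- The lower face `Γ = {|x|, |y| < R, z = -R}` of the cube. -/
def lowerFace (R : ℝ) : Set Space := {x | |x 0| < R ∧ |x 1| < R ∧ x 2 = -R}

/-! ### Sobolev spaces on the cube -/

/-- Multi-indices `α = (α₀, α₁, α₂)` of order `|α| = α₀ + α₁ + α₂ ≤ s`. -/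
abbrev MultiIndex (s : ℕ) : Type := {α : Fin 3 → Fin (s + 1) // ∑ i, (α i : ℕ) ≤ s}

/-- The order `|α|` of a multi-index. -/
def MultiIndex.order {s : ℕ} (α : MultiIndex s) : ℕ := ∑ i, (α.1 i : ℕ)

/-- The multi-index `0`. -/
def idxZero : MultiIndex 3 := ⟨fun _ => 0, by decide⟩

/-- The multi-index of the first order derivative `∂ᵢ`. -/
def idxOne (i : Fin 3) : MultiIndex 3 := ⟨Pi.single i 1, by revert i; decide⟩

/-- The multi-index of the pure second order derivative `∂ᵢ²`. -/
def idxTwo (i : Fin 3) : MultiIndex 3 := ⟨Pi.single i 2, by revert i; decide⟩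

/-- The classical partial derivative `∂ᵢ φ`. -/
def partialDeriv (i : Fin 3) (φ : Space → ℝ) : Space → ℝ :=
  fun x => fderiv ℝ φ x (EuclideanSpace.single i 1)

/-- The classical derivative `D^α φ = ∂₀^α₀ ∂₁^α₁ ∂₂^α₂ φ`. -/
def multiDeriv {s : ℕ} (α : MultiIndex s) (φ : Space → ℝ) : Space → ℝ :=
  (partialDeriv 0)^[(α.1 0 : ℕ)] ((partialDeriv 1)^[(α.1 1 : ℕ)]
    ((partialDeriv 2)^[(α.1 2 : ℕ)] φ))

/-- `φ ∈ C_c^∞(Ω)`, a real test function on the cube. -/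
structure IsTest (R : ℝ) (φ : Space → ℝ) : Prop where
  smooth : ContDiff ℝ ∞ φ
  compact : HasCompactSupport φ
  support : tsupport φ ⊆ cube R

/-- `L²(Ω; ℂ)`. -/
abbrev L2 (R : ℝ) : Type := Lp ℂ 2 ((volume : Measure Space).restrict (cube R))

/-- `w = D^α v` in `Ω` in the weak sense:
`∫_Ω v D^α φ = (-1)^|α| ∫_Ω w φ` for all `φ ∈ C_c^∞(Ω)`. -/
def IsWeakDeriv {s : ℕ} (R : ℝ) (α : MultiIndex s) (v w : L2 R) : Prop :=
  ∀ φ : Space → ℝ, IsTest R φ →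
    ∫ x in cube R, multiDeriv α φ x • v x =
      (-1 : ℝ) ^ α.order • ∫ x in cube R, φ x • w x

theorem smooth_partialDeriv (i : Fin 3) {φ : Space → ℝ}
    (h : ContDiff ℝ ∞ φ ∧ HasCompactSupport φ) :
    ContDiff ℝ ∞ (partialDeriv i φ) ∧ HasCompactSupport (partialDeriv i φ) := by
  refine ⟨?_, ?_⟩
  · exact (h.1.fderiv_right (m := ∞) (by simp)).clm_apply contDiff_const
  · exact h.2.fderiv_apply (𝕜 := ℝ) _

theorem smooth_iterate (i : Fin 3) (n : ℕ) {φ : Space → ℝ}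
    (h : ContDiff ℝ ∞ φ ∧ HasCompactSupport φ) :
    ContDiff ℝ ∞ ((partialDeriv i)^[n] φ) ∧ HasCompactSupport ((partialDeriv i)^[n] φ) := by
  induction n with
  | zero => simpa using h
  | succ n ih =>
    rw [Function.iterate_succ_apply']
    exact smooth_partialDeriv i ih

theorem smooth_multiDeriv {s : ℕ} (α : MultiIndex s) {φ : Space → ℝ}
    (h : ContDiff ℝ ∞ φ ∧ HasCompactSupport φ) :
    ContDiff ℝ ∞ (multiDeriv α φ) ∧ HasCompactSupport (multiDeriv α φ) :=
  smooth_iterate _ _ (smooth_iterate _ _ (smooth_iterate _ _ h))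

theorem integrable_test_smul {R : ℝ} {φ : Space → ℝ}
    (h : ContDiff ℝ ∞ φ ∧ HasCompactSupport φ) (v : L2 R) :
    Integrable (fun x => φ x • v x) ((volume : Measure Space).restrict (cube R)) := by
  have h1 : MemLp φ 2 ((volume : Measure Space).restrict (cube R)) :=
    (h.1.continuous.memLp_of_hasCompactSupport h.2).restrict _
  exact memLp_one_iff_integrable.1 ((Lp.memLp v).smul (p := 2) (q := 2) h1)

theorem integral_test_add {R : ℝ} {φ : Space → ℝ}
    (h : ContDiff ℝ ∞ φ ∧ HasCompactSupport φ) (v w : L2 R) :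
    ∫ x in cube R, φ x • (v + w : L2 R) x =
      (∫ x in cube R, φ x • v x) + ∫ x in cube R, φ x • w x := by
  rw [← integral_add (integrable_test_smul h v) (integrable_test_smul h w)]
  refine integral_congr_ae ?_
  filter_upwards [Lp.coeFn_add v w] with x hx
  rw [hx, Pi.add_apply, smul_add]

theorem integral_test_smul {R : ℝ} (φ : Space → ℝ) (c : ℝ) (v : L2 R) :
    ∫ x in cube R, φ x • (c • v : L2 R) x = c • ∫ x in cube R, φ x • v x := by
  rw [← integral_smul]
  refine integral_congr_ae ?_
  filter_upwards [Lp.coeFn_smul c v] with x hx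
  rw [hx, Pi.smul_apply, smul_comm]

/-- The Sobolev space `H^s(Ω; ℂ^N)`, as a real normed space. An element `V` is recorded by the
family of all weak derivatives `V (n, α) = D^α v_n ∈ L²(Ω; ℂ)`, `n < N`, `|α| ≤ s`, of its
components `v_n = V (n, 0)`, and the norm is
`‖V‖² = ∑_{n < N} ∑_{|α| ≤ s} ‖D^α v_n‖²_{L²(Ω)}`. Writing each `v_n` as the pair
`(Re v_n, Im v_n)` turns this space, isometrically, into the space of `2N`-dimensional
real vector functions with components in `H^s(Ω)`. -/
def Sobolev (R : ℝ) (N s : ℕ) :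
    Submodule ℝ (PiLp 2 (fun _ : Fin N × MultiIndex s => L2 R)) where
  carrier := {V | ∀ (n : Fin N) (α : MultiIndex s),
    IsWeakDeriv R α (V (n, ⟨fun _ => 0, by simp⟩)) (V (n, α))}
  zero_mem' := by
    intro n α φ hφ
    have h0 (g : Space → ℝ) : ∫ x in cube R, g x • (0 : L2 R) x = 0 := by
      have := integral_test_smul (R := R) g 0 0
      simpa using this
    simp only [PiLp.zero_apply]
    rw [h0, h0, smul_zero]
  add_mem' := by
    intro V W hV hW n α φ hφ
    have h1 := hV n α φ hφ
    have h2 := hW n α φ hφ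
    simp only [PiLp.add_apply]
    rw [integral_test_add (smooth_multiDeriv α ⟨hφ.smooth, hφ.compact⟩),
      integral_test_add ⟨hφ.smooth, hφ.compact⟩, h1, h2, smul_add]
  smul_mem' := by
    intro c V hV n α φ hφ
    have h1 := hV n α φ hφ
    simp only [PiLp.smul_apply]
    rw [integral_test_smul, integral_test_smul, h1, smul_comm]

/-- The space `H³(Ω; ℂ^N)`, that is `H³_{2N}(Ω)`. -/
abbrev H3 (R : ℝ) (N : ℕ) : Type := Sobolev R N 3

/-- The component `v_n` of `V`. -/
def comp {R : ℝ} {N : ℕ} (V : H3 R N) (n : Fin N) : L2 R := V.1 (n, idxZero)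

/-- The weak derivative `∂ᵢ v_n`. -/
def grad {R : ℝ} {N : ℕ} (V : H3 R N) (n : Fin N) (i : Fin 3) : L2 R := V.1 (n, idxOne i)

/-- The weak Laplacian `Δ v_n`, as a function on `Ω`. -/
def lap {R : ℝ} {N : ℕ} (V : H3 R N) (n : Fin N) (x : Space) : ℂ :=
  ∑ i, V.1 (n, idxTwo i) x

/-- `‖V‖²_{H²(Ω)}`, for `V ∈ H³(Ω; ℂ^N)`. -/
def normSqH2 {R : ℝ} {N : ℕ} (V : H3 R N) : ℝ :=
  ∑ n : Fin N, ∑ α : MultiIndex 3 with α.order ≤ 2, ‖V.1 (n, α)‖ ^ 2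

/-- `v|_S = g` for a part `S` of the closed cube, where `v` is (the class of) a function with a
representative that is continuous up to the boundary. Every element of `H²(Ω)` has one, by the
Sobolev embedding in dimension three. -/
def HasBoundaryValue {R : ℝ} (v : L2 R) (S : Set Space) (g : Space → ℂ) : Prop :=
  ∃ w : Space → ℂ, ContinuousOn w (closure (cube R)) ∧
    (∀ᵐ x ∂((volume : Measure Space).restrict (cube R)), v x = w x) ∧ ∀ x ∈ S, w x = g x

/-- The set `B(M)` of all `V ∈ H³(Ω; ℂ^N)` with `‖V‖_{H³} < M`, `V = ψ₀` on `∂Ω` and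
`∂_z V = ψ₁` on `Γ`. -/
def ball (R : ℝ) (N : ℕ) (M : ℝ) (ψ₀ ψ₁ : Fin N → Space → ℂ) : Set (H3 R N) :=
  {V | ‖V‖ < M ∧
    (∀ n, HasBoundaryValue (comp V n) (frontier (cube R)) (ψ₀ n)) ∧
    ∀ n, HasBoundaryValue (grad V n 2) (lowerFace R) (ψ₁ n)}

/-! ### The special orthonormal basis of `L²(-a, a)` -/

/-- `φ_n(α) = α^n e^α`. -/
def basisFun (n : ℕ) (α : ℝ) : ℝ := α ^ n * Real.exp α

/-- The functions `Ψ_n`: the Gram-Schmidt orthonormalization of `φ_0, φ_1, …` in `L²(-a, a)`,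
`Ψ_n = g_n / ‖g_n‖` with `g_n = φ_n - ∑_{m < n} ⟨φ_n, Ψ_m⟩ Ψ_m`. -/
def psi (a : ℝ) (n : ℕ) : ℝ → ℝ :=
  let g : ℝ → ℝ := fun α =>
    basisFun n α - ∑ m : Fin n, (∫ t in -a..a, basisFun n t * psi a m t) * psi a m α
  fun α => g α / Real.sqrt (∫ t in -a..a, g t ^ 2)
termination_by n
decreasing_by all_goals exact m.2

/-- The matrix `S_N = (s_{mn})`, `s_{mn} = ⟨Ψ_n', Ψ_m⟩`. -/
def matS (a : ℝ) (N : ℕ) : Matrix (Fin N) (Fin N) ℝ :=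
  Matrix.of fun m n => ∫ t in -a..a, deriv (psi a n) t * psi a m t

/-! ### The quasilinear operator -/

/-- The vector `𝐱 - 𝐱_α = (x - α, y, z + d)`, where `𝐱_α = (α, 0, -d)` is the point source. -/
def shift (d α : ℝ) (x : Space) : Space := !₂[x 0 - α, x 1, x 2 + d]

/-- The vector `x̃_α = i k (𝐱 - 𝐱_α) / |𝐱 - 𝐱_α| - (𝐱 - 𝐱_α) / |𝐱 - 𝐱_α|²`. -/
def xTilde (k d α : ℝ) (x : Space) (i : Fin 3) : ℂ :=
  Complex.I * k * (shift d α x i) / ‖shift d α x‖ - (shift d α x i) / ‖shift d α x‖ ^ 2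

/-- The vector `x̂_α`, the derivative of `x̃_α` with respect to `α`:
`x̂_α = i k / ρ³ (-y² - (z + d)², (x - α) y, (x - α) (z + d))
  - 1 / ρ⁴ ((x - α)² - y² - (z + d)², 2 (x - α) y, 2 (x - α) (z + d))`, `ρ = |𝐱 - 𝐱_α|`. -/
def xHat (k d α : ℝ) (x : Space) (i : Fin 3) : ℂ :=
  Complex.I * k / ‖shift d α x‖ ^ 3 *
      (![-(x 1) ^ 2 - (x 2 + d) ^ 2, (x 0 - α) * x 1, (x 0 - α) * (x 2 + d)] i : ℝ) -
    1 / ‖shift d α x‖ ^ 4 *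
      (![(x 0 - α) ^ 2 - (x 1) ^ 2 - (x 2 + d) ^ 2, 2 * (x 0 - α) * x 1,
        2 * (x 0 - α) * (x 2 + d)] i : ℝ)

/-- The nonlinearity `f_m`, evaluated at the point `x` and at the gradient matrix
`P n i = ∂ᵢ v_n(x)`. -/
def nonlin (a d k : ℝ) (N : ℕ) (x : Space) (P : Fin N → Fin 3 → ℂ) (m : Fin N) : ℂ :=
  2 * ∑ n : Fin N, ∑ l : Fin N, (∑ i, P n i * P l i) *
      ((∫ t in -a..a, psi a m t * psi a n t * deriv (psi a l) t : ℝ) : ℂ) +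
    2 * ∑ n : Fin N, (∫ t in -a..a,
      ((psi a m t * deriv (psi a n) t : ℝ) : ℂ) * ∑ i, P n i * xTilde k d t x i) +
    2 * ∑ n : Fin N, (∫ t in -a..a,
      ((psi a m t * psi a n t : ℝ) : ℂ) * ∑ i, xHat k d t x i * P n i)

/-- `L(V) = ΔV + K(∇V)` with `K(∇V) = S_N⁻¹ f(∇V)`, as a `ℂ^N`-valued function on `Ω`. -/
def opL (a d k : ℝ) {R : ℝ} {N : ℕ} (V : H3 R N) (x : Space) (m : Fin N) : ℂ :=
  lap V m x + ∑ j, (((matS a N)⁻¹ m j : ℝ) : ℂ) * nonlin a d k N x (fun n i => grad V n i x) j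

/-! ### The weighted Tikhonov-like functional -/

/-- The Carleman weight function `μ_λ(z) = exp(2λ(z - r)²)`. -/
def weight (lam r z : ℝ) : ℝ := Real.exp (2 * lam * (z - r) ^ 2)

/-- The integrand `|L(V)(𝐱)|² μ_λ(z)`. -/
def integrand (a d k r lam : ℝ) {R : ℝ} {N : ℕ} (V : H3 R N) (x : Space) : ℝ :=
  (∑ m, ‖opL a d k V x m‖ ^ 2) * weight lam r (x 2)

/-- The functional
`J_{λ,γ}(V) = exp(-2λ(R + r)²) ∫_Ω |L(V)|² μ_λ(z) d𝐱 + γ ‖V‖²_{H³(Ω)}`. -/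
def functionalJ (a d k r lam γ : ℝ) {R : ℝ} {N : ℕ} (V : H3 R N) : ℝ :=
  Real.exp (-2 * lam * (R + r) ^ 2) * (∫ x in cube R, integrand a d k r lam V x) + γ * ‖V‖ ^ 2

end Convexification

end

/-!
The operator is a Laplacian plus a quadratic polynomial in the gradient whose coefficients are
bounded on the cube, because the sources stay at a positive distance from it (`opL_eq`). Since
`H³ ⊂ W^{1,∞}` in dimension three, `V ↦ exp(λ(z - r)²) L(V)` is the sum of a continuous linear map
and of a continuous quadratic map from `H³` to `L²` (`exists_operators`). The functional is thus a
sum of squared norms of such maps: it is differentiable, and its second order Taylor remainder at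
`V₁` in the direction `h = V₂ - V₁` is explicit (`exists_hasFDerivAt`). The regularization
contributes `γ ‖h‖²` to it. On bounded sets the other part is, pointwise and up to the weight, at
least `½ |Δh|² - A (1 + |ΔV₁|) |∇h|²` (`exists_pointwise_lower`).

What remains is to absorb the negative term, for large `λ`, by the Carleman estimate for the
Laplacian with the weight `exp(2λ(z - r)²)` (`carleman`). It applies to the real and imaginary parts
of `h`, which vanish on the boundary of the cube together with the normal derivative on the lower
face (`zeroData_sub`). Conjugating the Laplacian with the square root of the weight, the commutator
of the symmetric and antisymmetric parts is positive and the boundary terms are zero or have a good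
sign (`conjugated_commutator`); this gives `λ ∫ |∇h|²` and `λ² ∫ h²`, weighted (`carleman_gradient`).
The second derivatives follow with a factor `λ` lost: on functions that vanish on the boundary of a
cube, `∫ (Δu)²` and `∫ |D²u|²`, weighted, agree up to lower order terms (`carleman_hessian`). The
coefficient `ΔV₁` is not bounded but belongs to `L⁶`; interpolating with the bound of
`exp(λ(z - r)²) ∇h` in `W^{1,2} ⊂ L⁶`, the estimate still absorbs it with the factor `√λ` in place of
`λ`. The remainder is then at least a constant times `λ⁻¹` times the weighted squares of all
derivatives of `h` up to order two (`exists_remainder_lower`). The weight is at least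
`exp(2λ(r - R)²)` on the cube, and `-2λ(R + r)² + 2λ(r - R)² = -8λRr`. Strict convexity is the first
order criterion (`strictConvexOn_of_forall_lt`).

The analysis on the cube is developed from scratch: density of smooth functions in `H³` by
mollification and dilation (`IsJet.exists_smooth`), the embeddings `W^{1,2} ⊂ L⁶` and `H² ⊂ C⁰`
(`eLpNorm_six_le`, `enorm_le_sobolev`), and integration by parts for functions that are uniform
limits of `C¹` functions with gradients converging in `L²` (`Adm.integral_nonneg`), which needs no
trace theorem.
-/

noncomputable section

namespace Convexification

open Filter Topology

/-! ### Density of smooth functions in `H³` of the cube -/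

theorem measurableSet_cube (R : ℝ) : MeasurableSet (cube R) := by
  have : cube R = ⋂ i, {x : Space | |x i| < R} := by ext; simp [cube]
  rw [this]
  exact MeasurableSet.iInter fun i => measurableSet_lt (by fun_prop) measurable_const

theorem isOpen_cube (R : ℝ) : IsOpen (cube R) := by
  have : cube R = ⋂ i, {x : Space | |x i| < R} := by ext; simp [cube]
  rw [this]
  exact isOpen_iInter_of_finite fun i => isOpen_lt (by fun_prop) continuous_const

/-- The closed cube `|x|, |y|, |z| ≤ R`. -/
def closedCube (R : ℝ) : Set Space := {x | ∀ i, |x i| ≤ R}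

theorem cube_subset_closedCube (R : ℝ) : cube R ⊆ closedCube R := fun _ hx i => (hx i).le

theorem isCompact_closedCube (R : ℝ) : IsCompact (closedCube R) := by
  have h : IsCompact (Set.pi univ fun _ : Fin 3 => Icc (-R) R) :=
    isCompact_univ_pi fun _ => isCompact_Icc
  have h2 := h.image (PiLp.continuous_toLp 2 (fun _ : Fin 3 => ℝ))
  convert h2 using 1
  ext x
  simp only [closedCube, Set.mem_ofPred_eq, mem_image, Set.mem_pi, mem_univ, true_imp_iff, mem_Icc,
    abs_le]
  constructor
  · intro h
    exact ⟨x.ofLp, h, rfl⟩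
  · rintro ⟨y, hy, rfl⟩
    exact hy

instance isFiniteMeasure_cube (R : ℝ) :
    IsFiniteMeasure ((volume : Measure Space).restrict (cube R)) := by
  refine ⟨?_⟩
  rw [Measure.restrict_apply_univ]
  exact lt_of_le_of_lt (measure_mono (cube_subset_closedCube R))
    (isCompact_closedCube R).measure_lt_top

theorem partialDeriv_smooth (i : Fin 3) {φ : Space → ℝ} (h : ContDiff ℝ ∞ φ) :
    ContDiff ℝ ∞ (partialDeriv i φ) :=
  (h.fderiv_right (m := ∞) (by simp)).clm_apply contDiff_const

theorem iterate_partialDeriv_smooth (i : Fin 3) (n : ℕ) {φ : Space → ℝ} (h : ContDiff ℝ ∞ φ) :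
    ContDiff ℝ ∞ ((partialDeriv i)^[n] φ) := by
  induction n with
  | zero => simpa using h
  | succ n ih =>
    rw [Function.iterate_succ_apply']
    exact partialDeriv_smooth i ih

theorem partialDeriv_comp_affine (i : Fin 3) {G : Space → ℝ} (hG : ContDiff ℝ ∞ G) (a c : ℝ)
    (b : Space) :
    partialDeriv i (fun x => a * G (c • x + b)) =
      fun x => (a * c) * partialDeriv i G (c • x + b) := by
  ext x
  have h1 : HasFDerivAt (fun x : Space => c • x + b) (c • ContinuousLinearMap.id ℝ Space) x :=
    ((hasFDerivAt_id x).const_smul c).add_const b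
  have h2 : HasFDerivAt G (fderiv ℝ G (c • x + b)) (c • x + b) :=
    (hG.differentiable (by simp)).differentiableAt.hasFDerivAt
  have h3 := (h2.comp x h1).const_mul a
  have h4 : HasFDerivAt (fun x => a * G (c • x + b)) _ x := h3
  rw [partialDeriv, h4.fderiv]
  simp [partialDeriv, mul_assoc]

theorem iterate_partialDeriv_comp_affine (i : Fin 3) (n : ℕ) {G : Space → ℝ}
    (hG : ContDiff ℝ ∞ G) (a c : ℝ) (b : Space) :
    (partialDeriv i)^[n] (fun x => a * G (c • x + b)) =
      fun x => (a * c ^ n) * (partialDeriv i)^[n] G (c • x + b) := by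
  induction n with
  | zero => simp
  | succ n ih =>
    rw [Function.iterate_succ_apply', ih, partialDeriv_comp_affine i
      (iterate_partialDeriv_smooth i n hG), Function.iterate_succ_apply']
    ext x
    ring

theorem multiDeriv_comp_affine {s : ℕ} (α : MultiIndex s) {G : Space → ℝ}
    (hG : ContDiff ℝ ∞ G) (c : ℝ) (b : Space) :
    multiDeriv α (fun x => G (c • x + b)) =
      fun x => c ^ α.order * multiDeriv α G (c • x + b) := by
  have h0 : (fun x => G (c • x + b)) = fun x => 1 * G (c • x + b) := by simp
  have g2 := iterate_partialDeriv_smooth 2 (α.1 2 : ℕ) hG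
  have g1 := iterate_partialDeriv_smooth 1 (α.1 1 : ℕ) g2
  rw [multiDeriv, h0, iterate_partialDeriv_comp_affine 2 _ hG,
    iterate_partialDeriv_comp_affine 1 _ g2, iterate_partialDeriv_comp_affine 0 _ g1]
  ext x
  rw [multiDeriv, MultiIndex.order, Fin.sum_univ_three, pow_add, pow_add]
  ring

/-- The convolution `∫ v(z) ρ(x - z) dz`. -/
def conv (v ρ : Space → ℝ) : Space → ℝ :=
  convolution v ρ (ContinuousLinearMap.lsmul ℝ ℝ).flip volume

theorem conv_apply (v ρ : Space → ℝ) (x : Space) : conv v ρ x = ∫ z, ρ (x - z) * v z := rfl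

theorem conv_smooth {v ρ : Space → ℝ} (hv : LocallyIntegrable v)
    (h : ContDiff ℝ ∞ ρ ∧ HasCompactSupport ρ) : ContDiff ℝ ∞ (conv v ρ) :=
  h.2.contDiff_convolution_right _ hv h.1

theorem partialDeriv_conv (i : Fin 3) {v ρ : Space → ℝ} (hv : LocallyIntegrable v)
    (h : ContDiff ℝ ∞ ρ ∧ HasCompactSupport ρ) :
    partialDeriv i (conv v ρ) = conv v (partialDeriv i ρ) := by
  ext x
  have h1 := h.2.hasFDerivAt_convolution_right (ContinuousLinearMap.lsmul ℝ ℝ).flip hv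
    (h.1.of_le (by simp)) x
  rw [partialDeriv, conv, h1.fderiv, convolution_precompR_apply _ hv (h.2.fderiv (𝕜 := ℝ))
    (h.1.continuous_fderiv (by simp))]
  rfl

theorem iterate_partialDeriv_conv (i : Fin 3) (n : ℕ) {v ρ : Space → ℝ}
    (hv : LocallyIntegrable v) (h : ContDiff ℝ ∞ ρ ∧ HasCompactSupport ρ) :
    (partialDeriv i)^[n] (conv v ρ) = conv v ((partialDeriv i)^[n] ρ) := by
  induction n with
  | zero => simp
  | succ n ih =>
    rw [Function.iterate_succ_apply', ih, partialDeriv_conv i hv (smooth_iterate i n h),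
      Function.iterate_succ_apply']

theorem multiDeriv_conv {s : ℕ} (α : MultiIndex s) {v ρ : Space → ℝ}
    (hv : LocallyIntegrable v) (h : ContDiff ℝ ∞ ρ ∧ HasCompactSupport ρ) :
    multiDeriv α (conv v ρ) = conv v (multiDeriv α ρ) := by
  have g2 := smooth_iterate 2 (α.1 2 : ℕ) h
  have g1 := smooth_iterate 1 (α.1 1 : ℕ) g2
  rw [multiDeriv, iterate_partialDeriv_conv 2 _ hv h, iterate_partialDeriv_conv 1 _ hv g2,
    iterate_partialDeriv_conv 0 _ hv g1]
  rfl

/-- A real function of class `H³` on the cube, recorded by the family of its weak derivatives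
up to order three. -/
structure IsJet (R : ℝ) (U : MultiIndex 3 → Space → ℝ) : Prop where
  memLp : ∀ α, MemLp (U α) 2 ((volume : Measure Space).restrict (cube R))
  weak : ∀ (α : MultiIndex 3) (φ : Space → ℝ), IsTest R φ →
    ∫ x in cube R, multiDeriv α φ x * U idxZero x =
      (-1 : ℝ) ^ α.order * ∫ x in cube R, φ x * U α x

theorem memLp_indicator {R : ℝ} {v : Space → ℝ}
    (hv : MemLp v 2 ((volume : Measure Space).restrict (cube R))) :
    MemLp ((cube R).indicator v) 2 volume :=
  (memLp_indicator_iff_restrict (measurableSet_cube R)).2 hv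

theorem conv_indicator (R : ℝ) (v ρ : Space → ℝ) (x : Space) :
    conv ((cube R).indicator v) ρ x = ∫ z in cube R, ρ (x - z) * v z := by
  rw [conv_apply, ← integral_indicator (measurableSet_cube R)]
  refine integral_congr_ae (Eventually.of_forall fun z => ?_)
  by_cases hz : z ∈ cube R <;> simp [hz]

/-- At points whose `ρ`-neighbourhood stays in the cube, differentiating a mollified function
amounts to mollifying its weak derivative. -/
theorem multiDeriv_conv_eq {R : ℝ} {U : MultiIndex 3 → Space → ℝ} (hU : IsJet R U)
    (α : MultiIndex 3) {ρ : Space → ℝ} (h : ContDiff ℝ ∞ ρ ∧ HasCompactSupport ρ) {x : Space}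
    (hx : ∀ z, x - z ∈ tsupport ρ → z ∈ cube R) :
    multiDeriv α (conv ((cube R).indicator (U idxZero)) ρ) x =
      conv ((cube R).indicator (U α)) ρ x := by
  have hv : LocallyIntegrable ((cube R).indicator (U idxZero)) :=
    (memLp_indicator (hU.memLp _)).locallyIntegrable (by norm_num)
  have haff : (fun z => ρ (x - z)) = fun z => ρ ((-1 : ℝ) • z + x) := by
    ext z; congr 1; simp [sub_eq_add_neg, add_comm]
  have htest : IsTest R (fun z => ρ (x - z)) := by
    have hts : tsupport (fun z => ρ (x - z)) ⊆ (fun z => x - z) ⁻¹' tsupport ρ :=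
      closure_minimal (fun z hz => subset_tsupport ρ hz)
        ((isClosed_tsupport ρ).preimage (by fun_prop))
    refine ⟨h.1.comp (by fun_prop), ?_, ?_⟩
    · exact h.2.comp_homeomorph (Homeomorph.subLeft x)
    · exact fun z hz => hx z (hts hz)
  rw [multiDeriv_conv α hv h, conv_indicator, conv_indicator]
  have key := hU.weak α _ htest
  rw [haff, multiDeriv_comp_affine α h.1] at key
  have e : ∀ z, (-1 : ℝ) • z + x = x - z := fun z => by simp [sub_eq_add_neg, add_comm]
  simp only [e, mul_assoc] at key
  rw [integral_const_mul] at key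
  exact mul_left_cancel₀ (pow_ne_zero _ (by norm_num)) key

theorem lintegral_comp_affine_le {t : ℝ} (ht : 1 / 2 ≤ t) (b : Space) {r : Space → ENNReal}
    (hr : Measurable r) : ∫⁻ x, r (t • x - b) ≤ 8 * ∫⁻ x, r x := by
  have ht0 : t ≠ 0 := by linarith
  have h1 : ∫⁻ x, r (t • x - b) = ∫⁻ x, r (x - b) ∂(Measure.map (fun x : Space => t • x) volume) := by
    rw [lintegral_map (by fun_prop) (by fun_prop)]
  rw [h1, Measure.map_addHaar_smul volume ht0, lintegral_smul_measure,
    lintegral_sub_right_eq_self r b, smul_eq_mul]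
  gcongr
  have : |(t ^ Module.finrank ℝ Space)⁻¹| ≤ 8 := by
    rw [finrank_euclideanSpace, Fintype.card_fin, abs_of_nonneg (by positivity)]
    rw [inv_le_comm₀ (by positivity) (by norm_num)]
    calc (8 : ℝ)⁻¹ = (1 / 2) ^ 3 := by norm_num
      _ ≤ t ^ 3 := by gcongr
  calc ENNReal.ofReal _ ≤ ENNReal.ofReal 8 := ENNReal.ofReal_le_ofReal this
    _ = 8 := by norm_num

/-- Mollification followed by a dilation with factor at least `1/2` is bounded on `L²`. -/
theorem lintegral_conv_sq_le {v ρ : Space → ℝ} (hv : AEStronglyMeasurable v)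
    (hρ : Continuous ρ) (hρ0 : ∀ x, 0 ≤ ρ x) (hi : Integrable ρ) (h1 : ∫ x, ρ x = 1) {t : ℝ}
    (ht : 1 / 2 ≤ t) :
    ∫⁻ x, ‖conv v ρ (t • x)‖ₑ ^ 2 ≤ 8 * ∫⁻ z, ‖v z‖ₑ ^ 2 := by
  have hmass : ∫⁻ z, ‖ρ z‖ₑ = 1 := by
    have := ofReal_integral_eq_lintegral_ofReal hi (Eventually.of_forall hρ0)
    rw [h1, ENNReal.ofReal_one] at this
    rw [this]
    exact lintegral_congr fun z => by rw [Real.enorm_of_nonneg (hρ0 z)]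
  have hmass' : ∀ x, ∫⁻ z, ‖ρ (x - z)‖ₑ = 1 := fun x => by
    rw [lintegral_sub_left_eq_self (fun z => ‖ρ z‖ₑ) x, hmass]
  have hpt : ∀ x, ‖conv v ρ x‖ₑ ^ 2 ≤ ∫⁻ z, ‖ρ (x - z)‖ₑ * ‖v z‖ₑ ^ 2 := by
    intro x
    have a1 : ‖conv v ρ x‖ₑ ≤
        ∫⁻ z, ‖ρ (x - z)‖ₑ ^ (1 / 2 : ℝ) * (‖ρ (x - z)‖ₑ ^ (1 / 2 : ℝ) * ‖v z‖ₑ) := by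
      rw [conv_apply]
      refine (enorm_integral_le_lintegral_enorm _).trans (le_of_eq ?_)
      refine lintegral_congr fun z => ?_
      rw [enorm_mul, ← mul_assoc, ← ENNReal.rpow_add_of_nonneg _ _ (by norm_num) (by norm_num)]
      norm_num
    have hm : Measurable fun z => ‖ρ (x - z)‖ₑ := by
      have : Continuous fun z => ρ (x - z) := by fun_prop
      exact this.measurable.enorm
    have a2 := ENNReal.lintegral_mul_le_Lp_mul_Lq volume
      (Real.HolderConjugate.two_two) (f := fun z => ‖ρ (x - z)‖ₑ ^ (1 / 2 : ℝ))
      (g := fun z => ‖ρ (x - z)‖ₑ ^ (1 / 2 : ℝ) * ‖v z‖ₑ)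
      (hm.pow_const _).aemeasurable ((hm.pow_const _).aemeasurable.mul hv.enorm)
    have a3 := a1.trans a2
    have e1 : ∫⁻ z, (‖ρ (x - z)‖ₑ ^ (1 / 2 : ℝ)) ^ (2 : ℝ) = 1 := by
      rw [← hmass' x]
      refine lintegral_congr fun z => ?_
      rw [← ENNReal.rpow_mul]; norm_num
    rw [e1] at a3
    simp only [ENNReal.one_rpow, one_mul] at a3
    calc ‖conv v ρ x‖ₑ ^ 2 = ‖conv v ρ x‖ₑ ^ (2 : ℝ) := by norm_cast
      _ ≤ _ := ENNReal.rpow_le_rpow a3 (by norm_num)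
      _ = _ := by
        rw [← ENNReal.rpow_mul]
        norm_num
        refine lintegral_congr fun z => ?_
        rw [mul_pow]
        congr 1
        rw [← ENNReal.rpow_natCast, ← ENNReal.rpow_mul]; norm_num
  have hm2 : AEMeasurable (fun p : Space × Space => ‖ρ (t • p.1 - p.2)‖ₑ * ‖v p.2‖ₑ ^ 2)
      (volume.prod volume) := by
    have c1 : Continuous fun p : Space × Space => ρ (t • p.1 - p.2) := by fun_prop
    have c2 : AEMeasurable (fun p : Space × Space => ‖v p.2‖ₑ ^ 2) (volume.prod volume) :=
      (hv.comp_snd).enorm.pow_const _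
    exact c1.measurable.enorm.aemeasurable.mul c2
  calc ∫⁻ x, ‖conv v ρ (t • x)‖ₑ ^ 2
      ≤ ∫⁻ x, ∫⁻ z, ‖ρ (t • x - z)‖ₑ * ‖v z‖ₑ ^ 2 := lintegral_mono fun x => hpt _
    _ = ∫⁻ z, ∫⁻ x, ‖ρ (t • x - z)‖ₑ * ‖v z‖ₑ ^ 2 := lintegral_lintegral_swap hm2
    _ = ∫⁻ z, (∫⁻ x, ‖ρ (t • x - z)‖ₑ) * ‖v z‖ₑ ^ 2 := by
        refine lintegral_congr fun z => ?_
        rw [lintegral_mul_const]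
        have : Continuous fun x => ρ (t • x - z) := by fun_prop
        exact this.measurable.enorm
    _ ≤ ∫⁻ z, (8 * 1) * ‖v z‖ₑ ^ 2 := by
        refine lintegral_mono fun z => ?_
        gcongr
        rw [← hmass]
        exact lintegral_comp_affine_le ht z hρ.measurable.enorm
    _ = 8 * ∫⁻ z, ‖v z‖ₑ ^ 2 := by
        rw [mul_one, lintegral_const_mul' _ _ (by norm_num)]

theorem eLpNorm_two_sq {X : Type*} [MeasurableSpace X] {E : Type*} [NormedAddCommGroup E]
    (f : X → E) (μ : Measure X) : eLpNorm f 2 μ ^ 2 = ∫⁻ x, ‖f x‖ₑ ^ 2 ∂μ := by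
  have := eLpNorm_nnreal_pow_eq_lintegral (f := f) (μ := μ) (p := 2) (by norm_num)
  simpa [ENNReal.rpow_ofNat] using this

/-- The mollifiers used to approximate functions on the cube; together with the dilation by
`1 - 1 / (n + 2)` they only see values inside the cube. -/
def bump {R : ℝ} (hR : 0 < R) (n : ℕ) : ContDiffBump (0 : Space) where
  rIn := R / (4 * (n + 2))
  rOut := R / (2 * (n + 2))
  rIn_pos := by positivity
  rIn_lt_rOut := by gcongr; norm_num

/-- The dilation factors `1 - 1 / (n + 2)`. -/
def dil (n : ℕ) : ℝ := 1 - 1 / (n + 2)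

theorem half_le_dil (n : ℕ) : 1 / 2 ≤ dil n := by
  have : (1 : ℝ) / (n + 2) ≤ 1 / 2 := by
    gcongr
    linarith [(Nat.cast_nonneg n : (0 : ℝ) ≤ n)]
  rw [dil]; linarith

theorem tendsto_dil : Tendsto dil atTop (𝓝 1) := by
  have h : Tendsto (fun n : ℕ => (1 : ℝ) / ((n + 2 : ℕ) : ℝ)) atTop (𝓝 0) :=
    (tendsto_add_atTop_iff_nat 2).2 tendsto_one_div_atTop_nhds_zero_nat
  have h2 := h.const_sub 1
  rw [sub_zero] at h2
  refine h2.congr fun n => ?_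
  rw [dil]; push_cast; rfl

theorem tendsto_bump {R : ℝ} (hR : 0 < R) : Tendsto (fun n => (bump hR n).rOut) atTop (𝓝 0) := by
  have h : Tendsto (fun n : ℕ => (1 : ℝ) / ((n + 2 : ℕ) : ℝ)) atTop (𝓝 0) :=
    (tendsto_add_atTop_iff_nat 2).2 tendsto_one_div_atTop_nhds_zero_nat
  have h2 := h.const_mul (R / 2)
  rw [mul_zero] at h2
  refine h2.congr fun n => ?_
  simp only [bump]
  push_cast
  field_simp

/-- The mollification kernel. -/
def kernel {R : ℝ} (hR : 0 < R) (n : ℕ) : Space → ℝ := (bump hR n).normed volume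

theorem kernel_smooth {R : ℝ} (hR : 0 < R) (n : ℕ) :
    ContDiff ℝ ∞ (kernel hR n) ∧ HasCompactSupport (kernel hR n) :=
  ⟨(bump hR n).contDiff_normed, (bump hR n).hasCompactSupport_normed⟩

/-- The dilation moves a point of the cube away from the boundary by more than the radius of the
kernel, so mollifying there uses values inside the cube only. -/
theorem mem_cube_of_kernel {R : ℝ} (hR : 0 < R) (n : ℕ) {x z : Space} (hx : x ∈ cube R)
    (hz : dil n • x - z ∈ tsupport (kernel hR n)) : z ∈ cube R := by
  rw [kernel, (bump hR n).tsupport_normed_eq, mem_closedBall_zero_iff] at hz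
  intro i
  have h1 : |dil n * x i - z i| ≤ R / (2 * (n + 2)) := by
    have := (PiLp.norm_apply_le (dil n • x - z) i).trans hz
    simpa [bump] using this
  have h2 : |dil n * x i| ≤ (1 - 1 / (n + 2)) * R := by
    rw [abs_mul, abs_of_nonneg (by linarith [half_le_dil n])]
    exact mul_le_mul_of_nonneg_left (hx i).le (by linarith [half_le_dil n])
  have h3 : |z i| ≤ |dil n * x i| + |dil n * x i - z i| := by
    have := abs_sub (dil n * x i) (dil n * x i - z i)
    simpa using this
  have h4 : 1 / ((n : ℝ) + 2) * R = 2 * (R / (2 * (n + 2))) := by field_simp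
  have h5 : 0 < R / (2 * ((n : ℝ) + 2)) := by positivity
  linarith

/-- Mollify and dilate. -/
def smoothing {R : ℝ} (hR : 0 < R) (n : ℕ) (v : Space → ℝ) (x : Space) : ℝ :=
  conv v (kernel hR n) (dil n • x)

/-- A continuous function with compact support is approximated uniformly on the cube. -/
theorem smoothing_uniform {R : ℝ} (hR : 0 < R) {g : Space → ℝ} (hg : Continuous g)
    (hgc : HasCompactSupport g) {η : ℝ} (hη : 0 < η) :
    ∀ᶠ n in atTop, ∀ x ∈ cube R, |smoothing hR n g x - g x| ≤ η := by
  have hu := Metric.uniformContinuous_iff.1 (hgc.uniformContinuous_of_continuous hg)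
  obtain ⟨θ, hθ, hu⟩ := hu (η / 2) (by positivity)
  obtain ⟨C, hC⟩ := (isCompact_closedCube R).isBounded.exists_norm_le
  have l1 : ∀ᶠ n in atTop, (bump hR n).rOut < θ := (tendsto_bump hR).eventually_lt_const hθ
  have l2 : ∀ᶠ n in atTop, |1 - dil n| * C < θ := by
    have : Tendsto (fun n => |1 - dil n| * C) atTop (𝓝 (|1 - 1| * C)) :=
      ((tendsto_dil.const_sub 1).abs).mul_const C
    exact this.eventually_lt_const (by simpa using hθ)
  filter_upwards [l1, l2] with n h1 h2 x hx
  have a1 : dist (smoothing hR n g x) (g (dil n • x)) ≤ η / 2 := by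
    rw [smoothing, conv, convolution_flip]
    refine (bump hR n).dist_normed_convolution_le hg.aestronglyMeasurable fun y hy => ?_
    exact (hu (lt_trans hy h1)).le
  have a2 : dist (g (dil n • x)) (g x) ≤ η / 2 := by
    refine (hu ?_).le
    rw [dist_comm, dist_eq_norm, ← one_smul ℝ x, smul_smul, mul_one, ← sub_smul, norm_smul]
    refine lt_of_le_of_lt ?_ h2
    exact mul_le_mul_of_nonneg_left (by simpa using hC x (cube_subset_closedCube R hx)) (norm_nonneg _)
  rw [← Real.dist_eq]
  linarith [dist_triangle (smoothing hR n g x) (g (dil n • x)) (g x)]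

theorem smoothing_sub {R : ℝ} (hR : 0 < R) (n : ℕ) {v w : Space → ℝ} (hv : LocallyIntegrable v)
    (hw : LocallyIntegrable w) (x : Space) :
    smoothing hR n (v - w) x = smoothing hR n v x - smoothing hR n w x := by
  have hk := kernel_smooth hR n
  have e1 : Integrable fun z => kernel hR n (dil n • x - z) * v z :=
    (hk.2.convolutionExists_right (ContinuousLinearMap.lsmul ℝ ℝ).flip hv hk.1.continuous
      (dil n • x)).integrable
  have e2 : Integrable fun z => kernel hR n (dil n • x - z) * w z :=
    (hk.2.convolutionExists_right (ContinuousLinearMap.lsmul ℝ ℝ).flip hw hk.1.continuous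
      (dil n • x)).integrable
  simp only [smoothing, conv_apply, Pi.sub_apply, mul_sub]
  exact integral_sub e1 e2

theorem continuous_smoothing {R : ℝ} (hR : 0 < R) (n : ℕ) {v : Space → ℝ}
    (hv : LocallyIntegrable v) : Continuous (smoothing hR n v) :=
  (conv_smooth hv (kernel_smooth hR n)).continuous.comp (by fun_prop)

theorem eLpNorm_smoothing_le {R : ℝ} (hR : 0 < R) (n : ℕ) {v : Space → ℝ}
    (hv : MemLp v 2 volume) :
    eLpNorm (smoothing hR n v) 2 ((volume : Measure Space).restrict (cube R)) ≤
      3 * eLpNorm v 2 volume := by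
  rw [← ENNReal.pow_le_pow_left_iff (n := 2) (by norm_num), mul_pow, eLpNorm_two_sq,
    eLpNorm_two_sq]
  calc ∫⁻ x in cube R, ‖smoothing hR n v x‖ₑ ^ 2 ≤ ∫⁻ x, ‖smoothing hR n v x‖ₑ ^ 2 :=
        setLIntegral_le_lintegral _ _
    _ ≤ 8 * ∫⁻ z, ‖v z‖ₑ ^ 2 :=
        lintegral_conv_sq_le hv.1 (kernel_smooth hR n).1.continuous (bump hR n).nonneg_normed
          (bump hR n).integrable_normed (bump hR n).integral_normed (half_le_dil n)
    _ ≤ 3 ^ 2 * ∫⁻ z, ‖v z‖ₑ ^ 2 := by gcongr; norm_num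

/-- Smoothing converges in `L²` of the cube: the operators are bounded on `L²` uniformly in `n`,
and the convergence is uniform for continuous functions with compact support. -/
theorem tendsto_smoothing {R : ℝ} (hR : 0 < R) {v : Space → ℝ}
    (hv : MemLp v 2 ((volume : Measure Space).restrict (cube R))) :
    Tendsto (fun n => eLpNorm (smoothing hR n ((cube R).indicator v) - v) 2
      ((volume : Measure Space).restrict (cube R))) atTop (𝓝 0) := by
  set μ := (volume : Measure Space).restrict (cube R)
  set w := (cube R).indicator v
  have hw : MemLp w 2 volume := memLp_indicator hv
  rw [ENNReal.tendsto_nhds_zero]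
  intro ε hε
  obtain ⟨ε', hε', hle⟩ : ∃ ε' : NNReal, 0 < ε' ∧ (ε' : ENNReal) * 5 ≤ ε := by
    rcases eq_or_ne ε ⊤ with rfl | hfin
    · exact ⟨1, one_pos, le_top⟩
    · lift ε to NNReal using hfin
      refine ⟨ε / 5, div_pos (by exact_mod_cast hε) (by norm_num), ?_⟩
      rw [← ENNReal.coe_ofNat, ← ENNReal.coe_mul, div_mul_cancel₀ _ (by norm_num)]
  obtain ⟨g, hgc, hgε, hg, hgm⟩ := hw.exists_hasCompactSupport_eLpNorm_sub_le (by norm_num)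
    (ε := ε') (by exact_mod_cast hε'.ne')
  obtain ⟨η, hη, hηle⟩ : ∃ η : ℝ, 0 < η ∧
      μ Set.univ ^ (2 : ENNReal).toReal⁻¹ * ENNReal.ofReal η ≤ ε' := by
    have hfin : μ Set.univ ^ (2 : ENNReal).toReal⁻¹ ≠ ⊤ :=
      ENNReal.rpow_ne_top_of_nonneg (by norm_num) (measure_ne_top _ _)
    set A := (μ Set.univ ^ (2 : ENNReal).toReal⁻¹).toReal with hA
    refine ⟨ε' / (A + 1), by positivity, ?_⟩
    rw [← ENNReal.ofReal_toReal hfin, ← hA, ← ENNReal.ofReal_mul ENNReal.toReal_nonneg,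
      ← ENNReal.ofReal_coe_nnreal]
    apply ENNReal.ofReal_le_ofReal
    have hA0 : 0 ≤ A := ENNReal.toReal_nonneg
    rw [← mul_div_assoc, div_le_iff₀ (by positivity)]
    nlinarith [ε'.2]
  have hwl : LocallyIntegrable w := hw.locallyIntegrable (by norm_num)
  have hgl : LocallyIntegrable g := hg.locallyIntegrable
  filter_upwards [smoothing_uniform hR hg hgc hη] with n hn
  have d : smoothing hR n w - v = smoothing hR n (w - g) + ((smoothing hR n g - g) + (g - v)) := by
    ext x
    simp only [Pi.sub_apply, Pi.add_apply, smoothing_sub hR n hwl hgl]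
    ring
  have m1 : AEStronglyMeasurable (smoothing hR n (w - g)) μ :=
    (continuous_smoothing hR n (hwl.sub hgl)).aestronglyMeasurable
  have m2 : AEStronglyMeasurable (smoothing hR n g - g) μ :=
    ((continuous_smoothing hR n hgl).sub hg).aestronglyMeasurable
  have m3 : AEStronglyMeasurable (g - v) μ := hg.aestronglyMeasurable.sub hv.1
  have b1 : eLpNorm (smoothing hR n (w - g)) 2 μ ≤ 3 * ε' :=
    (eLpNorm_smoothing_le hR n (hw.sub hgm)).trans (by gcongr)
  have b2 : eLpNorm (smoothing hR n g - g) 2 μ ≤ ε' := by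
    refine (eLpNorm_le_of_ae_bound (C := η) ?_).trans hηle
    filter_upwards [ae_restrict_mem (measurableSet_cube R)] with x hx using hn x hx
  have b3 : eLpNorm (g - v) 2 μ ≤ ε' := by
    have e : eLpNorm (g - v) 2 μ = eLpNorm (w - g) 2 μ := by
      rw [eLpNorm_sub_comm]
      refine eLpNorm_congr_ae ?_
      filter_upwards [ae_restrict_mem (measurableSet_cube R)] with x hx
      simp [w, hx]
    rw [e]
    exact (eLpNorm_mono_measure _ Measure.restrict_le_self).trans hgε
  rw [d]
  calc _ ≤ eLpNorm (smoothing hR n (w - g)) 2 μ + (eLpNorm (smoothing hR n g - g) 2 μ +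
        eLpNorm (g - v) 2 μ) :=
        (eLpNorm_add_le m1 (m2.add m3) (by norm_num)).trans
          (by gcongr; exact eLpNorm_add_le m2 m3 (by norm_num))
    _ ≤ 3 * ε' + (ε' + ε') := by gcongr
    _ = ε' * 5 := by ring
    _ ≤ ε := hle

/-- Smooth functions are dense in `H³` of the cube. Mollifying the extension of the function by
zero and dilating commutes with weak derivatives inside the cube, up to the factor
`(1 - 1 / (n + 2)) ^ |α|`. -/
theorem IsJet.exists_smooth {R : ℝ} (hR : 0 < R) {U : MultiIndex 3 → Space → ℝ}
    (hU : IsJet R U) :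
    ∃ F : ℕ → Space → ℝ, (∀ n, ContDiff ℝ ∞ (F n)) ∧ ∀ α, Tendsto
      (fun n => eLpNorm (multiDeriv α (F n) - U α) 2 ((volume : Measure Space).restrict (cube R)))
      atTop (𝓝 0) := by
  set μ := (volume : Measure Space).restrict (cube R)
  have hl : ∀ α, LocallyIntegrable ((cube R).indicator (U α)) := fun α =>
    (memLp_indicator (hU.memLp _)).locallyIntegrable (by norm_num)
  refine ⟨fun n => smoothing hR n ((cube R).indicator (U idxZero)), fun n => ?_, fun α => ?_⟩
  · exact (conv_smooth (hl _) (kernel_smooth hR n)).comp (by fun_prop)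
  · have hder : ∀ n, ∀ x ∈ cube R,
        multiDeriv α (smoothing hR n ((cube R).indicator (U idxZero))) x =
          dil n ^ α.order * smoothing hR n ((cube R).indicator (U α)) x := by
      intro n x hx
      have e : smoothing hR n ((cube R).indicator (U idxZero)) = fun x =>
          conv ((cube R).indicator (U idxZero)) (kernel hR n) (dil n • x + 0) := by
        ext x; simp [smoothing]
      rw [e, multiDeriv_comp_affine α (conv_smooth (hl _) (kernel_smooth hR n))]
      simp only [add_zero]
      rw [multiDeriv_conv_eq hU α (kernel_smooth hR n) fun z hz => mem_cube_of_kernel hR n hx hz]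
      rfl
    have hbd : ∀ n, eLpNorm (multiDeriv α (smoothing hR n ((cube R).indicator (U idxZero))) - U α)
        2 μ ≤ eLpNorm (smoothing hR n ((cube R).indicator (U α)) - U α) 2 μ +
          ‖dil n ^ α.order - 1‖ₑ * eLpNorm (U α) 2 μ := by
      intro n
      set a := dil n ^ α.order
      have ha : ‖a‖ₑ ≤ 1 := by
        have h0 : 0 ≤ dil n := by linarith [half_le_dil n]
        have h1 : dil n ≤ 1 := by rw [dil]; linarith [show (0 : ℝ) ≤ 1 / (n + 2) by positivity]
        rw [Real.enorm_of_nonneg (pow_nonneg h0 _), ← ENNReal.ofReal_one]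
        exact ENNReal.ofReal_le_ofReal (pow_le_one₀ h0 h1)
      have e : multiDeriv α (smoothing hR n ((cube R).indicator (U idxZero))) - U α =ᵐ[μ]
          a • (smoothing hR n ((cube R).indicator (U α)) - U α) + (a - 1) • U α := by
        filter_upwards [ae_restrict_mem (measurableSet_cube R)] with x hx
        simp only [Pi.sub_apply, Pi.add_apply, Pi.smul_apply, hder n x hx, smul_eq_mul]
        ring
      rw [eLpNorm_congr_ae e]
      have m1 : AEStronglyMeasurable (smoothing hR n ((cube R).indicator (U α)) - U α) μ :=
        (continuous_smoothing hR n (hl α)).aestronglyMeasurable.sub (hU.memLp α).1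
      refine (eLpNorm_add_le (m1.const_smul a) ((hU.memLp α).1.const_smul _) (by norm_num)).trans ?_
      rw [eLpNorm_const_smul, eLpNorm_const_smul]
      gcongr
      calc _ ≤ 1 * eLpNorm (smoothing hR n ((cube R).indicator (U α)) - U α) 2 μ := by gcongr
        _ = _ := one_mul _
    have hlim : Tendsto (fun n => eLpNorm (smoothing hR n ((cube R).indicator (U α)) - U α) 2 μ +
          ‖dil n ^ α.order - 1‖ₑ * eLpNorm (U α) 2 μ) atTop (𝓝 (0 + 0 * eLpNorm (U α) 2 μ)) := by
      refine (tendsto_smoothing hR (hU.memLp α)).add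
        (ENNReal.Tendsto.mul_const ?_ (Or.inr (hU.memLp α).2.ne))
      have : Tendsto (fun n => dil n ^ α.order - 1) atTop (𝓝 (1 ^ α.order - 1)) :=
        (tendsto_dil.pow _).sub_const 1
      rw [one_pow, sub_self] at this
      simpa [Function.comp_def] using (continuous_enorm.tendsto (0 : ℝ)).comp this
    rw [zero_mul, add_zero] at hlim
    exact tendsto_of_tendsto_of_tendsto_of_le_of_le tendsto_const_nhds hlim
      (fun _ => zero_le) hbd

/-! ### Sobolev inequalities on the cube -/

/-- Integrals over the cube are integrals over a product of intervals. -/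
theorem lintegral_cube (R : ℝ) (f : Space → ENNReal) :
    ∫⁻ x in cube R, f x = ∫⁻ y, f (WithLp.toLp 2 y)
      ∂(Measure.pi fun _ : Fin 3 => (volume : Measure ℝ).restrict (Ioo (-R) R)) := by
  have hmp := EuclideanSpace.volume_preserving_symm_measurableEquiv_toLp (Fin 3)
  have h := hmp.symm.setLIntegral_comp_preimage_emb
    (MeasurableEquiv.measurableEmbedding _) f (cube R)
  rw [← h]
  have e : (Measure.pi fun _ : Fin 3 => (volume : Measure ℝ).restrict (Ioo (-R) R)) =
      (volume : Measure (Fin 3 → ℝ)).restrict (Set.pi univ fun _ => Ioo (-R) R) := by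
    rw [volume_pi, Measure.restrict_pi_pi]
  rw [e]
  congr 2
  ext y
  simp [cube, abs_lt]

/-- In one variable, a value of a `C¹` function is at most its mean plus the total variation. -/
theorem le_mean_add_variation {R : ℝ} (hR : 0 < R) {φ φ' : ℝ → ℝ}
    (hφ : ∀ s, HasDerivAt φ (φ' s) s) (hc : Continuous φ') {t : ℝ} (ht : t ∈ Ioo (-R) R) :
    φ t ≤ ∫ s in Ioo (-R) R, (φ s / (2 * R) + |φ' s|) := by
  have hφc : Continuous φ := continuous_iff_continuousAt.2 fun s => (hφ s).continuousAt
  set A := ∫ s in Ioo (-R) R, |φ' s|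
  have hint : ∀ {g : ℝ → ℝ}, Continuous g → IntegrableOn g (Ioo (-R) R) := fun hg =>
    (hg.integrableOn_Icc).mono_set Ioo_subset_Icc_self
  have h1 : ∀ s ∈ Ioo (-R) R, φ t ≤ φ s + A := by
    intro s hs
    have e : ∫ x in s..t, φ' x = φ t - φ s :=
      intervalIntegral.integral_eq_sub_of_hasDerivAt (fun x _ => hφ x) (hc.intervalIntegrable _ _)
    have b : ‖∫ x in s..t, φ' x‖ ≤ ∫ x in uIoc s t, ‖φ' x‖ :=
      intervalIntegral.norm_integral_le_integral_norm_uIoc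
    have b2 : ∫ x in uIoc s t, ‖φ' x‖ ≤ A := by
      refine setIntegral_mono_set (hint hc.abs) (Eventually.of_forall fun x => abs_nonneg _)
        (Eventually.of_forall fun x (hx : x ∈ uIoc s t) => ?_)
      rw [uIoc, mem_Ioc] at hx
      change x ∈ Ioo (-R) R
      exact ⟨lt_of_le_of_lt (le_min hs.1.le ht.1.le) hx.1, lt_of_le_of_lt hx.2 (max_lt hs.2 ht.2)⟩
    rw [e] at b
    linarith [le_abs_self (φ t - φ s), Real.norm_eq_abs (φ t - φ s)]
  have hvol : (volume.restrict (Ioo (-R) R)).real univ = 2 * R := by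
    rw [measureReal_restrict_apply_univ, Real.volume_real_Ioo_of_le (by linarith)]; ring
  have h2 : ∫ _s in Ioo (-R) R, φ t ≤ ∫ s in Ioo (-R) R, (φ s + A) :=
    setIntegral_mono_on (integrableOn_const (by simp) (by simp)) ((hint hφc).add
      (integrableOn_const (by simp) (by simp))) measurableSet_Ioo h1
  rw [integral_add (hint hφc) (integrableOn_const (by simp) (by simp)), integral_const,
    integral_const, hvol, smul_eq_mul, smul_eq_mul] at h2
  rw [integral_add ((hint hφc).div_const _) (hint hc.abs), integral_div]
  have h3 : φ t ≤ (∫ s in Ioo (-R) R, φ s) / (2 * R) + A := by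
    rw [← sub_le_iff_le_add, le_div_iff₀ (by positivity)]
    linarith
  exact h3

theorem partialDeriv_continuous (i : Fin 3) {F : Space → ℝ} (hF : ContDiff ℝ 1 F) :
    Continuous (partialDeriv i F) :=
  (hF.continuous_fderiv (by simp)).clm_apply continuous_const

theorem hasDerivAt_update {F : Space → ℝ} (hF : ContDiff ℝ 1 F) (y : Fin 3 → ℝ) (i : Fin 3)
    (s : ℝ) : HasDerivAt (fun s => F (WithLp.toLp 2 (Function.update y i s)))
      (partialDeriv i F (WithLp.toLp 2 (Function.update y i s))) s := by
  have h1 : HasDerivAt (fun s => (WithLp.toLp 2 (Function.update y i s) : Space))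
      (EuclideanSpace.single i 1) s :=
    ((PiLp.continuousLinearEquiv 2 ℝ (fun _ : Fin 3 => ℝ)).symm.hasFDerivAt).comp_hasDerivAt s
      (_root_.hasDerivAt_update y i s)
  exact ((hF.differentiable (by simp)).differentiableAt.hasFDerivAt).comp_hasDerivAt s h1

theorem continuous_toLp_update (y : Fin 3 → ℝ) (i : Fin 3) :
    Continuous fun s : ℝ => (WithLp.toLp 2 (Function.update y i s) : Space) :=
  (PiLp.continuous_toLp 2 _).comp (continuous_const.update i continuous_id)

theorem memLp_of_continuous {R : ℝ} {F : Space → ℝ} (hF : Continuous F) (p : ENNReal) :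
    MemLp F p ((volume : Measure Space).restrict (cube R)) := by
  obtain ⟨C, hC⟩ := (isCompact_closedCube R).exists_bound_of_continuousOn hF.continuousOn
  refine MemLp.of_bound hF.aestronglyMeasurable C ?_
  filter_upwards [ae_restrict_mem (measurableSet_cube R)] with x hx
    using hC x (cube_subset_closedCube R hx)

theorem eLpNorm_six_pow {X : Type*} [MeasurableSpace X] {E : Type*} [NormedAddCommGroup E]
    (f : X → E) (μ : Measure X) : eLpNorm f 6 μ ^ 6 = ∫⁻ x, ‖f x‖ₑ ^ 6 ∂μ := by
  have := eLpNorm_nnreal_pow_eq_lintegral (f := f) (μ := μ) (p := 6) (by norm_num)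
  simpa [ENNReal.rpow_ofNat] using this

/-- `W^{1,2} ⊂ L⁶` on the three-dimensional cube: the grid-lines lemma is applied to `F⁴`. -/
theorem eLpNorm_six_le {R : ℝ} (hR : 0 < R) : ∃ C : NNReal, ∀ F : Space → ℝ, ContDiff ℝ 1 F →
    eLpNorm F 6 ((volume : Measure Space).restrict (cube R)) ≤
      C * (eLpNorm F 2 ((volume : Measure Space).restrict (cube R)) +
        ∑ i, eLpNorm (partialDeriv i F) 2 ((volume : Measure Space).restrict (cube R))) := by
  set μ := (volume : Measure Space).restrict (cube R) with hμ
  have hCR : (0 : ℝ) ≤ 1 / (2 * R) + 4 := by positivity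
  refine ⟨Real.toNNReal (1 / (2 * R) + 4), fun F hF => ?_⟩
  set c : Space → ℝ := fun x => |F x| / (2 * R) + 4 * ∑ i, |partialDeriv i F x| with hc
  have hpc : ∀ i, Continuous (partialDeriv i F) := fun i => partialDeriv_continuous i hF
  have hcc : Continuous c := by have := hF.continuous; fun_prop
  have hc0 : ∀ x, 0 ≤ c x := fun x => by positivity
  set H : Space → ℝ := fun x => |F x| ^ 3 * c x with hH
  have hHc : Continuous H := by have := hF.continuous; fun_prop
  have hH0 : ∀ x, 0 ≤ H x := fun x => mul_nonneg (by positivity) (hc0 x)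
  have hline : ∀ (y : Fin 3 → ℝ) (i : Fin 3), y i ∈ Ioo (-R) R →
      ENNReal.ofReal (F (WithLp.toLp 2 y) ^ 4) ≤
      ∫⁻ s in Ioo (-R) R, ENNReal.ofReal (H (WithLp.toLp 2 (Function.update y i s))) := by
    intro y i hy
    have hcl := continuous_toLp_update y i
    have h1 := le_mean_add_variation hR
      (φ := fun s => F (WithLp.toLp 2 (Function.update y i s)) ^ 4)
      (φ' := fun s => 4 * F (WithLp.toLp 2 (Function.update y i s)) ^ 3 *
        partialDeriv i F (WithLp.toLp 2 (Function.update y i s)))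
      (fun s => ((hasDerivAt_update hF y i s).fun_pow 4).congr_deriv (by norm_num))
      (by have h1 := hF.continuous.comp hcl
          have h2 := (hpc i).comp hcl
          simp only [Function.comp_def] at h1 h2
          fun_prop) hy
    simp only [Function.update_eq_self] at h1
    have hcH : Continuous fun s => H (WithLp.toLp 2 (Function.update y i s)) := hHc.comp hcl
    rw [← ofReal_integral_eq_lintegral_ofReal
      ((hcH.integrableOn_Icc).mono_set Ioo_subset_Icc_self)
      (Eventually.of_forall fun s => hH0 _)]
    refine ENNReal.ofReal_le_ofReal (h1.trans ?_)
    refine integral_mono_of_nonneg (Eventually.of_forall fun s => by positivity)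
      ((hcH.integrableOn_Icc).mono_set Ioo_subset_Icc_self) (Eventually.of_forall fun s => ?_)
    simp only [hH, hc]
    set x : Space := WithLp.toLp 2 (Function.update y i s)
    have e1 : |F x| ^ 4 = F x ^ 4 := by rw [← abs_pow, abs_of_nonneg (by positivity)]
    have e2 : |4 * F x ^ 3 * partialDeriv i F x| = 4 * (|F x| ^ 3 * |partialDeriv i F x|) := by
      rw [abs_mul, abs_mul, abs_pow]; norm_num [mul_assoc]
    have e3 : |partialDeriv i F x| ≤ ∑ j, |partialDeriv j F x| :=
      Finset.single_le_sum (f := fun j => |partialDeriv j F x|) (fun j _ => abs_nonneg _)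
        (Finset.mem_univ i)
    rw [e2, ← e1]
    have e4 := mul_le_mul_of_nonneg_left e3 (pow_nonneg (abs_nonneg (F x)) 3)
    calc |F x| ^ 4 / (2 * R) + 4 * (|F x| ^ 3 * |partialDeriv i F x|)
        ≤ |F x| ^ 4 / (2 * R) + 4 * (|F x| ^ 3 * ∑ j, |partialDeriv j F x|) := by linarith
      _ = |F x| ^ 3 * (|F x| / (2 * R) + 4 * ∑ i, |partialDeriv i F x|) := by ring
  set X := ∫⁻ x, ‖F x‖ₑ ^ 6 ∂μ with hX
  set Y := ∫⁻ x, ‖c x‖ₑ ^ 2 ∂μ with hY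
  -- finiteness of `∫ F⁶` allows to cancel it in `X ≤ X ^ (3/4) * Y ^ (3/4)`
  have hXfin : X ≠ ⊤ := by
    rw [hX, ← eLpNorm_six_pow]
    exact ENNReal.pow_ne_top (memLp_of_continuous hF.continuous 6).2.ne
  -- the grid-lines lemma for `F⁴`, which is bounded on each line by the integral of `H`
  have hgrid : X ≤ (∫⁻ x, ENNReal.ofReal (H x) ∂μ) ^ (3 / 2 : ℝ) := by
    set ν : Fin 3 → Measure ℝ := fun _ => (volume : Measure ℝ).restrict (Ioo (-R) R)
    have hconj : Real.HolderConjugate (Fintype.card (Fin 3)) (3 / 2) := by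
      rw [Fintype.card_fin]; push_cast
      exact Real.holderConjugate_iff.2 ⟨by norm_num, by norm_num⟩
    have hm : Measurable fun y : Fin 3 → ℝ => ENNReal.ofReal (H (WithLp.toLp 2 y)) :=
      (hHc.comp (PiLp.continuous_toLp 2 _)).measurable.ennreal_ofReal
    have g := lintegral_prod_lintegral_pow_le ν hconj hm
    rw [hX, hμ, lintegral_cube, lintegral_cube]
    refine le_trans (lintegral_mono_ae ?_) g
    have hae : ∀ᵐ y ∂(Measure.pi ν), ∀ i, y i ∈ Ioo (-R) R := by
      have e : Measure.pi ν = (Measure.pi fun _ => (volume : Measure ℝ)).restrict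
          (Set.pi univ fun _ => Ioo (-R) R) := (Measure.restrict_pi_pi _ _).symm
      rw [e]
      filter_upwards [ae_restrict_mem (MeasurableSet.univ_pi fun _ => measurableSet_Ioo)]
        with y hy i using hy i (mem_univ i)
    filter_upwards [hae] with y hy
    have e : ‖F (WithLp.toLp 2 y)‖ₑ ^ 6 =
        ∏ _i : Fin 3, ENNReal.ofReal (F (WithLp.toLp 2 y) ^ 4) ^ (1 / 2 : ℝ) := by
      rw [Finset.prod_const, Finset.card_univ, Fintype.card_fin]
      have e1 : ENNReal.ofReal (F (WithLp.toLp 2 y) ^ 4) = ‖F (WithLp.toLp 2 y)‖ₑ ^ 4 := by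
        rw [← enorm_pow, Real.enorm_of_nonneg (by positivity)]
      rw [e1, ← ENNReal.rpow_natCast, ← ENNReal.rpow_natCast, ← ENNReal.rpow_mul,
        ← ENNReal.rpow_natCast, ← ENNReal.rpow_mul]
      norm_num
    rw [e]
    refine Finset.prod_le_prod' fun i _ => ?_
    rw [Fintype.card_fin]
    norm_num only
    exact ENNReal.rpow_le_rpow (hline y i (hy i)) (by norm_num)
  -- Cauchy-Schwarz, as `H = |F|³ c`
  have hCS : ∫⁻ x, ENNReal.ofReal (H x) ∂μ ≤ X ^ (1 / 2 : ℝ) * Y ^ (1 / 2 : ℝ) := by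
    have h := ENNReal.lintegral_mul_le_Lp_mul_Lq μ Real.HolderConjugate.two_two
      (f := fun x => ‖F x‖ₑ ^ 3) (g := fun x => ‖c x‖ₑ)
      (hF.continuous.measurable.enorm.pow_const 3).aemeasurable hcc.measurable.enorm.aemeasurable
    refine le_trans (le_of_eq (lintegral_congr fun x => ?_)) (h.trans (le_of_eq ?_))
    · simp only [hH, Pi.mul_apply]
      rw [← enorm_pow, ← enorm_mul, Real.enorm_eq_ofReal_abs, abs_mul, abs_pow,
        abs_of_nonneg (hc0 x)]
    · rw [hX, hY]
      congr 3 <;> ext x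
      · rw [← ENNReal.rpow_natCast, ← ENNReal.rpow_mul, ← ENNReal.rpow_natCast]; norm_num
      · norm_cast
  have hXY : X ≤ Y ^ 3 := by
    rcases eq_or_ne X 0 with h0 | h0
    · rw [h0]; exact zero_le
    have h1 : X ≤ X ^ (3 / 4 : ℝ) * Y ^ (3 / 4 : ℝ) := by
      refine hgrid.trans ((ENNReal.rpow_le_rpow hCS (by norm_num)).trans (le_of_eq ?_))
      rw [ENNReal.mul_rpow_of_nonneg _ _ (by norm_num), ← ENNReal.rpow_mul, ← ENNReal.rpow_mul]
      norm_num
    have h2 : X = X ^ (3 / 4 : ℝ) * X ^ (1 / 4 : ℝ) := by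
      rw [← ENNReal.rpow_add _ _ h0 hXfin]; norm_num
    have h3 : X ^ (1 / 4 : ℝ) ≤ Y ^ (3 / 4 : ℝ) := by
      have h5 : X ^ (3 / 4 : ℝ) * X ^ (1 / 4 : ℝ) ≤ X ^ (3 / 4 : ℝ) * Y ^ (3 / 4 : ℝ) :=
        h2.symm.le.trans h1
      exact (ENNReal.mul_le_mul_iff_right (by simp [h0, hXfin])
        (ENNReal.rpow_ne_top_of_nonneg (by norm_num) hXfin)).1 h5
    have h4 := ENNReal.rpow_le_rpow h3 (z := 4) (by norm_num)
    rw [← ENNReal.rpow_mul, ← ENNReal.rpow_mul] at h4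
    norm_num at h4
    exact h4
  have h6 : eLpNorm F 6 μ ≤ eLpNorm c 2 μ := by
    rw [← ENNReal.pow_le_pow_left_iff (n := 6) (by norm_num), eLpNorm_six_pow]
    calc X ≤ Y ^ 3 := hXY
      _ = (eLpNorm c 2 μ ^ 2) ^ 3 := by rw [eLpNorm_two_sq]
      _ = _ := by rw [← pow_mul]
  refine h6.trans ?_
  have hceq : c = (1 / (2 * R)) • (fun x => ‖F x‖) +
      (4 : ℝ) • ∑ i, (fun x => ‖partialDeriv i F x‖) := by
    ext x
    simp [hc]; ring
  have m1 : AEStronglyMeasurable (fun x => ‖F x‖) μ := hF.continuous.norm.aestronglyMeasurable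
  have m2 : ∀ i, AEStronglyMeasurable (fun x => ‖partialDeriv i F x‖) μ := fun i =>
    (hpc i).norm.aestronglyMeasurable
  rw [hceq]
  refine (eLpNorm_add_le (m1.const_smul _) ((Finset.aestronglyMeasurable_sum _
    fun i _ => m2 i).const_smul _) (by norm_num)).trans ?_
  rw [eLpNorm_const_smul, eLpNorm_const_smul, eLpNorm_norm, mul_add]
  have hC1 : ‖1 / (2 * R)‖ₑ ≤ (Real.toNNReal (1 / (2 * R) + 4) : ENNReal) := by
    rw [Real.enorm_of_nonneg (by positivity)]
    exact ENNReal.ofReal_le_ofReal (by simp)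
  have hC2 : ‖(4 : ℝ)‖ₑ ≤ (Real.toNNReal (1 / (2 * R) + 4) : ENNReal) := by
    rw [Real.enorm_of_nonneg (by positivity)]
    exact ENNReal.ofReal_le_ofReal (by simp; positivity)
  refine add_le_add (mul_le_mul' hC1 le_rfl) (mul_le_mul' hC2 ?_)
  refine (eLpNorm_sum_le (fun i _ => m2 i) (by norm_num)).trans (le_of_eq ?_)
  exact Finset.sum_congr rfl fun i _ => eLpNorm_norm _

theorem fderiv_apply_eq_sum {F : Space → ℝ} (x v : Space) :
    fderiv ℝ F x v = ∑ i, v i * partialDeriv i F x := by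
  conv_lhs => rw [← (EuclideanSpace.basisFun (Fin 3) ℝ).sum_repr v]
  simp [partialDeriv]

theorem convexCombination_mem_cube {R : ℝ} {x y : Space} (hx : x ∈ closedCube R) (hy : y ∈ cube R)
    {t : ℝ} (ht : t ∈ Ioo (0 : ℝ) 1) : t • y + (1 - t) • x ∈ cube R := by
  intro i
  have h1 : |t * y i| < t * R := by
    rw [abs_mul, abs_of_pos ht.1]; exact mul_lt_mul_of_pos_left (hy i) ht.1
  have h2 : |(1 - t) * x i| ≤ (1 - t) * R := by
    have h0 : 0 ≤ 1 - t := by linarith [ht.2]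
    rw [abs_mul, abs_of_nonneg h0]; exact mul_le_mul_of_nonneg_left (hx i) h0
  calc |(t • y + (1 - t) • x) i| = |t * y i + (1 - t) * x i| := by simp
    _ ≤ |t * y i| + |(1 - t) * x i| := abs_add_le _ _
    _ < R := by linarith

theorem lintegral_comp_affine {t : ℝ} (ht : 0 < t) (b : Space) {r : Space → ENNReal}
    (hr : Measurable r) :
    ∫⁻ x, r (t • x + b) = ENNReal.ofReal (t ^ 3)⁻¹ * ∫⁻ x, r x := by
  have h1 : ∫⁻ x, r (t • x + b) = ∫⁻ x, r (x + b) ∂(Measure.map (fun x : Space => t • x) volume) := by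
    rw [lintegral_map (by fun_prop) (by fun_prop)]
  rw [h1, Measure.map_addHaar_smul volume ht.ne', lintegral_smul_measure,
    lintegral_add_right_eq_self r b, smul_eq_mul, finrank_euclideanSpace, Fintype.card_fin,
    abs_of_nonneg (by positivity)]

/-- Contracting the cube towards a point costs a factor `t ^ (-1/2)` in `L⁶`, which is integrable
in `t`. This makes Morrey's inequality work. -/
theorem lintegral_contraction_le {R : ℝ} {b : Space → ℝ} (hb : Continuous b) {x : Space}
    (hx : x ∈ closedCube R) {t : ℝ} (ht : t ∈ Ioo (0 : ℝ) 1) :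
    ∫⁻ y in cube R, ‖b (t • y + (1 - t) • x)‖ₑ ≤
      ENNReal.ofReal (t ^ (-1 / 2 : ℝ)) *
        (eLpNorm b 6 ((volume : Measure Space).restrict (cube R)) *
          volume (cube R) ^ (5 / 6 : ℝ)) := by
  set μ := (volume : Measure Space).restrict (cube R) with hμ
  set g : Space → ℝ := fun y => b (t • y + (1 - t) • x)
  have hg : Continuous g := by fun_prop
  have h1 : eLpNorm g 1 μ ≤ eLpNorm g 6 μ * volume (cube R) ^ (5 / 6 : ℝ) := by
    have := eLpNorm_le_eLpNorm_mul_rpow_measure_univ (p := 1) (q := 6) (μ := μ) (by norm_num)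
      hg.aestronglyMeasurable
    rw [hμ, Measure.restrict_apply_univ] at this
    refine this.trans (le_of_eq ?_)
    norm_num
    rfl
  have h2 : eLpNorm g 6 μ ≤ ENNReal.ofReal (t ^ (-1 / 2 : ℝ)) * eLpNorm b 6 μ := by
    rw [← ENNReal.pow_le_pow_left_iff (n := 6) (by norm_num), mul_pow, eLpNorm_six_pow,
      eLpNorm_six_pow, hμ]
    have e : ENNReal.ofReal (t ^ (-1 / 2 : ℝ)) ^ 6 = ENNReal.ofReal (t ^ 3)⁻¹ := by
      rw [← ENNReal.ofReal_pow (Real.rpow_nonneg ht.1.le _), ← Real.rpow_natCast,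
        ← Real.rpow_mul ht.1.le, ← Real.rpow_natCast t, ← Real.rpow_neg ht.1.le]
      norm_num
    rw [e, ← lintegral_indicator (measurableSet_cube R), ← lintegral_indicator (measurableSet_cube R),
      ← lintegral_comp_affine ht.1 ((1 - t) • x)
        ((hb.measurable.enorm.pow_const 6).indicator (measurableSet_cube R))]
    refine lintegral_mono fun y => ?_
    by_cases hy : y ∈ cube R
    · rw [indicator_of_mem hy, indicator_of_mem (convexCombination_mem_cube hx hy ht)]
    · rw [indicator_of_notMem hy]; exact zero_le
  rw [eLpNorm_one_eq_lintegral_enorm] at h1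
  refine h1.trans ?_
  rw [← mul_assoc]
  gcongr

/-- The mean value inequality along a segment. -/
theorem enorm_le_segment {R : ℝ} (hR : 0 < R) {F : Space → ℝ} (hF : ContDiff ℝ 1 F) {x y : Space}
    (hx : x ∈ closedCube R) (hy : y ∈ cube R) :
    ‖F x‖ₑ ≤ ‖F y‖ₑ + ENNReal.ofReal (2 * R) *
      ∫⁻ t in Ioo (0 : ℝ) 1, ‖∑ i, |partialDeriv i F (t • y + (1 - t) • x)|‖ₑ := by
  set γ : ℝ → Space := fun t => t • y + (1 - t) • x
  have hγc : Continuous γ := by fun_prop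
  have hγ : ∀ t, HasDerivAt γ (y - x) t := fun t => by
    have h1 := (hasDerivAt_id t).smul_const y
    have h2 := ((hasDerivAt_id t).const_sub 1).smul_const x
    have h3 := h1.add h2
    simp only [one_smul, neg_smul, ← sub_eq_add_neg] at h3
    exact h3
  have hd : ∀ t, HasDerivAt (fun t => F (γ t)) (fderiv ℝ F (γ t) (y - x)) t := fun t =>
    ((hF.differentiable (by simp)).differentiableAt.hasFDerivAt).comp_hasDerivAt t (hγ t)
  have hdc : Continuous fun t => fderiv ℝ F (γ t) (y - x) :=
    ((hF.continuous_fderiv (by simp)).comp hγc).clm_apply continuous_const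
  have e : ∫ t in (0 : ℝ)..1, fderiv ℝ F (γ t) (y - x) = F y - F x := by
    rw [intervalIntegral.integral_eq_sub_of_hasDerivAt (fun t _ => hd t)
      (hdc.intervalIntegrable _ _)]
    simp [γ]
  have e2 : F x = F y - ∫ t in Ioo (0 : ℝ) 1, fderiv ℝ F (γ t) (y - x) := by
    rw [← integral_Ioc_eq_integral_Ioo, ← intervalIntegral.integral_of_le zero_le_one, e]; ring
  rw [e2]
  refine enorm_sub_le.trans ?_
  gcongr
  refine (enorm_integral_le_lintegral_enorm _).trans ?_
  rw [← lintegral_const_mul' _ _ ENNReal.ofReal_ne_top]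
  refine lintegral_mono fun t => ?_
  rw [← Real.enorm_of_nonneg (by positivity), ← enorm_mul, Real.enorm_eq_ofReal_abs,
    Real.enorm_eq_ofReal_abs]
  refine ENNReal.ofReal_le_ofReal ?_
  rw [fderiv_apply_eq_sum, abs_of_nonneg (a := 2 * R * _) (by positivity), Finset.mul_sum]
  refine (Finset.abs_sum_le_sum_abs _ _).trans (Finset.sum_le_sum fun i _ => ?_)
  rw [abs_mul]
  gcongr
  have := abs_sub (y i) (x i)
  simp only [PiLp.sub_apply]
  linarith [hx i, (hy i).le]

theorem volume_cube_pos {R : ℝ} (hR : 0 < R) : 0 < volume (cube R) :=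
  (isOpen_cube R).measure_pos _ ⟨0, fun i => by simpa using hR⟩

theorem volume_cube_lt_top (R : ℝ) : volume (cube R) < ⊤ :=
  lt_of_le_of_lt (measure_mono (cube_subset_closedCube R)) (isCompact_closedCube R).measure_lt_top

/-- Morrey's inequality on the cube: average over `y` the mean value inequality on the segment from
`x` to `y`, and exchange the integrals. -/
theorem enorm_le_morrey {R : ℝ} (hR : 0 < R) : ∃ C : NNReal, ∀ F : Space → ℝ, ContDiff ℝ 1 F →
    ∀ x ∈ closedCube R, ‖F x‖ₑ ≤
      C * (eLpNorm F 2 ((volume : Measure Space).restrict (cube R)) +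
        ∑ i, eLpNorm (partialDeriv i F) 6 ((volume : Measure Space).restrict (cube R))) := by
  set μ := (volume : Measure Space).restrict (cube R) with hμ
  set m := volume (cube R) with hm
  have hm0 : m ≠ 0 := (volume_cube_pos hR).ne'
  have hmt : m ≠ ⊤ := (volume_cube_lt_top R).ne
  set T := ∫⁻ t in Ioo (0 : ℝ) 1, ENNReal.ofReal (t ^ (-1 / 2 : ℝ)) with hT
  have hTfin : T ≠ ⊤ := by
    have hi : IntegrableOn (fun t : ℝ => t ^ (-1 / 2 : ℝ)) (Ioo 0 1) :=
      ((intervalIntegral.intervalIntegrable_rpow' (by norm_num)).1).mono_set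
        Ioo_subset_Ioc_self
    have := hi.lintegral_lt_top
    exact this.ne
  set K : ENNReal := m⁻¹ * (m ^ (1 / 2 : ℝ) + ENNReal.ofReal (2 * R) * (T * m ^ (5 / 6 : ℝ)))
  have hK : K ≠ ⊤ := by
    refine ENNReal.mul_ne_top (ENNReal.inv_ne_top.2 hm0) (ENNReal.add_ne_top.2 ⟨?_, ?_⟩)
    · exact ENNReal.rpow_ne_top_of_nonneg (by norm_num) hmt
    · exact ENNReal.mul_ne_top ENNReal.ofReal_ne_top (ENNReal.mul_ne_top hTfin
        (ENNReal.rpow_ne_top_of_nonneg (by norm_num) hmt))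
  refine ⟨K.toNNReal, fun F hF x hx => ?_⟩
  rw [ENNReal.coe_toNNReal hK]
  set b : Space → ℝ := fun z => ∑ i, |partialDeriv i F z|
  have hpc : ∀ i, Continuous (partialDeriv i F) := fun i => partialDeriv_continuous i hF
  have hbc : Continuous b := by fun_prop
  set S := ∑ i, eLpNorm (partialDeriv i F) 6 μ with hS
  have hbS : eLpNorm b 6 μ ≤ S := by
    have : b = ∑ i, fun z => ‖partialDeriv i F z‖ := by ext z; simp [b]
    rw [this]
    refine (eLpNorm_sum_le (fun i _ => (hpc i).norm.aestronglyMeasurable) (by norm_num)).trans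
      (le_of_eq ?_)
    exact Finset.sum_congr rfl fun i _ => eLpNorm_norm _
  have hF1 : ∫⁻ y in cube R, ‖F y‖ₑ ≤ eLpNorm F 2 μ * m ^ (1 / 2 : ℝ) := by
    have := eLpNorm_le_eLpNorm_mul_rpow_measure_univ (p := 1) (q := 2) (μ := μ) (by norm_num)
      hF.continuous.aestronglyMeasurable (f := F)
    rw [hμ, Measure.restrict_apply_univ, eLpNorm_one_eq_lintegral_enorm] at this
    refine this.trans (le_of_eq ?_)
    norm_num
    rfl
  have key : ‖F x‖ₑ * m ≤ (eLpNorm F 2 μ * m ^ (1 / 2 : ℝ)) +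
      ENNReal.ofReal (2 * R) * (T * (S * m ^ (5 / 6 : ℝ))) := by
    have hjoint : Measurable fun p : Space × ℝ => ‖b (p.2 • p.1 + (1 - p.2) • x)‖ₑ := by
      have : Continuous fun p : Space × ℝ => b (p.2 • p.1 + (1 - p.2) • x) := by fun_prop
      exact this.measurable.enorm
    calc ‖F x‖ₑ * m = ∫⁻ _y in cube R, ‖F x‖ₑ := by rw [setLIntegral_const]
      _ ≤ ∫⁻ y in cube R, (‖F y‖ₑ + ENNReal.ofReal (2 * R) *
            ∫⁻ t in Ioo (0 : ℝ) 1, ‖b (t • y + (1 - t) • x)‖ₑ) :=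
          setLIntegral_mono' (measurableSet_cube R) fun y hy => enorm_le_segment hR hF hx hy
      _ = (∫⁻ y in cube R, ‖F y‖ₑ) + ENNReal.ofReal (2 * R) *
            ∫⁻ y in cube R, ∫⁻ t in Ioo (0 : ℝ) 1, ‖b (t • y + (1 - t) • x)‖ₑ := by
          rw [lintegral_add_left hF.continuous.measurable.enorm,
            lintegral_const_mul' _ _ ENNReal.ofReal_ne_top]
      _ = (∫⁻ y in cube R, ‖F y‖ₑ) + ENNReal.ofReal (2 * R) *
            ∫⁻ t in Ioo (0 : ℝ) 1, ∫⁻ y in cube R, ‖b (t • y + (1 - t) • x)‖ₑ := by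
          rw [lintegral_lintegral_swap hjoint.aemeasurable]
      _ ≤ (eLpNorm F 2 μ * m ^ (1 / 2 : ℝ)) + ENNReal.ofReal (2 * R) *
            ∫⁻ t in Ioo (0 : ℝ) 1, ENNReal.ofReal (t ^ (-1 / 2 : ℝ)) * (S * m ^ (5 / 6 : ℝ)) := by
          refine add_le_add hF1 (mul_le_mul' le_rfl ?_)
          refine setLIntegral_mono' measurableSet_Ioo fun t ht => ?_
          refine (lintegral_contraction_le hbc hx ht).trans ?_
          gcongr
      _ = _ := by
          rw [lintegral_mul_const' _ _]
          refine ENNReal.mul_ne_top ?_ (ENNReal.rpow_ne_top_of_nonneg (by norm_num) hmt)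
          exact ENNReal.sum_ne_top.2 fun i _ => (memLp_of_continuous (hpc i) 6).2.ne
  calc ‖F x‖ₑ = m⁻¹ * (‖F x‖ₑ * m) := by
        rw [mul_comm ‖F x‖ₑ, ← mul_assoc, ENNReal.inv_mul_cancel hm0 hmt, one_mul]
    _ ≤ m⁻¹ * ((eLpNorm F 2 μ * m ^ (1 / 2 : ℝ)) +
      ENNReal.ofReal (2 * R) * (T * (S * m ^ (5 / 6 : ℝ)))) := by gcongr
    _ ≤ m⁻¹ * (((eLpNorm F 2 μ + S) * m ^ (1 / 2 : ℝ)) +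
      ENNReal.ofReal (2 * R) * (T * ((eLpNorm F 2 μ + S) * m ^ (5 / 6 : ℝ)))) := by
        gcongr
        · exact le_self_add
        · exact le_add_self
    _ = K * (eLpNorm F 2 μ + S) := by ring

/-- `H² ⊂ C⁰` on the three-dimensional cube. -/
theorem enorm_le_sobolev {R : ℝ} (hR : 0 < R) : ∃ C : NNReal, ∀ F : Space → ℝ, ContDiff ℝ 2 F →
    ∀ x ∈ closedCube R, ‖F x‖ₑ ≤
      C * (eLpNorm F 2 ((volume : Measure Space).restrict (cube R)) +
        ∑ i, (eLpNorm (partialDeriv i F) 2 ((volume : Measure Space).restrict (cube R)) +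
          ∑ j, eLpNorm (partialDeriv j (partialDeriv i F)) 2
            ((volume : Measure Space).restrict (cube R)))) := by
  obtain ⟨C₁, h₁⟩ := eLpNorm_six_le hR
  obtain ⟨C₂, h₂⟩ := enorm_le_morrey hR
  refine ⟨C₂ * (C₁ + 1), fun F hF x hx => ?_⟩
  have hF1 : ContDiff ℝ 1 F := hF.of_le (by norm_num)
  have hd : ∀ i, ContDiff ℝ 1 (partialDeriv i F) := fun i =>
    (hF.fderiv_right (m := 1) (by norm_num)).clm_apply contDiff_const
  refine (h₂ F hF1 x hx).trans ?_
  push_cast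
  rw [mul_assoc]
  gcongr
  rw [mul_add]
  refine add_le_add ?_ ?_
  · calc _ ≤ 1 * eLpNorm F 2 (volume.restrict (cube R)) := by rw [one_mul]
      _ ≤ _ := by gcongr; exact le_add_self
  · rw [Finset.mul_sum]
    refine Finset.sum_le_sum fun i _ => (h₁ _ (hd i)).trans ?_
    gcongr
    exact le_self_add

/-! ### Integration by parts for limits of smooth functions -/

/-- Lebesgue measure on the cube. -/
abbrev cubeMeasure (R : ℝ) : Measure Space := (volume : Measure Space).restrict (cube R)

theorem integral_cube (R : ℝ) (f : Space → ℝ) :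
    ∫ x in cube R, f x = ∫ y in Icc (fun _ : Fin 3 => -R) (fun _ => R), f (WithLp.toLp 2 y) := by
  have hmp := EuclideanSpace.volume_preserving_symm_measurableEquiv_toLp (Fin 3)
  rw [← hmp.symm.setIntegral_preimage_emb (MeasurableEquiv.measurableEmbedding _) f (cube R)]
  have e : (MeasurableEquiv.toLp 2 (Fin 3 → ℝ)) ⁻¹' cube R =
      Set.pi univ fun _ : Fin 3 => Ioo (-R) R := by
    ext y; simp [cube, abs_lt]
  change ∫ y in (MeasurableEquiv.toLp 2 (Fin 3 → ℝ)) ⁻¹' cube R, f (WithLp.toLp 2 y) = _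
  rw [e]
  exact setIntegral_congr_set Measure.univ_pi_Ioo_ae_eq_Icc

theorem hasFDerivAt_comp_toLp {F : Space → ℝ} (hF : ContDiff ℝ 1 F) (y : Fin 3 → ℝ) :
    HasFDerivAt (fun y => F (WithLp.toLp 2 y)) ((fderiv ℝ F (WithLp.toLp 2 y)).comp
      (PiLp.continuousLinearEquiv 2 ℝ (fun _ : Fin 3 => ℝ)).symm.toContinuousLinearMap) y :=
  ((hF.differentiable (by simp)).differentiableAt.hasFDerivAt).comp y
    (PiLp.continuousLinearEquiv 2 ℝ (fun _ : Fin 3 => ℝ)).symm.hasFDerivAt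

/-- The divergence theorem on the cube, for the vector field `F eᵢ`, as an inequality. -/
theorem integral_partialDeriv_ge {R : ℝ} (hR : 0 < R) {F : Space → ℝ} (hF : ContDiff ℝ 1 F)
    (i : Fin 3) {ε : ℝ} (htop : ∀ x ∈ closedCube R, x i = R → -ε ≤ F x)
    (hbot : ∀ x ∈ closedCube R, x i = -R → F x ≤ ε) :
    -(2 * ε * (2 * R) ^ 2) ≤ ∫ x in cube R, partialDeriv i F x := by
  set G : (Fin 3 → ℝ) → ℝ := fun y => F (WithLp.toLp 2 y) with hG
  have hGc : Continuous G := hF.continuous.comp (PiLp.continuous_toLp 2 _)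
  set G' : (Fin 3 → ℝ) → (Fin 3 → ℝ) →L[ℝ] ℝ := fun y => (fderiv ℝ F (WithLp.toLp 2 y)).comp
      (PiLp.continuousLinearEquiv 2 ℝ (fun _ : Fin 3 => ℝ)).symm.toContinuousLinearMap with hG'
  have hG'e : ∀ y, G' y (Pi.single i 1) = partialDeriv i F (WithLp.toLp 2 y) := fun y => rfl
  have hsum : ∀ y, ∑ j, (if j = i then G' y else 0) (Pi.single j 1) =
      partialDeriv i F (WithLp.toLp 2 y) := by
    intro y
    rw [Finset.sum_eq_single i]
    · simp [hG'e]
    · intro j _ hj; simp [hj]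
    · simp
  have hpc : Continuous fun y : Fin 3 → ℝ => partialDeriv i F (WithLp.toLp 2 y) :=
    (partialDeriv_continuous i hF).comp (PiLp.continuous_toLp 2 _)
  have hdiv := integral_divergence_of_hasFDerivAt_off_countable'
    (fun _ : Fin 3 => -R) (fun _ => R) (fun _ => by simp only; linarith)
    (fun j => if j = i then G else 0) (fun j y => if j = i then G' y else 0) ∅ countable_empty
    (fun j => by
      by_cases hj : j = i
      · simp only [hj, if_true]; exact hGc.continuousOn
      · simp only [hj, if_false]; exact continuousOn_const)
    (fun y _ j => by
      by_cases hj : j = i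
      · simp only [hj, if_true]; exact hasFDerivAt_comp_toLp hF y
      · simp only [hj, if_false]; exact hasFDerivAt_const _ _)
    (by simp only [hsum]
        exact hpc.continuousOn.integrableOn_compact isCompact_Icc)
  simp only [hsum] at hdiv
  rw [integral_cube, hdiv, Finset.sum_eq_single i]
  · simp only [if_true]
    set face : Set (Fin 2 → ℝ) := Icc ((fun _ : Fin 3 => -R) ∘ i.succAbove)
      ((fun _ : Fin 3 => R) ∘ i.succAbove) with hface
    have hvol : volume.real face = (2 * R) ^ 2 := by
      have hle : (fun _ : Fin 3 => -R) ∘ i.succAbove ≤ (fun _ : Fin 3 => R) ∘ i.succAbove :=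
        fun _ => by change -R ≤ R; linarith
      rw [hface, measureReal_def, Real.volume_Icc_pi_toReal hle]
      simp; ring
    have hfin : volume face ≠ ⊤ := isCompact_Icc.measure_lt_top.ne
    have hmem : ∀ s : ℝ, |s| ≤ R → ∀ y ∈ face,
        (WithLp.toLp 2 (i.insertNth s y : Fin 3 → ℝ) : Space) ∈ closedCube R := by
      intro s hs y hy j
      change |(i.insertNth s y : Fin 3 → ℝ) j| ≤ R
      rcases Fin.eq_self_or_eq_succAbove i j with rfl | ⟨l, rfl⟩
      · simpa using hs
      · rw [Fin.insertNth_apply_succAbove]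
        exact abs_le.2 ⟨hy.1 l, hy.2 l⟩
    have hint : ∀ s : ℝ, IntegrableOn (fun y : Fin 2 → ℝ => G (i.insertNth s y)) face := fun s =>
      (hGc.comp (by fun_prop)).continuousOn.integrableOn_compact isCompact_Icc
    have h1 : ∫ _y in face, -ε ≤ ∫ y in face, G (i.insertNth R y) :=
      setIntegral_mono_on (integrableOn_const hfin) (hint R) measurableSet_Icc fun y hy =>
        htop _ (hmem R (abs_of_pos hR).le y hy) (by simp)
    have h2 : ∫ y in face, G (i.insertNth (-R) y) ≤ ∫ _y in face, ε :=
      setIntegral_mono_on (hint (-R)) (integrableOn_const hfin) measurableSet_Icc fun y hy =>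
        hbot _ (hmem (-R) (by rw [abs_neg, abs_of_pos hR]) y hy) (by simp)
    rw [setIntegral_const, hvol, smul_eq_mul] at h1 h2
    linarith
  · intro j _ hj; simp [hj]
  · simp

/-- `f` is continuous on the closed cube and has the weak gradient `f'` in `L²`: it is the
uniform limit of `C¹` functions whose gradients converge to `f'` in `L²` of the cube. -/
def Adm (R : ℝ) (f : Space → ℝ) (f' : Fin 3 → Space → ℝ) : Prop :=
  (∀ i, MemLp (f' i) 2 (cubeMeasure R)) ∧
  ∃ F : ℕ → Space → ℝ, (∀ n, ContDiff ℝ 1 (F n)) ∧ TendstoUniformlyOn F f atTop (closedCube R) ∧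
    ∀ i, Tendsto (fun n => eLpNorm (partialDeriv i (F n) - f' i) 2 (cubeMeasure R)) atTop (𝓝 0)

/-- `g ∈ W^{1,2}` with weak gradient `g'`: both are `L²`-limits of a `C¹` sequence and of its
gradients. -/
def WeakH1 (R : ℝ) (g : Space → ℝ) (g' : Fin 3 → Space → ℝ) : Prop :=
  MemLp g 2 (cubeMeasure R) ∧ (∀ i, MemLp (g' i) 2 (cubeMeasure R)) ∧
  ∃ G : ℕ → Space → ℝ, (∀ n, ContDiff ℝ 1 (G n)) ∧
    Tendsto (fun n => eLpNorm (G n - g) 2 (cubeMeasure R)) atTop (𝓝 0) ∧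
    ∀ i, Tendsto (fun n => eLpNorm (partialDeriv i (G n) - g' i) 2 (cubeMeasure R)) atTop (𝓝 0)

theorem Adm.continuousOn {R : ℝ} {f : Space → ℝ} {f' : Fin 3 → Space → ℝ} (h : Adm R f f') :
    ContinuousOn f (closedCube R) := by
  obtain ⟨_, F, hF, hu, _⟩ := h
  exact hu.continuousOn (Frequently.of_forall fun n => (hF n).continuous.continuousOn)

theorem Adm.bounded {R : ℝ} {f : Space → ℝ} {f' : Fin 3 → Space → ℝ} (h : Adm R f f') :
    ∃ C, 0 ≤ C ∧ ∀ x ∈ closedCube R, |f x| ≤ C := by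
  obtain ⟨C, hC⟩ := (isCompact_closedCube R).exists_bound_of_continuousOn h.continuousOn
  exact ⟨max C 0, le_max_right _ _, fun x hx => (hC x hx).trans (le_max_left _ _)⟩

theorem Adm.aestronglyMeasurable {R : ℝ} {f : Space → ℝ} {f' : Fin 3 → Space → ℝ}
    (h : Adm R f f') : AEStronglyMeasurable f (cubeMeasure R) :=
  (h.continuousOn.mono (cube_subset_closedCube R)).aestronglyMeasurable (measurableSet_cube R)

theorem Adm.memLp {R : ℝ} {f : Space → ℝ} {f' : Fin 3 → Space → ℝ} (h : Adm R f f')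
    (p : ENNReal) : MemLp f p (cubeMeasure R) := by
  obtain ⟨C, _, hC⟩ := h.bounded
  refine MemLp.of_bound h.aestronglyMeasurable C ?_
  filter_upwards [ae_restrict_mem (measurableSet_cube R)] with x hx
    using hC x (cube_subset_closedCube R hx)

theorem eLpNorm_mul_le_of_bound {R : ℝ} {f g : Space → ℝ} {C : ℝ}
    (hC : ∀ x ∈ closedCube R, |f x| ≤ C) :
    eLpNorm (fun x => f x * g x) 2 (cubeMeasure R) ≤
      ENNReal.ofReal C * eLpNorm g 2 (cubeMeasure R) := by
  refine eLpNorm_le_mul_eLpNorm_of_ae_le_mul ?_ 2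
  filter_upwards [ae_restrict_mem (measurableSet_cube R)] with x hx
  rw [norm_mul]
  exact mul_le_mul_of_nonneg_right (hC x (cube_subset_closedCube R hx)) (norm_nonneg _)

theorem memLp_mul_of_bound {R : ℝ} {f g : Space → ℝ} {C : ℝ}
    (hf : AEStronglyMeasurable f (cubeMeasure R)) (hg : MemLp g 2 (cubeMeasure R))
    (hC : ∀ x ∈ closedCube R, |f x| ≤ C) : MemLp (fun x => f x * g x) 2 (cubeMeasure R) :=
  ⟨hf.mul hg.1, (eLpNorm_mul_le_of_bound hC).trans_lt (ENNReal.mul_lt_top (by simp) hg.2)⟩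

theorem Adm.memLp_mul {R : ℝ} {f : Space → ℝ} {f' : Fin 3 → Space → ℝ} (h : Adm R f f')
    {g : Space → ℝ} (hg : MemLp g 2 (cubeMeasure R)) :
    MemLp (fun x => f x * g x) 2 (cubeMeasure R) :=
  let ⟨_, _, hC⟩ := h.bounded
  memLp_mul_of_bound h.aestronglyMeasurable hg hC

theorem Adm.of_contDiff (R : ℝ) {F : Space → ℝ} (hF : ContDiff ℝ 1 F) :
    Adm R F (fun i => partialDeriv i F) :=
  ⟨fun i => memLp_of_continuous (partialDeriv_continuous i hF) 2, fun _ => F, fun _ => hF,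
    fun _ hu => Eventually.of_forall fun _ _ _ => refl_mem_uniformity hu, fun i => by simp⟩

theorem Adm.weakH1 {R : ℝ} {f : Space → ℝ} {f' : Fin 3 → Space → ℝ} (h : Adm R f f') :
    WeakH1 R f f' := by
  refine ⟨h.memLp 2, h.1, ?_⟩
  obtain ⟨_, F, hF, hu, hd⟩ := h
  refine ⟨F, hF, ?_, hd⟩
  rw [Metric.tendstoUniformlyOn_iff] at hu
  have hfin : cubeMeasure R Set.univ ^ (2 : ENNReal).toReal⁻¹ ≠ ⊤ :=
    ENNReal.rpow_ne_top_of_nonneg (by norm_num) (measure_ne_top _ _)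
  have hb : ∀ ε > 0, ∀ᶠ n in atTop, eLpNorm (F n - f) 2 (cubeMeasure R) ≤
      cubeMeasure R Set.univ ^ (2 : ENNReal).toReal⁻¹ * ENNReal.ofReal ε := by
    intro ε hε
    filter_upwards [hu ε hε] with n hn
    refine eLpNorm_le_of_ae_bound ?_
    filter_upwards [ae_restrict_mem (measurableSet_cube R)] with x hx
    have := (hn x (cube_subset_closedCube R hx)).le
    rwa [dist_comm, Real.dist_eq] at this
  set A := cubeMeasure R Set.univ ^ (2 : ENNReal).toReal⁻¹
  have hlim : Tendsto (fun ε : ℝ => A * ENNReal.ofReal ε) (𝓝[>] 0) (𝓝 0) := by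
    have h1 : Tendsto (fun ε : ℝ => ENNReal.ofReal ε) (𝓝[>] 0) (𝓝 (ENNReal.ofReal 0)) :=
      (ENNReal.continuous_ofReal.tendsto 0).mono_left nhdsWithin_le_nhds
    have h2 := ENNReal.Tendsto.const_mul h1 (Or.inr hfin)
    simpa using h2
  rw [ENNReal.tendsto_nhds_zero]
  intro δ hδ
  obtain ⟨ε, hε, hε0⟩ := ((ENNReal.tendsto_nhds_zero.1 hlim δ hδ).and self_mem_nhdsWithin).exists
  filter_upwards [hb ε hε0] with n hn using hn.trans hε

theorem partialDeriv_add (i : Fin 3) {F G : Space → ℝ} (hF : ContDiff ℝ 1 F)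
    (hG : ContDiff ℝ 1 G) (x : Space) :
    partialDeriv i (fun x => F x + G x) x = partialDeriv i F x + partialDeriv i G x := by
  have h := ((hF.differentiable (by simp)).differentiableAt (x := x)).hasFDerivAt.add
    ((hG.differentiable (by simp)).differentiableAt (x := x)).hasFDerivAt
  have h2 : HasFDerivAt (fun x => F x + G x) _ x := h
  rw [partialDeriv, h2.fderiv]
  rfl

theorem partialDeriv_mul (i : Fin 3) {F G : Space → ℝ} (hF : ContDiff ℝ 1 F)
    (hG : ContDiff ℝ 1 G) (x : Space) :
    partialDeriv i (fun x => F x * G x) x =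
      F x * partialDeriv i G x + partialDeriv i F x * G x := by
  have h := ((hF.differentiable (by simp)).differentiableAt (x := x)).hasFDerivAt.mul
    ((hG.differentiable (by simp)).differentiableAt (x := x)).hasFDerivAt
  have h2 : HasFDerivAt (fun x => F x * G x) _ x := h
  rw [partialDeriv, h2.fderiv]
  simp [partialDeriv, mul_comm]

theorem tendsto_eLpNorm_add {R : ℝ} {a : ℕ → Space → ℝ} {c d : ℕ → Space → ℝ}
    (hab : ∀ n, a n =ᵐ[cubeMeasure R] fun x => c n x + d n x)
    (hc : ∀ n, AEStronglyMeasurable (c n) (cubeMeasure R))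
    (hd : ∀ n, AEStronglyMeasurable (d n) (cubeMeasure R))
    (h1 : Tendsto (fun n => eLpNorm (c n) 2 (cubeMeasure R)) atTop (𝓝 0))
    (h2 : Tendsto (fun n => eLpNorm (d n) 2 (cubeMeasure R)) atTop (𝓝 0)) :
    Tendsto (fun n => eLpNorm (a n) 2 (cubeMeasure R)) atTop (𝓝 0) := by
  have h3 := h1.add h2
  rw [add_zero] at h3
  refine tendsto_of_tendsto_of_tendsto_of_le_of_le tendsto_const_nhds h3 (fun _ => zero_le)
    fun n => ?_
  simp only
  rw [eLpNorm_congr_ae (hab n)]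
  exact eLpNorm_add_le (hc n) (hd n) (by norm_num)

theorem Adm.add {R : ℝ} {f g : Space → ℝ} {f' g' : Fin 3 → Space → ℝ} (hf : Adm R f f')
    (hg : Adm R g g') : Adm R (fun x => f x + g x) (fun i x => f' i x + g' i x) := by
  obtain ⟨mf, F, hF, uF, dF⟩ := hf
  obtain ⟨mg, G, hG, uG, dG⟩ := hg
  refine ⟨fun i => (mf i).add (mg i), fun n x => F n x + G n x, fun n => (hF n).add (hG n),
    uF.add uG, fun i => ?_⟩
  refine tendsto_eLpNorm_add (fun n => Eventually.of_forall fun x => ?_)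
    (fun n => (partialDeriv_continuous i (hF n)).aestronglyMeasurable.sub (mf i).1)
    (fun n => (partialDeriv_continuous i (hG n)).aestronglyMeasurable.sub (mg i).1) (dF i) (dG i)
  simp only [Pi.sub_apply, partialDeriv_add i (hF n) (hG n)]
  ring

theorem tendsto_eLpNorm_mul_of_uniform {R : ℝ} {f : ℕ → Space → ℝ} {f₀ g : Space → ℝ}
    (hu : TendstoUniformlyOn f f₀ atTop (closedCube R)) (hg : MemLp g 2 (cubeMeasure R)) :
    Tendsto (fun n => eLpNorm (fun x => (f n x - f₀ x) * g x) 2 (cubeMeasure R)) atTop (𝓝 0) := by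
  rw [Metric.tendstoUniformlyOn_iff] at hu
  have hlim : Tendsto (fun ε : ℝ => ENNReal.ofReal ε * eLpNorm g 2 (cubeMeasure R)) (𝓝[>] 0)
      (𝓝 0) := by
    have h1 : Tendsto (fun ε : ℝ => ENNReal.ofReal ε) (𝓝[>] 0) (𝓝 (ENNReal.ofReal 0)) :=
      (ENNReal.continuous_ofReal.tendsto 0).mono_left nhdsWithin_le_nhds
    have h2 := ENNReal.Tendsto.mul_const h1 (Or.inr hg.2.ne)
    simpa using h2
  rw [ENNReal.tendsto_nhds_zero]
  intro δ hδ
  obtain ⟨ε, hε, hε0⟩ := ((ENNReal.tendsto_nhds_zero.1 hlim δ hδ).and self_mem_nhdsWithin).exists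
  filter_upwards [hu ε hε0] with n hn
  refine (eLpNorm_mul_le_of_bound fun x hx => ?_).trans hε
  have := (hn x hx).le
  rwa [dist_comm, Real.dist_eq] at this

theorem exists_uniform_bound {R : ℝ} {f : ℕ → Space → ℝ} {f₀ : Space → ℝ}
    (hu : TendstoUniformlyOn f f₀ atTop (closedCube R)) (hf₀ : ContinuousOn f₀ (closedCube R)) :
    ∃ C, 0 ≤ C ∧ ∀ᶠ n in atTop, ∀ x ∈ closedCube R, |f n x| ≤ C := by
  obtain ⟨C, hC⟩ := (isCompact_closedCube R).exists_bound_of_continuousOn hf₀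
  rw [Metric.tendstoUniformlyOn_iff] at hu
  refine ⟨max C 0 + 1, by positivity, ?_⟩
  filter_upwards [hu 1 one_pos] with n hn x hx
  have h1 := (hn x hx).le
  rw [dist_comm, Real.dist_eq] at h1
  have h2 : |f₀ x| ≤ max C 0 := (hC x hx).trans (le_max_left _ _)
  have h3 := abs_add_le (f n x - f₀ x) (f₀ x)
  rw [sub_add_cancel] at h3
  linarith

theorem tendsto_eLpNorm_bounded_mul {R : ℝ} {f g : ℕ → Space → ℝ} {C : ℝ}
    (hf : ∀ᶠ n in atTop, ∀ x ∈ closedCube R, |f n x| ≤ C)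
    (hg : Tendsto (fun n => eLpNorm (g n) 2 (cubeMeasure R)) atTop (𝓝 0)) :
    Tendsto (fun n => eLpNorm (fun x => f n x * g n x) 2 (cubeMeasure R)) atTop (𝓝 0) := by
  have h := ENNReal.Tendsto.const_mul (a := ENNReal.ofReal C) hg (Or.inr ENNReal.ofReal_ne_top)
  rw [mul_zero] at h
  refine tendsto_of_tendsto_of_tendsto_of_le_of_le' tendsto_const_nhds h
    (Eventually.of_forall fun _ => zero_le) ?_
  filter_upwards [hf] with n hn using eLpNorm_mul_le_of_bound hn

theorem tendstoUniformlyOn_mul {R : ℝ} {f g : ℕ → Space → ℝ} {f₀ g₀ : Space → ℝ}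
    (hu : TendstoUniformlyOn f f₀ atTop (closedCube R)) (hf₀ : ContinuousOn f₀ (closedCube R))
    (hv : TendstoUniformlyOn g g₀ atTop (closedCube R)) (hg₀ : ContinuousOn g₀ (closedCube R)) :
    TendstoUniformlyOn (fun n x => f n x * g n x) (fun x => f₀ x * g₀ x) atTop
      (closedCube R) := by
  obtain ⟨A, hA, hfA⟩ := exists_uniform_bound hu hf₀
  obtain ⟨B, hB⟩ := (isCompact_closedCube R).exists_bound_of_continuousOn hg₀
  have hB0 : ∀ x ∈ closedCube R, |g₀ x| ≤ max B 0 := fun x hx => (hB x hx).trans (le_max_left _ _)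
  have hB1 : 0 ≤ max B 0 := le_max_right _ _
  rw [Metric.tendstoUniformlyOn_iff] at *
  intro ε hε
  set δ := ε / (A + max B 0 + 1)
  have hδ : 0 < δ := by positivity
  have hδe : δ * (A + max B 0 + 1) = ε := div_mul_cancel₀ _ (by positivity)
  filter_upwards [hu δ hδ, hv δ hδ, hfA] with n h1 h2 h3 x hx
  have a1 := (h1 x hx).le
  have a2 := (h2 x hx).le
  rw [dist_comm, Real.dist_eq] at a1 a2
  rw [dist_comm, Real.dist_eq]
  have e : f n x * g n x - f₀ x * g₀ x = f n x * (g n x - g₀ x) + (f n x - f₀ x) * g₀ x := by ring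
  calc |f n x * g n x - f₀ x * g₀ x|
      ≤ |f n x| * |g n x - g₀ x| + |f n x - f₀ x| * |g₀ x| := by
        rw [e, ← abs_mul, ← abs_mul]; exact abs_add_le _ _
    _ ≤ A * δ + δ * max B 0 := by
        gcongr
        · exact h3 x hx
        · exact hB0 x hx
    _ < ε := by nlinarith

theorem Adm.mul {R : ℝ} {f g : Space → ℝ} {f' g' : Fin 3 → Space → ℝ} (hf : Adm R f f')
    (hg : Adm R g g') :
    Adm R (fun x => f x * g x) (fun i x => f x * g' i x + f' i x * g x) := by
  have cf := hf.continuousOn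
  have cg := hg.continuousOn
  have af := hf.aestronglyMeasurable
  have ag := hg.aestronglyMeasurable
  have m' : ∀ i, MemLp (fun x => f x * g' i x + f' i x * g x) 2 (cubeMeasure R) := fun i => by
    refine (hf.memLp_mul (hg.1 i)).add ?_
    simpa [mul_comm] using hg.memLp_mul (hf.1 i)
  obtain ⟨mf, F, hF, uF, dF⟩ := hf
  obtain ⟨mg, G, hG, uG, dG⟩ := hg
  refine ⟨m', fun n x => F n x * G n x, fun n => (hF n).mul (hG n),
    tendstoUniformlyOn_mul uF cf uG cg, fun i => ?_⟩
  obtain ⟨A, -, hA⟩ := exists_uniform_bound uF cf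
  obtain ⟨B, -, hB⟩ := exists_uniform_bound uG cg
  have t1 := tendsto_eLpNorm_bounded_mul hA (dG i)
  have t2 := tendsto_eLpNorm_mul_of_uniform uF (mg i)
  have t3 := tendsto_eLpNorm_bounded_mul hB (dF i)
  have t4 := tendsto_eLpNorm_mul_of_uniform uG (mf i)
  have cF := fun n => (hF n).continuous.aestronglyMeasurable (μ := cubeMeasure R)
  have cG := fun n => (hG n).continuous.aestronglyMeasurable (μ := cubeMeasure R)
  have cF' := fun n => (partialDeriv_continuous i (hF n)).aestronglyMeasurable (μ := cubeMeasure R)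
  have cG' := fun n => (partialDeriv_continuous i (hG n)).aestronglyMeasurable (μ := cubeMeasure R)
  have s1 := fun n => (cF n).mul ((cG' n).sub (mg i).1)
  have s2 := fun n => ((cF n).sub af).mul (mg i).1
  have s3 := fun n => (cG n).mul ((cF' n).sub (mf i).1)
  have s4 := fun n => ((cG n).sub ag).mul (mf i).1
  have T1 := tendsto_eLpNorm_add (fun n => EventuallyEq.rfl) s1 s2 t1 t2
  have T2 := tendsto_eLpNorm_add (fun n => EventuallyEq.rfl) s3 s4 t3 t4
  refine tendsto_eLpNorm_add (fun n => Eventually.of_forall fun x => ?_)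
    (fun n => (s1 n).add (s2 n)) (fun n => (s3 n).add (s4 n)) T1 T2
  simp only [Pi.sub_apply, Pi.mul_apply, Pi.add_apply, partialDeriv_mul i (hF n) (hG n)]
  ring

theorem Adm.const_mul {R : ℝ} {f : Space → ℝ} {f' : Fin 3 → Space → ℝ} (hf : Adm R f f')
    (c : ℝ) : Adm R (fun x => c * f x) (fun i x => c * f' i x) := by
  have h := (Adm.of_contDiff R (F := fun _ => c) contDiff_const).mul hf
  have e : ∀ i x, partialDeriv i (fun _ : Space => c) x = 0 := fun i x => by simp [partialDeriv]
  simpa only [e, zero_mul, add_zero] using h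

theorem integrable_mul_of_memLp {R : ℝ} {a b : Space → ℝ} (ha : MemLp a 2 (cubeMeasure R))
    (hb : MemLp b 2 (cubeMeasure R)) : Integrable (fun x => a x * b x) (cubeMeasure R) :=
  ha.integrable_mul hb

theorem tendsto_integral_mul {R : ℝ} {a b : Space → ℝ} {B : ℕ → Space → ℝ}
    (ha : MemLp a 2 (cubeMeasure R)) (hb : MemLp b 2 (cubeMeasure R))
    (hB : ∀ n, MemLp (B n) 2 (cubeMeasure R))
    (h : Tendsto (fun n => eLpNorm (B n - b) 2 (cubeMeasure R)) atTop (𝓝 0)) :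
    Tendsto (fun n => ∫ x in cube R, a x * B n x) atTop (𝓝 (∫ x in cube R, a x * b x)) := by
  refine tendsto_integral_of_L1' _ (integrable_mul_of_memLp ha hb).1
    (Eventually.of_forall fun n => integrable_mul_of_memLp ha (hB n)) ?_
  have h2 := ENNReal.Tendsto.const_mul (a := eLpNorm a 2 (cubeMeasure R)) h (Or.inr ha.2.ne)
  rw [mul_zero] at h2
  refine tendsto_of_tendsto_of_tendsto_of_le_of_le tendsto_const_nhds h2 (fun _ => zero_le)
    fun n => ?_
  have e : ((fun x => a x * B n x) - fun x => a x * b x) = a • (B n - b) := by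
    ext x; simp; ring
  rw [e]
  exact eLpNorm_smul_le_mul_eLpNorm ((hB n).sub hb).1 ha.1

/-- The derivative `∂ᵢf` of a function that is nonnegative on the face `xᵢ = R` and nonpositive on
the face `xᵢ = -R` has a nonnegative integral. As an inequality, the divergence theorem passes to
the limit without reference to traces. -/
theorem Adm.integral_nonneg {R : ℝ} (hR : 0 < R) {f : Space → ℝ} {f' : Fin 3 → Space → ℝ}
    (h : Adm R f f') (i : Fin 3) (htop : ∀ x ∈ closedCube R, x i = R → 0 ≤ f x)
    (hbot : ∀ x ∈ closedCube R, x i = -R → f x ≤ 0) : 0 ≤ ∫ x in cube R, f' i x := by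
  obtain ⟨mf, F, hF, uF, dF⟩ := h
  have hlim := tendsto_integral_mul (a := fun _ => 1) (memLp_const 1) (mf i)
    (fun n => memLp_of_continuous (partialDeriv_continuous i (hF n)) 2) (dF i)
  simp only [one_mul] at hlim
  rw [Metric.tendstoUniformlyOn_iff] at uF
  have hge : ∀ ε > 0, -(2 * ε * (2 * R) ^ 2) ≤ ∫ x in cube R, f' i x := by
    intro ε hε
    refine ge_of_tendsto hlim ?_
    filter_upwards [uF ε hε] with n hn
    refine integral_partialDeriv_ge hR (hF n) i (fun x hx hxi => ?_) (fun x hx hxi => ?_)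
    · have h1 := (abs_lt.1 (hn x hx)).2
      linarith [htop x hx hxi]
    · have h1 := (abs_lt.1 (hn x hx)).1
      linarith [hbot x hx hxi]
  by_contra hneg
  push Not at hneg
  have := hge (-(∫ x in cube R, f' i x) / (4 * (2 * R) ^ 2)) (by
    apply div_pos (by linarith) (by positivity))
  have e : 2 * (-(∫ x in cube R, f' i x) / (4 * (2 * R) ^ 2)) * (2 * R) ^ 2 =
      -(∫ x in cube R, f' i x) / 2 := by field_simp; ring
  rw [e] at this
  linarith

theorem Adm.integral_eq_zero {R : ℝ} (hR : 0 < R) {f : Space → ℝ} {f' : Fin 3 → Space → ℝ}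
    (h : Adm R f f') (i : Fin 3) (h0 : ∀ x ∈ closedCube R, |x i| = R → f x = 0) :
    ∫ x in cube R, f' i x = 0 := by
  have hz : ∀ x ∈ closedCube R, x i = R ∨ x i = -R → f x = 0 := fun x hx hxi => h0 x hx (by
    rcases hxi with e | e <;> rw [e]
    · exact abs_of_pos hR
    · rw [abs_neg, abs_of_pos hR])
  refine le_antisymm ?_ (h.integral_nonneg hR i (fun x hx e => (hz x hx (Or.inl e)).ge)
    fun x hx e => (hz x hx (Or.inr e)).le)
  have := (h.const_mul (-1)).integral_nonneg hR i
    (fun x hx e => by simp [hz x hx (Or.inl e)]) fun x hx e => by simp [hz x hx (Or.inr e)]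
  simp only [neg_mul, one_mul] at this
  rw [integral_neg] at this
  linarith

/-- Integration by parts without boundary terms, when one factor is continuous and vanishes on
the two faces and the other one is only of class `W^{1,2}`. -/
theorem Adm.integral_mul_eq_zero {R : ℝ} (hR : 0 < R) {f g : Space → ℝ}
    {f' g' : Fin 3 → Space → ℝ} (hf : Adm R f f') (hg : WeakH1 R g g') (i : Fin 3)
    (h0 : ∀ x ∈ closedCube R, |x i| = R → f x = 0) :
    ∫ x in cube R, (f x * g' i x + f' i x * g x) = 0 := by
  obtain ⟨mg, mg', G, hG, dG, dG'⟩ := hg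
  have l1 := tendsto_integral_mul (hf.memLp 2) (mg' i)
    (fun n => memLp_of_continuous (partialDeriv_continuous i (hG n)) 2) (dG' i)
  have l2 := tendsto_integral_mul (hf.1 i) mg
    (fun n => memLp_of_continuous (hG n).continuous 2) dG
  have l3 := l1.add l2
  rw [← integral_add (integrable_mul_of_memLp (hf.memLp 2) (mg' i))
    (integrable_mul_of_memLp (hf.1 i) mg)] at l3
  refine tendsto_nhds_unique l3 ?_
  have e : ∀ n, (∫ x in cube R, f x * partialDeriv i (G n) x) + ∫ x in cube R, f' i x * G n x = 0 := by
    intro n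
    rw [← integral_add (integrable_mul_of_memLp (hf.memLp 2)
      (memLp_of_continuous (partialDeriv_continuous i (hG n)) 2))
      (integrable_mul_of_memLp (hf.1 i) (memLp_of_continuous (hG n).continuous 2))]
    exact (hf.mul (Adm.of_contDiff R (hG n))).integral_eq_zero hR i fun x hx e => by
      simp [h0 x hx e]
  simp only [e]
  exact tendsto_const_nhds

/-! ### Continuous representatives -/

theorem partialDeriv_sub (i : Fin 3) {F G : Space → ℝ} (hF : ContDiff ℝ 1 F)
    (hG : ContDiff ℝ 1 G) : partialDeriv i (F - G) = partialDeriv i F - partialDeriv i G := by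
  ext x
  have h := ((hF.differentiable (by simp)).differentiableAt (x := x)).hasFDerivAt.sub
    ((hG.differentiable (by simp)).differentiableAt (x := x)).hasFDerivAt
  rw [partialDeriv, h.fderiv]
  rfl

theorem partialDeriv_contDiff_one (i : Fin 3) {F : Space → ℝ} (hF : ContDiff ℝ 2 F) :
    ContDiff ℝ 1 (partialDeriv i F) :=
  (hF.fderiv_right (m := 1) (by norm_num)).clm_apply contDiff_const

/-- The multi-index of `∂ᵢ∂ⱼ`. -/
def idx2 (i j : Fin 3) : MultiIndex 3 :=
  ⟨fun l => (if l = i then 1 else 0) + (if l = j then 1 else 0), by revert i j; decide⟩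

/-- The multi-index of `∂ᵢ∂ⱼ∂ₖ`. -/
def idx3 (i j k : Fin 3) : MultiIndex 3 :=
  ⟨fun l => (if l = i then 1 else 0) + (if l = j then 1 else 0) + (if l = k then 1 else 0), by
    revert i j k; decide⟩

theorem idx2_symm (i j : Fin 3) : idx2 i j = idx2 j i := by
  revert i j; decide

theorem idx3_symm (i j k : Fin 3) : idx3 i j k = idx3 i k j := by
  revert i j k; decide

theorem idx3_symm' (i j k : Fin 3) : idx3 i j k = idx3 j i k := by
  revert i j k; decide

theorem idx2_self (i : Fin 3) : idx2 i i = idxTwo i := by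
  revert i; decide

theorem two_le_infty : (2 : WithTop ℕ∞) ≤ ∞ := WithTop.coe_le_coe.2 le_top

theorem partialDeriv_comm (i j : Fin 3) {F : Space → ℝ} (hF : ContDiff ℝ ∞ F) :
    partialDeriv i (partialDeriv j F) = partialDeriv j (partialDeriv i F) := by
  ext x
  have hd : DifferentiableAt ℝ (fderiv ℝ F) x :=
    ((hF.fderiv_right (m := ∞) (by simp)).differentiable (by simp)).differentiableAt
  have e : ∀ a b : Space, fderiv ℝ (fun y => fderiv ℝ F y a) x b = fderiv ℝ (fderiv ℝ F) x b a := by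
    intro a b
    have := hd.hasFDerivAt.clm_apply (hasFDerivAt_const a x)
    rw [this.fderiv]
    simp
  have hs : IsSymmSndFDerivAt ℝ F x :=
    (hF.contDiffAt (x := x)).isSymmSndFDerivAt (by simpa using two_le_infty)
  exact (e _ _).trans ((hs _ _).trans (e _ _).symm)

theorem multiDeriv_idxZero (F : Space → ℝ) : multiDeriv idxZero F = F := rfl

theorem multiDeriv_idxOne (i : Fin 3) (F : Space → ℝ) :
    multiDeriv (idxOne i) F = partialDeriv i F := by
  fin_cases i <;> rfl

theorem multiDeriv_idx2 (i j : Fin 3) {F : Space → ℝ} (hF : ContDiff ℝ ∞ F) :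
    multiDeriv (idx2 i j) F = partialDeriv j (partialDeriv i F) := by
  have c1 := partialDeriv_comm 1 0 hF
  have c2 := partialDeriv_comm 2 0 hF
  have c3 := partialDeriv_comm 2 1 hF
  fin_cases i <;> fin_cases j <;> first | rfl | exact c1.symm | exact c2.symm | exact c3.symm

theorem multiDeriv_idx3 (i j k : Fin 3) {F : Space → ℝ} (hF : ContDiff ℝ ∞ F) :
    multiDeriv (idx3 i j k) F = partialDeriv k (partialDeriv j (partialDeriv i F)) := by
  have c1 : ∀ G : Space → ℝ, ContDiff ℝ ∞ G →
    partialDeriv 1 (partialDeriv 0 G) = partialDeriv 0 (partialDeriv 1 G) :=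
    fun G hG => partialDeriv_comm 1 0 hG
  have c2 : ∀ G : Space → ℝ, ContDiff ℝ ∞ G →
    partialDeriv 2 (partialDeriv 0 G) = partialDeriv 0 (partialDeriv 2 G) :=
    fun G hG => partialDeriv_comm 2 0 hG
  have c3 : ∀ G : Space → ℝ, ContDiff ℝ ∞ G →
    partialDeriv 2 (partialDeriv 1 G) = partialDeriv 1 (partialDeriv 2 G) :=
    fun G hG => partialDeriv_comm 2 1 hG
  have s : ∀ i, ContDiff ℝ ∞ (partialDeriv i F) := fun i => partialDeriv_smooth i hF
  symm
  fin_cases i <;> fin_cases j <;> fin_cases k <;>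
    simp only [Fin.zero_eta, Fin.mk_one, Fin.reduceFinMk, c1 _ hF, c2 _ hF, c3 _ hF, c1 _ (s _),
      c2 _ (s _), c3 _ (s _)] <;> rfl

/-- An `L²`-convergent sequence of `C²` functions on the cube whose derivatives up to order two
converge in `L²` converges uniformly. -/
theorem exists_uniform_limit {R : ℝ} (hR : 0 < R) : ∃ C : NNReal, ∀ (G : ℕ → Space → ℝ)
    (w : Space → ℝ) (w1 : Fin 3 → Space → ℝ) (w2 : Fin 3 → Fin 3 → Space → ℝ),
    (∀ n, ContDiff ℝ 2 (G n)) → MemLp w 2 (cubeMeasure R) →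
    (∀ i, MemLp (w1 i) 2 (cubeMeasure R)) → (∀ i j, MemLp (w2 i j) 2 (cubeMeasure R)) →
    Tendsto (fun n => eLpNorm (G n - w) 2 (cubeMeasure R)) atTop (𝓝 0) →
    (∀ i, Tendsto (fun n => eLpNorm (partialDeriv i (G n) - w1 i) 2 (cubeMeasure R))
      atTop (𝓝 0)) →
    (∀ i j, Tendsto (fun n => eLpNorm (partialDeriv j (partialDeriv i (G n)) - w2 i j) 2
      (cubeMeasure R)) atTop (𝓝 0)) →
    ∃ g : Space → ℝ, TendstoUniformlyOn G g atTop (closedCube R) ∧ g =ᵐ[cubeMeasure R] w ∧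
      ∀ x ∈ closedCube R, ‖g x‖ₑ ≤ C * (eLpNorm w 2 (cubeMeasure R) +
        ∑ i, (eLpNorm (w1 i) 2 (cubeMeasure R) + ∑ j, eLpNorm (w2 i j) 2 (cubeMeasure R))) := by
  obtain ⟨C, hC⟩ := enorm_le_sobolev hR
  refine ⟨C, fun G w w1 w2 hG hw hw1 hw2 t0 t1 t2 => ?_⟩
  set μ := cubeMeasure R
  set e : ℕ → ENNReal := fun n => eLpNorm (G n - w) 2 μ + ∑ i, (eLpNorm (partialDeriv i (G n) - w1 i)
    2 μ + ∑ j, eLpNorm (partialDeriv j (partialDeriv i (G n)) - w2 i j) 2 μ) with he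
  have hG1 : ∀ n, ContDiff ℝ 1 (G n) := fun n => (hG n).of_le (by norm_num)
  have hp1 : ∀ n i, ContDiff ℝ 1 (partialDeriv i (G n)) := fun n i =>
    partialDeriv_contDiff_one i (hG n)
  have m0 : ∀ n, AEStronglyMeasurable (G n) μ := fun n => (hG n).continuous.aestronglyMeasurable
  have m1 : ∀ n i, AEStronglyMeasurable (partialDeriv i (G n)) μ := fun n i =>
    (hp1 n i).continuous.aestronglyMeasurable
  have m2 : ∀ n i j, AEStronglyMeasurable (partialDeriv j (partialDeriv i (G n))) μ := fun n i j =>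
    (partialDeriv_continuous j (hp1 n i)).aestronglyMeasurable
  have hlim : Tendsto (fun n => C * e n) atTop (𝓝 0) := by
    have h1 : Tendsto e atTop (𝓝 (0 + ∑ i : Fin 3, (0 + ∑ j : Fin 3, 0))) :=
      t0.add (tendsto_finsetSum _ fun i _ => (t1 i).add (tendsto_finsetSum _ fun j _ => t2 i j))
    simp only [Finset.sum_const_zero, add_zero] at h1
    simpa using ENNReal.Tendsto.const_mul h1 (Or.inr (ENNReal.coe_ne_top (r := C)))
  have tri : ∀ {a b c : Space → ℝ}, AEStronglyMeasurable a μ → AEStronglyMeasurable b μ →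
      AEStronglyMeasurable c μ → eLpNorm (a - b) 2 μ ≤ eLpNorm (a - c) 2 μ + eLpNorm (b - c) 2 μ := by
    intro a b c ha hb hc
    have : a - b = (a - c) - (b - c) := by ext x; simp
    rw [this]
    exact eLpNorm_sub_le (ha.sub hc) (hb.sub hc) (by norm_num)
  have hcau : ∀ n m, ∀ x ∈ closedCube R, ‖G n x - G m x‖ₑ ≤ C * e n + C * e m := by
    intro n m x hx
    have h := hC (G n - G m) ((hG n).sub (hG m)) x hx
    refine h.trans ?_
    rw [← mul_add]
    refine mul_le_mul' le_rfl ?_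
    have e1 : ∀ i, partialDeriv i (G n - G m) = partialDeriv i (G n) - partialDeriv i (G m) :=
      fun i => partialDeriv_sub i (hG1 n) (hG1 m)
    have e2 : ∀ i j, partialDeriv j (partialDeriv i (G n - G m)) =
        partialDeriv j (partialDeriv i (G n)) - partialDeriv j (partialDeriv i (G m)) := fun i j => by
      rw [e1, partialDeriv_sub j (hp1 n i) (hp1 m i)]
    simp only [e2]
    simp only [e1]
    refine le_trans (add_le_add (tri (m0 n) (m0 m) hw.1) (Finset.sum_le_sum fun i _ =>
      add_le_add (tri (m1 n i) (m1 m i) (hw1 i).1) (Finset.sum_le_sum fun j _ =>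
        tri (m2 n i j) (m2 m i j) (hw2 i j).1))) (le_of_eq ?_)
    simp only [Finset.sum_add_distrib, he]
    ring
  have hUC : UniformCauchySeqOn G atTop (closedCube R) := by
    rw [Metric.uniformCauchySeqOn_iff]
    intro ε hε
    have hev := hlim.eventually_lt_const (u := ENNReal.ofReal (ε / 2)) (by simpa using hε)
    obtain ⟨N, hN⟩ := eventually_atTop.1 hev
    refine ⟨N, fun m hm n hn x hx => ?_⟩
    have h := (hcau m n x hx).trans_lt (ENNReal.add_lt_add (hN m hm) (hN n hn))
    rw [← ENNReal.ofReal_add (by positivity) (by positivity), add_halves,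
      Real.enorm_eq_ofReal_abs] at h
    exact (ENNReal.ofReal_lt_ofReal_iff hε).1 h
  have hpt : ∀ x, ∃ y, x ∈ closedCube R → Tendsto (fun n => G n x) atTop (𝓝 y) := by
    intro x
    by_cases hx : x ∈ closedCube R
    · obtain ⟨y, hy⟩ := cauchySeq_tendsto_of_complete (hUC.cauchySeq hx)
      exact ⟨y, fun _ => hy⟩
    · exact ⟨0, fun h => absurd h hx⟩
  choose g hg using hpt
  refine ⟨g, hUC.tendstoUniformlyOn_of_tendsto hg, ?_, fun x hx => ?_⟩
  · obtain ⟨ns, hmono, hns⟩ := (tendstoInMeasure_of_tendsto_eLpNorm (by norm_num) m0 hw.1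
      t0).exists_seq_tendsto_ae
    filter_upwards [hns, ae_restrict_mem (measurableSet_cube R)] with x h1 h2
    exact tendsto_nhds_unique ((hg x (cube_subset_closedCube R h2)).comp hmono.tendsto_atTop) h1
  · have h1 : Tendsto (fun n => ‖G n x‖ₑ) atTop (𝓝 ‖g x‖ₑ) :=
      (continuous_enorm.tendsto _).comp (hg x hx)
    set S := eLpNorm w 2 μ + ∑ i, (eLpNorm (w1 i) 2 μ + ∑ j, eLpNorm (w2 i j) 2 μ) with hS
    have h2 : Tendsto (fun n => C * e n + C * S) atTop (𝓝 (0 + C * S)) :=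
      hlim.add_const _
    rw [zero_add] at h2
    refine le_of_tendsto_of_tendsto' h1 h2 fun n => ?_
    refine (hC (G n) (hG n) x hx).trans ?_
    rw [← mul_add]
    refine mul_le_mul' le_rfl ?_
    have tri2 : ∀ {a c : Space → ℝ}, AEStronglyMeasurable a μ → AEStronglyMeasurable c μ →
        eLpNorm a 2 μ ≤ eLpNorm (a - c) 2 μ + eLpNorm c 2 μ := by
      intro a c ha hc
      have : a = (a - c) + c := by ext x; simp
      nth_rewrite 1 [this]
      exact eLpNorm_add_le (ha.sub hc) hc (by norm_num)
    calc _ ≤ (eLpNorm (G n - w) 2 μ + eLpNorm w 2 μ) +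
          ∑ i, ((eLpNorm (partialDeriv i (G n) - w1 i) 2 μ + eLpNorm (w1 i) 2 μ) +
            ∑ j, (eLpNorm (partialDeriv j (partialDeriv i (G n)) - w2 i j) 2 μ +
              eLpNorm (w2 i j) 2 μ)) :=
          add_le_add (tri2 (m0 n) hw.1) (Finset.sum_le_sum fun i _ =>
            add_le_add (tri2 (m1 n i) (hw1 i).1) (Finset.sum_le_sum fun j _ =>
              tri2 (m2 n i j) (hw2 i j).1))
      _ = _ := by simp only [Finset.sum_add_distrib, he, hS]; ring

/-- `W^{1,2} ⊂ L⁶`, by Fatou's lemma. -/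
theorem WeakH1.eLpNorm_six_le {R : ℝ} (hR : 0 < R) : ∃ C : NNReal, ∀ (g : Space → ℝ)
    (g' : Fin 3 → Space → ℝ), WeakH1 R g g' →
    eLpNorm g 6 (cubeMeasure R) ≤
      C * (eLpNorm g 2 (cubeMeasure R) + ∑ i, eLpNorm (g' i) 2 (cubeMeasure R)) := by
  obtain ⟨C, hC⟩ := Convexification.eLpNorm_six_le hR
  refine ⟨C, fun g g' ⟨hg, hg', G, hG, t0, t1⟩ => ?_⟩
  set μ := cubeMeasure R
  have m0 : ∀ n, AEStronglyMeasurable (G n) μ := fun n => (hG n).continuous.aestronglyMeasurable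
  have m1 : ∀ n i, AEStronglyMeasurable (partialDeriv i (G n)) μ := fun n i =>
    (partialDeriv_continuous i (hG n)).aestronglyMeasurable
  obtain ⟨ns, hmono, hns⟩ := (tendstoInMeasure_of_tendsto_eLpNorm (by norm_num) m0 hg.1
      t0).exists_seq_tendsto_ae
  have h1 := Lp.eLpNorm_lim_le_liminf_eLpNorm (p := 6) (fun n => m0 (ns n)) g hns
  refine h1.trans ?_
  set S := eLpNorm g 2 μ + ∑ i, eLpNorm (g' i) 2 μ with hS
  set e : ℕ → ENNReal := fun n => eLpNorm (G n - g) 2 μ +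
    ∑ i, eLpNorm (partialDeriv i (G n) - g' i) 2 μ with he
  have hle : Tendsto e atTop (𝓝 (0 + ∑ i : Fin 3, 0)) :=
    t0.add (tendsto_finsetSum _ fun i _ => t1 i)
  simp only [Finset.sum_const_zero, add_zero] at hle
  have h2 : Tendsto (fun n => C * (e (ns n) + S)) atTop (𝓝 (C * (0 + S))) :=
    ENNReal.Tendsto.const_mul ((hle.comp hmono.tendsto_atTop).add_const S)
      (Or.inr ENNReal.coe_ne_top)
  rw [zero_add] at h2
  rw [← h2.liminf_eq]
  refine liminf_le_liminf (Eventually.of_forall fun n => ?_)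
  refine (hC _ (hG (ns n))).trans (mul_le_mul' le_rfl ?_)
  have tri2 : ∀ {a c : Space → ℝ}, AEStronglyMeasurable a μ → AEStronglyMeasurable c μ →
      eLpNorm a 2 μ ≤ eLpNorm (a - c) 2 μ + eLpNorm c 2 μ := by
    intro a c ha hc
    have : a = (a - c) + c := by ext x; simp
    nth_rewrite 1 [this]
    exact eLpNorm_add_le (ha.sub hc) hc (by norm_num)
  calc _ ≤ (eLpNorm (G (ns n) - g) 2 μ + eLpNorm g 2 μ) +
        ∑ i, (eLpNorm (partialDeriv i (G (ns n)) - g' i) 2 μ + eLpNorm (g' i) 2 μ) :=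
        add_le_add (tri2 (m0 _) hg.1) (Finset.sum_le_sum fun i _ => tri2 (m1 _ i) (hg' i).1)
    _ = _ := by simp only [Finset.sum_add_distrib, he, hS]; ring

/-- A function `u` of class `H³` on the cube with its derivatives: `u` and `u1` are continuous
up to the boundary, the second derivatives `u2` are of class `W^{1,2}` with gradients `u3`, and
`u` is a limit of `C¹` functions uniformly on the closed cube together with the gradients. -/
structure H3Fun (R : ℝ) (u : Space → ℝ) (u1 : Fin 3 → Space → ℝ)
    (u2 : Fin 3 → Fin 3 → Space → ℝ) (u3 : Fin 3 → Fin 3 → Fin 3 → Space → ℝ) : Prop where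
  adm : Adm R u u1
  adm1 : ∀ i, Adm R (u1 i) (u2 i)
  weak2 : ∀ i j, WeakH1 R (u2 i j) (u3 i j)
  symm2 : ∀ i j, u2 i j = u2 j i
  symm3 : ∀ i j k, u3 i j k = u3 i k j
  symm3' : ∀ i j k, u3 i j k = u3 j i k
  c1 : ∃ F : ℕ → Space → ℝ, (∀ n, ContDiff ℝ 1 (F n)) ∧
    TendstoUniformlyOn F u atTop (closedCube R) ∧
    ∀ i, TendstoUniformlyOn (fun n => partialDeriv i (F n)) (u1 i) atTop (closedCube R)

/-- The Sobolev embedding `H³ ⊂ C¹` and `H³ ⊂ W^{2,6}` for families of weak derivatives. -/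
theorem IsJet.exists_rep {R : ℝ} (hR : 0 < R) : ∃ C : NNReal, ∀ U : MultiIndex 3 → Space → ℝ,
    IsJet R U → ∃ (u : Space → ℝ) (u1 : Fin 3 → Space → ℝ),
      H3Fun R u u1 (fun i j => U (idx2 i j)) (fun i j k => U (idx3 i j k)) ∧
      u =ᵐ[cubeMeasure R] U idxZero ∧ (∀ i, u1 i =ᵐ[cubeMeasure R] U (idxOne i)) ∧
      (∀ x ∈ closedCube R, ‖u x‖ₑ ≤ C * ∑ α, eLpNorm (U α) 2 (cubeMeasure R)) ∧
      (∀ i, ∀ x ∈ closedCube R, ‖u1 i x‖ₑ ≤ C * ∑ α, eLpNorm (U α) 2 (cubeMeasure R)) ∧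
      ∀ i j, eLpNorm (U (idx2 i j)) 6 (cubeMeasure R) ≤
        C * ∑ α, eLpNorm (U α) 2 (cubeMeasure R) := by
  obtain ⟨C₁, h₁⟩ := exists_uniform_limit hR
  obtain ⟨C₂, h₂⟩ := WeakH1.eLpNorm_six_le hR
  refine ⟨C₁ * 13 + C₂ * 4, fun U hU => ?_⟩
  obtain ⟨F, hF, hlim⟩ := hU.exists_smooth hR
  set S := ∑ α, eLpNorm (U α) 2 (cubeMeasure R) with hS
  have hle : ∀ α, eLpNorm (U α) 2 (cubeMeasure R) ≤ S := fun α =>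
    Finset.single_le_sum (f := fun α => eLpNorm (U α) 2 (cubeMeasure R)) (fun _ _ => zero_le)
      (Finset.mem_univ α)
  have l0 := hlim idxZero
  have l1 := fun i => hlim (idxOne i)
  have l2 := fun i j => hlim (idx2 i j)
  have l3 := fun i j k => hlim (idx3 i j k)
  simp only [multiDeriv_idxZero] at l0
  simp only [multiDeriv_idxOne] at l1
  simp only [multiDeriv_idx2 _ _ (hF _)] at l2
  simp only [multiDeriv_idx3 _ _ _ (hF _)] at l3
  obtain ⟨u, uu, uae, ub⟩ := h₁ F (U idxZero) (fun i => U (idxOne i)) (fun i j => U (idx2 i j))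
    (fun n => (hF n).of_le two_le_infty) (hU.memLp _) (fun _ => hU.memLp _) (fun _ _ => hU.memLp _) l0 l1 l2
  have hex := fun k => h₁ (fun n => partialDeriv k (F n)) (U (idxOne k)) (fun i => U (idx2 k i))
    (fun i j => U (idx3 k i j)) (fun n => (partialDeriv_smooth k (hF n)).of_le two_le_infty)
    (hU.memLp _) (fun _ => hU.memLp _) (fun _ _ => hU.memLp _) (l1 k) (l2 k) (l3 k)
  choose u1 u1u u1ae u1b using hex
  have hsum : ∀ {a : ENNReal} {b : Fin 3 → ENNReal} {c : Fin 3 → Fin 3 → ENNReal}, a ≤ S →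
      (∀ i, b i ≤ S) → (∀ i j, c i j ≤ S) →
      C₁ * (a + ∑ i, (b i + ∑ j, c i j)) ≤ (C₁ * 13 + C₂ * 4 : NNReal) * S := by
    intro a b c ha hb hc
    calc C₁ * (a + ∑ i, (b i + ∑ j, c i j)) ≤ C₁ * (S + ∑ i : Fin 3, (S + ∑ j : Fin 3, S)) :=
          mul_le_mul' le_rfl (add_le_add ha (Finset.sum_le_sum fun i _ =>
            add_le_add (hb i) (Finset.sum_le_sum fun j _ => hc i j)))
      _ = (C₁ * 13) * S := by simp; ring
      _ ≤ _ := by push_cast; gcongr; exact le_self_add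
  have hweak : ∀ i j, WeakH1 R (U (idx2 i j)) (fun k => U (idx3 i j k)) := fun i j =>
    ⟨hU.memLp _, fun _ => hU.memLp _, fun n => partialDeriv j (partialDeriv i (F n)),
      fun n => (partialDeriv_smooth j (partialDeriv_smooth i (hF n))).of_le (by simp), l2 i j,
      l3 i j⟩
  refine ⟨u, u1, ⟨?_, fun i => ?_, hweak, fun i j => ?_, fun i j k => ?_, fun i j k => ?_,
    ?_⟩, uae, u1ae,
    fun x hx => (ub x hx).trans (hsum (hle _) (fun _ => hle _) fun _ _ => hle _),
    fun i x hx => (u1b i x hx).trans (hsum (hle _) (fun _ => hle _) fun _ _ => hle _),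
    fun i j => (h₂ _ _ (hweak i j)).trans ?_⟩
  · have hc : ∀ i n, eLpNorm (partialDeriv i (F n) - u1 i) 2 (cubeMeasure R) =
        eLpNorm (partialDeriv i (F n) - U (idxOne i)) 2 (cubeMeasure R) := fun i n =>
      eLpNorm_congr_ae (EventuallyEq.rfl.sub (u1ae i))
    exact ⟨fun i => (memLp_congr_ae (u1ae i)).2 (hU.memLp _), F,
      fun n => (hF n).of_le (by simp), uu, fun i => by simpa only [hc] using l1 i⟩
  · exact ⟨fun j => hU.memLp _, fun n => partialDeriv i (F n),
      fun n => (partialDeriv_smooth i (hF n)).of_le (by simp), u1u i, l2 i⟩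
  · simp only [idx2_symm i j]
  · simp only [idx3_symm i j k]
  · simp only [idx3_symm' i j k]
  · exact ⟨F, fun n => (hF n).of_le (by simp), uu, u1u⟩
  · calc C₂ * (eLpNorm (U (idx2 i j)) 2 (cubeMeasure R) +
          ∑ k, eLpNorm (U (idx3 i j k)) 2 (cubeMeasure R)) ≤ C₂ * (S + ∑ _k : Fin 3, S) :=
          mul_le_mul' le_rfl (add_le_add (hle _) (Finset.sum_le_sum fun _ _ => hle _))
      _ = (C₂ * 4) * S := by simp; ring
      _ ≤ _ := by push_cast; gcongr; exact le_add_self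

/-! ### Boundary values -/

theorem update_mem_closedCube {R : ℝ} {x : Space} (hx : x ∈ closedCube R) (j : Fin 3) {s : ℝ}
    (hs : s ∈ Icc (-R) R) :
    (WithLp.toLp 2 (Function.update x.ofLp j s) : Space) ∈ closedCube R := by
  intro l
  rcases eq_or_ne l j with rfl | hl
  · simpa using abs_le.2 hs
  · simpa [Function.update_of_ne hl] using hx l

/-- If `u` vanishes on the boundary of the cube, so do its tangential derivatives. The derivatives
converge uniformly, hence `u` is differentiable along lines in a face; the points of the edges are
limits of points in the interior of such a line. -/
theorem H3Fun.tangential {R : ℝ} (hR : 0 < R) {u : Space → ℝ} {u1 : Fin 3 → Space → ℝ}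
    {u2 : Fin 3 → Fin 3 → Space → ℝ} {u3 : Fin 3 → Fin 3 → Fin 3 → Space → ℝ}
    (h : H3Fun R u u1 u2 u3) (h0 : ∀ x ∈ closedCube R, ∀ i, |x i| = R → u x = 0) {i j : Fin 3}
    (hij : i ≠ j) {x : Space} (hx : x ∈ closedCube R) (hxi : |x i| = R) : u1 j x = 0 := by
  obtain ⟨F, hF, uF, uF1⟩ := h.c1
  set γ : ℝ → Space := fun s => WithLp.toLp 2 (Function.update x.ofLp j s) with hγ
  have hγK : ∀ s ∈ Icc (-R) R, γ s ∈ closedCube R := fun s hs => update_mem_closedCube hx j hs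
  have hγi : ∀ s, |γ s i| = R := fun s => by simpa [hγ, Function.update_of_ne hij] using hxi
  have hsub : Ioo (-R) R ⊆ γ ⁻¹' closedCube R := fun s hs => hγK s (Ioo_subset_Icc_self hs)
  have hzero : EqOn (fun s => u1 j (γ s)) (fun _ => 0) (Ioo (-R) R) := by
    intro s hs
    have hd := hasDerivAt_of_tendstoUniformlyOn isOpen_Ioo
      (((uF1 j).comp γ).mono hsub)
      (Eventually.of_forall fun n t _ => hasDerivAt_update (hF n) x.ofLp j t)
      (fun t ht => uF.tendsto_at (hγK t (Ioo_subset_Icc_self ht))) hs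
    have h2 : HasDerivAt (fun s => u (γ s)) 0 s := by
      refine (hasDerivAt_const s (0 : ℝ)).congr_of_eventuallyEq ?_
      filter_upwards [isOpen_Ioo.mem_nhds hs] with t ht
      exact h0 _ (hγK t (Ioo_subset_Icc_self ht)) i (hγi t)
    exact hd.unique h2
  have hcont : ContinuousOn (fun s => u1 j (γ s)) (Icc (-R) R) :=
    (h.adm1 j).continuousOn.comp (continuous_toLp_update _ _).continuousOn hγK
  have hall := hzero.of_subset_closure hcont continuousOn_const Ioo_subset_Icc_self
    (by rw [closure_Ioo (by linarith)])
  have := hall (abs_le.1 (hx j))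
  simpa [hγ] using this

/-! ### The conjugated operator -/

/-- Functions of one coordinate. -/
theorem Adm.of_coord (R : ℝ) (j : Fin 3) {φ φ' : ℝ → ℝ} (hφ : ∀ s, HasDerivAt φ (φ' s) s)
    (hc : Continuous φ') :
    Adm R (fun x => φ (x j)) (fun i x => (if i = j then 1 else 0) * φ' (x j)) := by
  have hd : ContDiff ℝ 1 φ := by
    rw [contDiff_one_iff_deriv]
    exact ⟨fun s => (hφ s).differentiableAt, by rwa [show deriv φ = φ' from funext fun s => (hφ s).deriv]⟩
  have h := Adm.of_contDiff R (F := fun x : Space => φ (x j)) (hd.comp (by fun_prop))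
  have e : ∀ i (x : Space), partialDeriv i (fun x : Space => φ (x j)) x =
      (if i = j then 1 else 0) * φ' (x j) := by
    intro i x
    have h1 : HasFDerivAt (fun x : Space => x j) (EuclideanSpace.proj j : Space →L[ℝ] ℝ) x :=
      (EuclideanSpace.proj j : Space →L[ℝ] ℝ).hasFDerivAt
    have h2 := (hφ (x j)).comp_hasFDerivAt x h1
    have h3 : HasFDerivAt (fun x : Space => φ (x j)) _ x := h2
    rw [partialDeriv, h3.fderiv]
    simp [eq_comm, mul_comm]
  have e' : (fun i => partialDeriv i (fun x : Space => φ (x j))) =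
      fun i x => (if i = j then 1 else 0) * φ' (x j) := by
    ext i x; exact e i x
  rwa [e'] at h

/-- The square root `exp(λ(z - r)²)` of the Carleman weight. -/
def carl (lam r : ℝ) (x : Space) : ℝ := Real.exp (lam * (x 2 - r) ^ 2)

theorem carl_sq (lam r : ℝ) (x : Space) : carl lam r x ^ 2 = weight lam r (x 2) := by
  rw [carl, weight, ← Real.exp_nat_mul]
  congr 1; push_cast; ring

/-- The derivative `2(z - r)` of the phase `(z - r)²`. -/
def phase (r : ℝ) (x : Space) : ℝ := 2 * (x 2 - r)

/-- `1` for the vertical direction, `0` for the horizontal ones. -/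
def vert (i : Fin 3) : ℝ := if i = 2 then 1 else 0

theorem adm_carl (R lam r : ℝ) :
    Adm R (carl lam r) (fun i x => vert i * (lam * phase r x * carl lam r x)) := by
  refine Adm.of_coord R 2 (φ := fun s => Real.exp (lam * (s - r) ^ 2))
    (φ' := fun s => lam * (2 * (s - r)) * Real.exp (lam * (s - r) ^ 2)) (fun s => ?_)
    (by fun_prop)
  have h1 : HasDerivAt (fun s => lam * (s - r) ^ 2) (lam * (2 * (s - r))) s := by
    have := (((hasDerivAt_id s).sub_const r).fun_pow 2).const_mul lam
    simpa using this
  simpa [mul_comm] using h1.exp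

theorem adm_phase (R r : ℝ) : Adm R (phase r) (fun i _ => vert i * 2) :=
  Adm.of_coord R 2 (φ := fun s => 2 * (s - r)) (φ' := fun _ => 2)
    (fun s => by simpa using ((hasDerivAt_id s).sub_const r).const_mul 2) continuous_const

theorem Adm.congr_deriv {R : ℝ} {f : Space → ℝ} {f' g' : Fin 3 → Space → ℝ} (h : Adm R f f')
    (e : ∀ i x, f' i x = g' i x) : Adm R f g' := by
  rwa [show f' = g' from funext fun i => funext fun x => e i x] at h

theorem Adm.congr {R : ℝ} {f g : Space → ℝ} {f' g' : Fin 3 → Space → ℝ} (h : Adm R f f')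
    (e0 : ∀ x, f x = g x) (e : ∀ i x, f' i x = g' i x) : Adm R g g' := by
  rw [show f = g from funext e0] at h
  exact h.congr_deriv e

/-- `D` is integrable and has a nonnegative integral. -/
def PosInt {X : Type*} [MeasurableSpace X] (μ : Measure X) (D : X → ℝ) : Prop :=
  Integrable D μ ∧ 0 ≤ ∫ x, D x ∂μ

/-- `D` is integrable and its integral vanishes. -/
def NullInt {X : Type*} [MeasurableSpace X] (μ : Measure X) (D : X → ℝ) : Prop :=
  Integrable D μ ∧ ∫ x, D x ∂μ = 0

section
variable {X : Type*} [MeasurableSpace X] {μ : Measure X} {D D' f g : X → ℝ}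

theorem PosInt.add (h : PosInt μ D) (h' : PosInt μ D') : PosInt μ (fun x => D x + D' x) :=
  ⟨h.1.add h'.1, by rw [integral_add h.1 h'.1]; exact add_nonneg h.2 h'.2⟩

theorem PosInt.const_mul (h : PosInt μ D) {c : ℝ} (hc : 0 ≤ c) : PosInt μ (fun x => c * D x) :=
  ⟨h.1.const_mul c, by rw [integral_const_mul]; exact mul_nonneg hc h.2⟩

theorem NullInt.const_mul (h : NullInt μ D) (c : ℝ) : NullInt μ (fun x => c * D x) :=
  ⟨h.1.const_mul c, by rw [integral_const_mul, h.2, mul_zero]⟩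

theorem NullInt.add (h : NullInt μ D) (h' : NullInt μ D') : NullInt μ (fun x => D x + D' x) :=
  ⟨h.1.add h'.1, by rw [integral_add h.1 h'.1, h.2, h'.2, add_zero]⟩

theorem NullInt.posInt (h : NullInt μ D) : PosInt μ D := ⟨h.1, h.2.ge⟩

theorem PosInt.integral_le (h : PosInt μ D) (hf : Integrable f μ) (hg : Integrable g μ)
    (hle : ∀ᵐ x ∂μ, f x + D x ≤ g x) : ∫ x, f x ∂μ ≤ ∫ x, g x ∂μ := by
  have := integral_mono_ae (hf.add h.1) hg hle
  rw [integral_add' hf h.1] at this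
  linarith [h.2]

end

theorem Adm.nullInt {R : ℝ} (hR : 0 < R) {f : Space → ℝ} {f' : Fin 3 → Space → ℝ}
    (h : Adm R f f') (i : Fin 3) (h0 : ∀ x ∈ closedCube R, |x i| = R → f x = 0) :
    NullInt (cubeMeasure R) (f' i) :=
  ⟨(h.1 i).integrable (by norm_num), h.integral_eq_zero hR i h0⟩

theorem Adm.nullInt_mul {R : ℝ} (hR : 0 < R) {f g : Space → ℝ}
    {f' g' : Fin 3 → Space → ℝ} (hf : Adm R f f') (hg : WeakH1 R g g') (i : Fin 3)
    (h0 : ∀ x ∈ closedCube R, |x i| = R → f x = 0) :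
    NullInt (cubeMeasure R) (fun x => f x * g' i x + f' i x * g x) :=
  ⟨(integrable_mul_of_memLp (hf.memLp 2) (hg.2.1 i)).add (integrable_mul_of_memLp (hf.1 i) hg.1),
    hf.integral_mul_eq_zero hR hg i h0⟩

/-- Integral inequality for the conjugated operator
`P w = Δw - 2λ p w_z + (λ²p² - 2λ) w`, `p = 2(z - r)`: the commutator of its symmetric and
antisymmetric parts is positive. The boundary term `-2λ p w_z²` has the right sign on the upper
face, since `p < 0`, and vanishes on the lower one. -/
theorem conjugated_commutator {R r lam : ℝ} (hR : 0 < R) (hr : R < r) (hl : 0 < lam)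
    {w : Space → ℝ} {w1 : Fin 3 → Space → ℝ} {w2 : Fin 3 → Fin 3 → Space → ℝ}
    (hw : Adm R w w1) (hw1 : ∀ i, Adm R (w1 i) (w2 i)) (hs : ∀ i j, w2 i j = w2 j i)
    (b0 : ∀ x ∈ closedCube R, ∀ i, |x i| = R → w x = 0)
    (bt : ∀ x ∈ closedCube R, ∀ i j, i ≠ j → |x i| = R → w1 j x = 0)
    (bz : ∀ x ∈ closedCube R, x 2 = -R → w1 2 x = 0) :
    ∫ x in cube R, (8 * lam * w1 2 x ^ 2 + 8 * lam ^ 3 * (phase r x ^ 2 * w x ^ 2)) ≤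
      ∫ x in cube R, (w2 0 0 x + w2 1 1 x + w2 2 2 x - 2 * lam * phase r x * w1 2 x +
        (lam ^ 2 * phase r x ^ 2 - 2 * lam) * w x) ^ 2 := by
  have hp := adm_phase R r
  have d0 := (hw1 0).mul ((hp.mul (hw1 2)).add hw)
  have d1 := (hw1 1).mul ((hp.mul (hw1 2)).add hw)
  have d2 := hp.mul (((hw1 0).mul (hw1 0)).add ((hw1 1).mul (hw1 1)))
  have d3 := (hp.mul ((hw1 2).mul (hw1 2))).const_mul (-1)
  have d4 := hw.mul (hw1 2)
  have d5 := (hp.mul (hp.mul hp)).mul (hw.mul hw)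
  have z0 := d0.nullInt hR 0 fun x hx e => by
    simp [b0 x hx 0 e, bt x hx 0 2 (by decide) e]
  have z1 := d1.nullInt hR 1 fun x hx e => by
    simp [b0 x hx 1 e, bt x hx 1 2 (by decide) e]
  have z2 := d2.nullInt hR 2 fun x hx e => by
    simp [bt x hx 2 0 (by decide) e, bt x hx 2 1 (by decide) e]
  have z3 : PosInt (cubeMeasure R) _ := ⟨(d3.1 2).integrable (by norm_num), d3.integral_nonneg hR 2 (fun x hx e => by
    have : phase r x < 0 := by rw [phase, e]; linarith
    nlinarith [mul_self_nonneg (w1 2 x)]) fun x hx e => by simp [bz x hx e]⟩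
  have z4 := d4.nullInt hR 2 fun x hx e => by simp [b0 x hx 2 e]
  have z5 := d5.nullInt hR 2 fun x hx e => by simp [b0 x hx 2 e]
  have ia : Integrable (fun x => 8 * lam * w1 2 x ^ 2 + 8 * lam ^ 3 * (phase r x ^ 2 * w x ^ 2))
      (cubeMeasure R) := by
    have h := ((((hw1 2).mul (hw1 2)).const_mul (8 * lam)).add
      (((hp.mul hp).mul (hw.mul hw)).const_mul (8 * lam ^ 3))).memLp 1
    refine (memLp_one_iff_integrable.1 h).congr (Eventually.of_forall fun x => ?_)
    ring
  have iP : Integrable (fun x => (w2 0 0 x + w2 1 1 x + w2 2 2 x - 2 * lam * phase r x * w1 2 x +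
        (lam ^ 2 * phase r x ^ 2 - 2 * lam) * w x) ^ 2) (cubeMeasure R) := by
    have m1 : MemLp (fun x => w2 0 0 x + w2 1 1 x + w2 2 2 x) 2 (cubeMeasure R) :=
      (((hw1 0).1 0).add ((hw1 1).1 1)).add ((hw1 2).1 2)
    have m2 := ((((hp.mul (hw1 2)).const_mul (-2 * lam)).add (((hp.mul hp).mul hw).const_mul
      (lam ^ 2))).add (hw.const_mul (-2 * lam))).memLp 2
    refine ((m1.add m2).integrable_sq).congr (Eventually.of_forall fun x => ?_)
    simp only [Pi.add_apply]
    ring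
  -- with `A = Δw + λ²p²w` and `B = -2λ(p w_z + w)`, the square `(A + B)²` is `A² + B² + 2AB`, and
  -- `2AB = 8λ w_z² + 8λ³p²w²` up to the derivatives `d0`, …, `d5`
  refine ((((((z0.const_mul (-4 * lam)).add (z1.const_mul (-4 * lam))).add
    (z2.const_mul (2 * lam))).add (z4.const_mul (-4 * lam))).add
    (z5.const_mul (-2 * lam ^ 3))).posInt.add
    (z3.const_mul (mul_nonneg zero_le_two hl.le))).integral_le ia iP (Eventually.of_forall fun x => ?_)
  have e : ∀ a b : ℝ, 0 ≤ a ^ 2 + b ^ 2 := fun a b => by positivity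
  refine sub_nonneg.1 (le_of_le_of_eq
    (e (w2 0 0 x + w2 1 1 x + w2 2 2 x + lam ^ 2 * phase r x ^ 2 * w x)
      (-2 * lam * phase r x * w1 2 x - 2 * lam * w x)) ?_)
  simp only [vert, hs 2 0, hs 2 1, Fin.reduceEq, if_true, if_false]
  ring

theorem ae_cube {R : ℝ} {p : Space → Prop} (h : ∀ x ∈ cube R, p x) :
    ∀ᵐ x ∂(cubeMeasure R), p x := by
  filter_upwards [ae_restrict_mem (measurableSet_cube R)] with x hx using h x hx

/-- The conjugated Laplacian `Δw - 2λ p w_z + (λ²p² - 2λ) w`, `p = 2(z - r)`. -/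
def conjLap (lam r : ℝ) (w : Space → ℝ) (w1 : Fin 3 → Space → ℝ) (w2 : Fin 3 → Fin 3 → Space → ℝ)
    (x : Space) : ℝ :=
  w2 0 0 x + w2 1 1 x + w2 2 2 x - 2 * lam * phase r x * w1 2 x +
    (lam ^ 2 * phase r x ^ 2 - 2 * lam) * w x

theorem memLp_conjLap {R lam r : ℝ} {w : Space → ℝ} {w1 : Fin 3 → Space → ℝ}
    {w2 : Fin 3 → Fin 3 → Space → ℝ} (hw : Adm R w w1) (hw1 : ∀ i, Adm R (w1 i) (w2 i)) :
    MemLp (conjLap lam r w w1 w2) 2 (cubeMeasure R) := by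
  have hp := adm_phase R r
  have m1 : MemLp (fun x => w2 0 0 x + w2 1 1 x + w2 2 2 x) 2 (cubeMeasure R) :=
    (((hw1 0).1 0).add ((hw1 1).1 1)).add ((hw1 2).1 2)
  have m2 := ((((hp.mul (hw1 2)).const_mul (-2 * lam)).add (((hp.mul hp).mul hw).const_mul
    (lam ^ 2))).add (hw.const_mul (-2 * lam))).memLp 2
  refine (memLp_congr_ae (Eventually.of_forall fun x => ?_)).1 (m1.add m2)
  simp only [Pi.add_apply, conjLap]
  ring

theorem Adm.integrable {R : ℝ} {f : Space → ℝ} {f' : Fin 3 → Space → ℝ} (h : Adm R f f') :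
    Integrable f (cubeMeasure R) := memLp_one_iff_integrable.1 (h.memLp 1)

/-- The conjugated operator controls the gradient and the function. -/
theorem conjugated_estimate {R r lam : ℝ} (hR : 0 < R) (hr : R < r) (hl : 1 ≤ lam)
    (hlr : 1 ≤ lam * (4 * (r - R) ^ 2))
    {w : Space → ℝ} {w1 : Fin 3 → Space → ℝ} {w2 : Fin 3 → Fin 3 → Space → ℝ}
    (hw : Adm R w w1) (hw1 : ∀ i, Adm R (w1 i) (w2 i)) (hs : ∀ i j, w2 i j = w2 j i)
    (b0 : ∀ x ∈ closedCube R, ∀ i, |x i| = R → w x = 0)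
    (bt : ∀ x ∈ closedCube R, ∀ i j, i ≠ j → |x i| = R → w1 j x = 0)
    (bz : ∀ x ∈ closedCube R, x 2 = -R → w1 2 x = 0) :
    ∫ x in cube R, (lam * (w1 0 x ^ 2 + w1 1 x ^ 2 + w1 2 x ^ 2) +
        lam ^ 3 * (phase r x ^ 2 * w x ^ 2) + lam ^ 2 * w x ^ 2) ≤
      2 * ∫ x in cube R, conjLap lam r w w1 w2 x ^ 2 := by
  have hp := adm_phase R r
  have hc := conjugated_commutator hR hr (by linarith : 0 < lam) hw hw1 hs b0 bt bz
  have mP := memLp_conjLap (lam := lam) (r := r) hw hw1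
  have iP := mP.integrable_sq
  have iw := (hw.mul hw).integrable
  have ipw := ((hp.mul hp).mul (hw.mul hw)).integrable
  have ig := fun i => ((hw1 i).mul (hw1 i)).integrable
  -- `|∇w|² = λ²p²w² - w P` up to terms of divergence form
  have n0 := (hw.mul (hw1 0)).nullInt hR 0 fun x hx e => by simp [b0 x hx 0 e]
  have n1 := (hw.mul (hw1 1)).nullInt hR 1 fun x hx e => by simp [b0 x hx 1 e]
  have n2 := (hw.mul (hw1 2)).nullInt hR 2 fun x hx e => by simp [b0 x hx 2 e]
  have n3 := (hp.mul (hw.mul hw)).nullInt hR 2 fun x hx e => by simp [b0 x hx 2 e]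
  have i1 : Integrable (fun x => lam * (w1 0 x ^ 2 + w1 1 x ^ 2 + w1 2 x ^ 2) +
        lam ^ 3 * (phase r x ^ 2 * w x ^ 2) + lam ^ 2 * w x ^ 2) (cubeMeasure R) := by
    refine ((((((ig 0).add (ig 1)).add (ig 2)).const_mul lam).add (ipw.const_mul (lam ^ 3))).add
      (iw.const_mul (lam ^ 2))).congr (Eventually.of_forall fun x => ?_)
    simp only [Pi.add_apply]; ring
  have i2 : Integrable (fun x => 8 * lam * w1 2 x ^ 2 + 8 * lam ^ 3 * (phase r x ^ 2 * w x ^ 2))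
      (cubeMeasure R) := by
    refine (((ig 2).const_mul (8 * lam)).add (ipw.const_mul (8 * lam ^ 3))).congr
      (Eventually.of_forall fun x => ?_)
    simp only [Pi.add_apply]; ring
  have h1 := (((((n0.add n1).add n2).const_mul (-lam)).add
    (n3.const_mul (lam * lam))).posInt).integral_le i1 (i2.add (iP.const_mul (1 / 2)))
    (ae_cube fun x hx => by
      have hz : r - R ≤ r - x 2 := by linarith [(abs_lt.1 (hx 2)).2]
      have hph : 4 * (r - R) ^ 2 ≤ phase r x ^ 2 := by
        rw [phase]; nlinarith [hz]
      have h2 : lam ^ 2 * w x ^ 2 ≤ lam ^ 3 * (phase r x ^ 2 * w x ^ 2) := by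
        have : 1 ≤ lam * phase r x ^ 2 := hlr.trans (by gcongr)
        nlinarith [mul_le_mul_of_nonneg_right this (show 0 ≤ lam ^ 2 * w x ^ 2 by positivity)]
      have h3 : 0 ≤ lam * w1 2 x ^ 2 := by positivity
      have h4 : 0 ≤ lam ^ 3 * (phase r x ^ 2 * w x ^ 2) := by positivity
      have h5 := sq_nonneg (lam * w x + conjLap lam r w w1 w2 x)
      have e : lam * (w1 0 x ^ 2 + w1 1 x ^ 2 + w1 2 x ^ 2) +
          (-lam * (w x * w2 0 0 x + w1 0 x * w1 0 x + (w x * w2 1 1 x + w1 1 x * w1 1 x) +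
            (w x * w2 2 2 x + w1 2 x * w1 2 x)) +
          lam * lam * (phase r x * (w x * w1 2 x + w1 2 x * w x) + vert 2 * 2 * (w x * w x))) =
          lam ^ 3 * (phase r x ^ 2 * w x ^ 2) - lam * w x * conjLap lam r w w1 w2 x := by
        simp only [conjLap, vert, if_true]; ring
      simp only [Pi.add_apply]
      nlinarith)
  rw [integral_add' i2 (iP.const_mul (1 / 2)), integral_const_mul] at h1
  have hP0 : 0 ≤ ∫ x in cube R, conjLap lam r w w1 w2 x ^ 2 := integral_nonneg fun x => sq_nonneg _
  simp only [conjLap] at *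
  linarith

/-- The boundary conditions of the Carleman estimate: `u = 0` on the whole boundary and
`u_z = 0` on the lower face. -/
structure ZeroData (R : ℝ) (u : Space → ℝ) (u1 : Fin 3 → Space → ℝ) : Prop where
  zero : ∀ x ∈ closedCube R, ∀ i, |x i| = R → u x = 0
  normal : ∀ x ∈ closedCube R, x 2 = -R → u1 2 x = 0

/-- The Carleman estimate for `u` and `∇u`: the estimate for the conjugated operator, applied to
`w = exp(λ(z - r)²) u`. -/
theorem carleman_gradient {R r lam : ℝ} (hR : 0 < R) (hr : R < r) (hl : 1 ≤ lam)
    (hlr : 1 ≤ lam * (4 * (r - R) ^ 2)) {u : Space → ℝ} {u1 : Fin 3 → Space → ℝ}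
    {u2 : Fin 3 → Fin 3 → Space → ℝ} {u3 : Fin 3 → Fin 3 → Fin 3 → Space → ℝ}
    (h : H3Fun R u u1 u2 u3) (hb : ZeroData R u u1) :
    lam * (∫ x in cube R, carl lam r x ^ 2 * (u1 0 x ^ 2 + u1 1 x ^ 2 + u1 2 x ^ 2)) +
      lam ^ 2 * (∫ x in cube R, carl lam r x ^ 2 * u x ^ 2) ≤
      4 * ∫ x in cube R, carl lam r x ^ 2 * (u2 0 0 x + u2 1 1 x + u2 2 2 x) ^ 2 := by
  have hE := adm_carl R lam r
  have hp := adm_phase R r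
  have hw := (hE.mul h.adm).congr (g := fun x => carl lam r x * u x)
    (g' := fun i x => carl lam r x * (u1 i x + vert i * lam * (phase r x * u x))) (fun x => rfl)
    fun i x => by ring
  have hw1 := fun i => hE.mul ((h.adm1 i).add ((hp.mul h.adm).const_mul (vert i * lam)))
  have ht := fun x hx i j hij e => h.tangential hR hb.zero (x := x) (i := i) (j := j) hij hx e
  have key := conjugated_estimate hR hr hl hlr hw hw1 (fun i j => by
    ext x; rw [h.symm2 i j]; ring) (fun x hx i e => by rw [hb.zero x hx i e, mul_zero])
    (fun x hx i j hij e => by rw [hb.zero x hx i e, ht x hx i j hij e]; ring)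
    (fun x hx e => by
      rw [hb.normal x hx e, hb.zero x hx 2 (by rw [e, abs_neg, abs_of_pos hR])]; ring)
  have eP : ∀ x, conjLap lam r (fun x => carl lam r x * u x)
      (fun i x => carl lam r x * (u1 i x + vert i * lam * (phase r x * u x)))
      (fun i j x => carl lam r x * (u2 i j x + vert i * lam * (phase r x * u1 j x + vert j * 2 * u x))
        + vert j * (lam * phase r x * carl lam r x) * (u1 i x + vert i * lam * (phase r x * u x))) x
        ^ 2 = carl lam r x ^ 2 * (u2 0 0 x + u2 1 1 x + u2 2 2 x) ^ 2 := by
    intro x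
    rw [← mul_pow]
    congr 1
    simp only [conjLap, vert, Fin.reduceEq, if_true, if_false]
    ring
  have e2 := integral_congr_ae (μ := cubeMeasure R) (Eventually.of_forall eP)
  rw [e2] at key
  have iE2 := hE.mul hE
  have ig := fun i => (iE2.mul ((h.adm1 i).mul (h.adm1 i))).integrable
  have iu := (iE2.mul (h.adm.mul h.adm)).integrable
  have ik : Integrable (fun x => lam * ((carl lam r x * (u1 0 x + vert 0 * lam * (phase r x * u x))) ^ 2
      + (carl lam r x * (u1 1 x + vert 1 * lam * (phase r x * u x))) ^ 2
      + (carl lam r x * (u1 2 x + vert 2 * lam * (phase r x * u x))) ^ 2) +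
        lam ^ 3 * (phase r x ^ 2 * (carl lam r x * u x) ^ 2) + lam ^ 2 * (carl lam r x * u x) ^ 2)
      (cubeMeasure R) := by
    have ipw := ((hp.mul hp).mul (hw.mul hw)).integrable
    have iw := (hw.mul hw).integrable
    have iv := fun i => ((hw1 i).mul (hw1 i)).integrable
    refine ((((((iv 0).add (iv 1)).add (iv 2)).const_mul lam).add (ipw.const_mul (lam ^ 3))).add
      (iw.const_mul (lam ^ 2))).congr (Eventually.of_forall fun x => ?_)
    simp only [Pi.add_apply]; ring
  have e3 : lam * (∫ x in cube R, carl lam r x ^ 2 * (u1 0 x ^ 2 + u1 1 x ^ 2 + u1 2 x ^ 2)) +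
      lam ^ 2 * (∫ x in cube R, carl lam r x ^ 2 * u x ^ 2) =
      ∫ x in cube R, (lam * (carl lam r x ^ 2 * (u1 0 x ^ 2 + u1 1 x ^ 2 + u1 2 x ^ 2)) +
        lam ^ 2 * (carl lam r x ^ 2 * u x ^ 2)) := by
    rw [integral_add, integral_const_mul, integral_const_mul]
    · refine ((((ig 0).add (ig 1)).add (ig 2)).const_mul lam).congr
        (Eventually.of_forall fun x => ?_)
      simp only [Pi.add_apply]; ring
    · refine (iu.const_mul (lam ^ 2)).congr (Eventually.of_forall fun x => ?_)
      ring
  have e4 : ∫ x in cube R, (lam * (carl lam r x ^ 2 * (u1 0 x ^ 2 + u1 1 x ^ 2 + u1 2 x ^ 2)) +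
        lam ^ 2 * (carl lam r x ^ 2 * u x ^ 2)) ≤ ∫ x in cube R, 2 *
      (lam * ((carl lam r x * (u1 0 x + vert 0 * lam * (phase r x * u x))) ^ 2
      + (carl lam r x * (u1 1 x + vert 1 * lam * (phase r x * u x))) ^ 2
      + (carl lam r x * (u1 2 x + vert 2 * lam * (phase r x * u x))) ^ 2) +
        lam ^ 3 * (phase r x ^ 2 * (carl lam r x * u x) ^ 2) + lam ^ 2 * (carl lam r x * u x) ^ 2) := by
    refine integral_mono ?_ (ik.const_mul 2) fun x => ?_
    · refine (((((ig 0).add (ig 1)).add (ig 2)).const_mul lam).add (iu.const_mul (lam ^ 2))).congr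
        (Eventually.of_forall fun x => ?_)
      simp only [Pi.add_apply]; ring
    · simp only [vert, Fin.reduceEq, if_true, if_false]
      have hc : 0 ≤ carl lam r x ^ 2 := sq_nonneg _
      have h1 : 0 ≤ carl lam r x ^ 2 * (lam * (u1 0 x ^ 2 + u1 1 x ^ 2 +
        (u1 2 x + 2 * lam * phase r x * u x) ^ 2)) := by positivity
      have h2 : 0 ≤ carl lam r x ^ 2 * (lam ^ 2 * u x ^ 2) := by positivity
      nlinarith
  rw [integral_const_mul] at e4
  rw [e3]
  linarith

/-! ### Second derivatives -/

/-- With a cut-off factor `θ` that depends on the variables other than `xᵢ` only and vanishes for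
`|xⱼ| = R`, the function `θ (uᵢᵢuⱼⱼ + uᵢuᵢⱼⱼ) = θ ∂ᵢ(uᵢuⱼⱼ)` has integral zero, although `uᵢ` need
not vanish for `|xᵢ| = R` and `uⱼⱼ` has no boundary values: it equals
`∂ⱼ(θ(uⱼuᵢᵢ + uᵢuᵢⱼ)) - ∂ᵢ(uⱼ(θuᵢⱼ + θⱼuᵢ))`. -/
theorem H3Fun.nullInt_cutoff {R : ℝ} (hR : 0 < R) {u : Space → ℝ} {u1 : Fin 3 → Space → ℝ}
    {u2 : Fin 3 → Fin 3 → Space → ℝ} {u3 : Fin 3 → Fin 3 → Fin 3 → Space → ℝ}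
    (h : H3Fun R u u1 u2 u3) {i j : Fin 3}
    (ht : ∀ x ∈ closedCube R, |x i| = R → u1 j x = 0) {θ : Space → ℝ} {θ1 θ2 : Fin 3 → Space → ℝ}
    (hθ : Adm R θ θ1) (hθj : Adm R (θ1 j) θ2) (hi : ∀ x, θ1 i x = 0) (hij : ∀ x, θ2 i x = 0)
    (h0 : ∀ x ∈ closedCube R, |x j| = R → θ x = 0) :
    NullInt (cubeMeasure R) (fun x => θ x * (u2 i i x * u2 j j x + u1 i x * u3 i j j x)) := by
  have a1 := (hθ.mul (h.adm1 j)).nullInt_mul hR (h.weak2 i i) j fun x hx e => by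
    rw [h0 x hx e, zero_mul]
  have a2 := (hθ.mul (h.adm1 i)).nullInt_mul hR (h.weak2 i j) j fun x hx e => by
    rw [h0 x hx e, zero_mul]
  have b1 := (hθ.mul (h.adm1 j)).nullInt_mul hR (h.weak2 i j) i fun x hx e => by
    rw [ht x hx e, mul_zero]
  have b2 := (hθj.mul ((h.adm1 j).mul (h.adm1 i))).nullInt hR i fun x hx e => by
    rw [ht x hx e]; ring
  have key := (a1.add a2).add ((b1.add b2).const_mul (-1))
  refine (congrArg (NullInt (cubeMeasure R)) (funext fun x => ?_)).mp key
  simp only [hi, hij, h.symm2 j i, h.symm3 i j i]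
  ring

/-- The cut-off `1 - (s/R)^{2m}`. -/
def cutoff (R : ℝ) (m : ℕ) (s : ℝ) : ℝ := 1 - (s / R) ^ (2 * m)

theorem contDiff_cutoff (R : ℝ) (m : ℕ) : ContDiff ℝ ∞ (cutoff R m) := by
  unfold cutoff; fun_prop

theorem cutoff_eq_zero {R : ℝ} (hR : 0 < R) (m : ℕ) {s : ℝ} (hs : |s| = R) : cutoff R m s = 0 := by
  have : (s / R) ^ 2 = 1 := by rw [div_pow, ← sq_abs s, hs, div_self (by positivity)]
  rw [cutoff, pow_mul, this, one_pow, sub_self]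

theorem abs_cutoff_le {R : ℝ} (hR : 0 < R) (m : ℕ) {s : ℝ} (hs : |s| < R) : |cutoff R m s| ≤ 1 := by
  have h1 : (s / R) ^ 2 ≤ 1 := by
    rw [sq_le_one_iff_abs_le_one, abs_div, abs_of_pos hR, div_le_one hR]; exact hs.le
  have h2 : ((s / R) ^ 2) ^ m ≤ 1 := pow_le_one₀ (sq_nonneg _) h1
  have h3 : 0 ≤ ((s / R) ^ 2) ^ m := by positivity
  rw [cutoff, pow_mul, abs_le]
  constructor <;> linarith

theorem tendsto_cutoff {R : ℝ} (hR : 0 < R) {s : ℝ} (hs : |s| < R) :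
    Tendsto (fun m => cutoff R m s) atTop (𝓝 1) := by
  have h1 : (s / R) ^ 2 < 1 := by
    rw [sq_lt_one_iff_abs_lt_one, abs_div, abs_of_pos hR, div_lt_one hR]; exact hs
  have := (tendsto_pow_atTop_nhds_zero_of_lt_one (sq_nonneg (s / R)) h1).const_sub 1
  simpa only [cutoff, pow_mul, sub_zero] using this

theorem Adm.of_coord_contDiff (R : ℝ) (j : Fin 3) {φ : ℝ → ℝ} (hφ : ContDiff ℝ ∞ φ) :
    Adm R (fun x => φ (x j)) (fun i x => (if i = j then 1 else 0) * deriv φ (x j)) :=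
  Adm.of_coord R j (fun s => ((hφ.differentiable (by simp)) s).hasDerivAt)
    (hφ.continuous_deriv (by simp))

/-- The identity for the weight alone: the cut-off `1 - (xⱼ/R)^{2m}` tends to `1` as `m → ∞`. The
weight depends on `z` only, hence the assumption that `xᵢ` is not `z`. -/
theorem H3Fun.nullInt_weighted {R lam r : ℝ} (hR : 0 < R) {u : Space → ℝ} {u1 : Fin 3 → Space → ℝ}
    {u2 : Fin 3 → Fin 3 → Space → ℝ} {u3 : Fin 3 → Fin 3 → Fin 3 → Space → ℝ}
    (h : H3Fun R u u1 u2 u3) {i j : Fin 3} (hij : i ≠ j) (hi : i ≠ 2)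
    (ht : ∀ x ∈ closedCube R, |x i| = R → u1 j x = 0) :
    NullInt (cubeMeasure R)
      (fun x => carl lam r x ^ 2 * (u2 i i x * u2 j j x + u1 i x * u3 i j j x)) := by
  have hE := adm_carl R lam r
  have hE2 := hE.mul hE
  have hp := adm_phase R r
  have hc : ∀ m, NullInt (cubeMeasure R) (fun x => (cutoff R m (x j) * (carl lam r x * carl lam r x)) *
      (u2 i i x * u2 j j x + u1 i x * u3 i j j x)) := by
    intro m
    have hη := Adm.of_coord_contDiff R j (contDiff_cutoff R m)
    have hη' := Adm.of_coord_contDiff R j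
      ((contDiff_infty_iff_deriv.1 (contDiff_cutoff R m)).2)
    have hθ := hη.mul hE2
    have hD := (((hη.mul (hp.mul hE2)).const_mul (vert j * (2 * lam))).add (hη'.mul hE2)).congr
      (g := fun x => cutoff R m (x j) * (carl lam r x * (vert j * (lam * phase r x * carl lam r x)) +
        vert j * (lam * phase r x * carl lam r x) * carl lam r x) +
        (if j = j then 1 else 0) * deriv (cutoff R m) (x j) * (carl lam r x * carl lam r x))
      (fun x => by rw [if_pos rfl]; ring) (fun i x => rfl)
    have hv : vert i = 0 := by simp [vert, hi]
    refine h.nullInt_cutoff hR ht hθ hD (fun x => ?_) (fun x => ?_) fun x hx e => ?_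
    · simp only [hv, if_neg hij]; ring
    · simp only [hv, if_neg hij]; ring
    · rw [cutoff_eq_zero hR m e, zero_mul]
  have hG : Integrable (fun x => u2 i i x * u2 j j x + u1 i x * u3 i j j x) (cubeMeasure R) :=
    (integrable_mul_of_memLp (h.weak2 i i).1 (h.weak2 j j).1).add
      (integrable_mul_of_memLp ((h.adm1 i).memLp 2) ((h.weak2 i j).2.1 j))
  obtain ⟨B, hB0, hB⟩ := hE2.bounded
  have hEG : Integrable (fun x => (carl lam r x * carl lam r x) *
      (u2 i i x * u2 j j x + u1 i x * u3 i j j x)) (cubeMeasure R) :=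
    hG.bdd_mul hE2.aestronglyMeasurable (ae_cube fun x hx => hB x (cube_subset_closedCube R hx))
  have hlim := tendsto_integral_of_dominated_convergence (μ := cubeMeasure R)
    (F := fun m x => (cutoff R m (x j) * (carl lam r x * carl lam r x)) *
      (u2 i i x * u2 j j x + u1 i x * u3 i j j x))
    (f := fun x => (carl lam r x * carl lam r x) * (u2 i i x * u2 j j x + u1 i x * u3 i j j x))
    _ (fun m => (hc m).1.1) hEG.norm
    (fun m => ae_cube fun x hx => by
      rw [mul_assoc, norm_mul, Real.norm_eq_abs]
      exact mul_le_of_le_one_left (norm_nonneg _) (abs_cutoff_le hR m (hx j)))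
    (ae_cube fun x hx => by
      simpa using ((tendsto_cutoff hR (hx j)).mul_const (carl lam r x * carl lam r x)).mul_const
        (u2 i i x * u2 j j x + u1 i x * u3 i j j x))
  simp only [(hc _).2] at hlim
  have h0 := tendsto_nhds_unique hlim tendsto_const_nhds
  simp only [pow_two]
  exact ⟨hEG, h0⟩

/-- `∫ E²(uᵢᵢuⱼⱼ - uᵢⱼ²)` is a lower order term. -/
theorem H3Fun.nullInt_minor {R lam r : ℝ} (hR : 0 < R) {u : Space → ℝ} {u1 : Fin 3 → Space → ℝ}
    {u2 : Fin 3 → Fin 3 → Space → ℝ} {u3 : Fin 3 → Fin 3 → Fin 3 → Space → ℝ}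
    (h : H3Fun R u u1 u2 u3) {i j : Fin 3} (hij : i ≠ j) (hi : i ≠ 2)
    (ht : ∀ x ∈ closedCube R, |x i| = R → u1 j x = 0)
    (ht' : ∀ x ∈ closedCube R, |x j| = R → u1 i x = 0) :
    NullInt (cubeMeasure R) (fun x => carl lam r x ^ 2 * (u2 i i x * u2 j j x - u2 i j x ^ 2) -
      vert j * (2 * lam * phase r x * carl lam r x ^ 2 * u1 i x * u2 i j x)) := by
  have hE := adm_carl R lam r
  have a := h.nullInt_weighted (lam := lam) (r := r) hR hij hi ht
  have b := ((hE.mul hE).mul (h.adm1 i)).nullInt_mul hR (h.weak2 i j) j fun x hx e => by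
    rw [ht' x hx e, mul_zero]
  refine (congrArg (NullInt (cubeMeasure R)) (funext fun x => ?_)).mp (a.add (b.const_mul (-1)))
  ring

theorem phase_sq_le {R r : ℝ} (hr : R < r) {x : Space} (hx : x ∈ cube R) :
    phase r x ^ 2 ≤ 4 * (R + r) ^ 2 := by
  have h := abs_lt.1 (hx 2)
  rw [phase]
  nlinarith [h.1, h.2]

theorem integrable_weight_mul {R lam r : ℝ} {a b : Space → ℝ} (ha : MemLp a 2 (cubeMeasure R))
    (hb : MemLp b 2 (cubeMeasure R)) :
    Integrable (fun x => carl lam r x ^ 2 * (a x * b x)) (cubeMeasure R) := by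
  have hE := adm_carl R lam r
  refine (integrable_mul_of_memLp (hE.memLp_mul ha) (hE.memLp_mul hb)).congr
    (Eventually.of_forall fun x => ?_)
  ring

/-- The weighted Hessian is controlled by the weighted Laplacian and gradient: the difference
`(Δu)² - |D²u|²` is twice the sum of the minors `uᵢᵢuⱼⱼ - uᵢⱼ²`, `i < j`, whose integrals are of lower
order. -/
theorem carleman_hessian {R r lam : ℝ} (hR : 0 < R) (hr : R < r) (hl : 1 ≤ lam)
    {u : Space → ℝ} {u1 : Fin 3 → Space → ℝ}
    {u2 : Fin 3 → Fin 3 → Space → ℝ} {u3 : Fin 3 → Fin 3 → Fin 3 → Space → ℝ}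
    (h : H3Fun R u u1 u2 u3) (hb : ZeroData R u u1) :
    ∫ x in cube R, carl lam r x ^ 2 * ∑ i, ∑ j, u2 i j x ^ 2 ≤
      2 * (∫ x in cube R, carl lam r x ^ 2 * (u2 0 0 x + u2 1 1 x + u2 2 2 x) ^ 2) +
      64 * lam ^ 2 * (R + r) ^ 2 *
        ∫ x in cube R, carl lam r x ^ 2 * (u1 0 x ^ 2 + u1 1 x ^ 2 + u1 2 x ^ 2) := by
  have ht := fun i j hij x hx e => h.tangential hR hb.zero (x := x) (i := i) (j := j) hij hx e
  have n01 := h.nullInt_minor (lam := lam) (r := r) hR (i := 0) (j := 1) (by decide) (by decide)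
    (ht 0 1 (by decide)) (ht 1 0 (by decide))
  have n02 := h.nullInt_minor (lam := lam) (r := r) hR (i := 0) (j := 2) (by decide) (by decide)
    (ht 0 2 (by decide)) (ht 2 0 (by decide))
  have n12 := h.nullInt_minor (lam := lam) (r := r) hR (i := 1) (j := 2) (by decide) (by decide)
    (ht 1 2 (by decide)) (ht 2 1 (by decide))
  have iH : Integrable (fun x => carl lam r x ^ 2 * ∑ i, ∑ j, u2 i j x ^ 2) (cubeMeasure R) := by
    have := integrable_finsetSum Finset.univ fun i (_ : i ∈ Finset.univ) =>
      integrable_finsetSum Finset.univ fun j (_ : j ∈ Finset.univ) =>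
        integrable_weight_mul (lam := lam) (r := r) (h.weak2 i j).1 (h.weak2 i j).1
    refine this.congr (Eventually.of_forall fun x => ?_)
    simp only [Finset.mul_sum, pow_two]
  have iL : Integrable (fun x => carl lam r x ^ 2 * (u2 0 0 x + u2 1 1 x + u2 2 2 x) ^ 2)
      (cubeMeasure R) := by
    have m := ((h.weak2 0 0).1.add (h.weak2 1 1).1).add (h.weak2 2 2).1
    refine (integrable_weight_mul (lam := lam) (r := r) m m).congr (Eventually.of_forall fun x => ?_)
    simp only [Pi.add_apply, pow_two]
  have iG : Integrable (fun x => carl lam r x ^ 2 * (u1 0 x ^ 2 + u1 1 x ^ 2 + u1 2 x ^ 2))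
      (cubeMeasure R) := by
    have m := fun i => (h.adm1 i).memLp 2
    have k := fun i => integrable_weight_mul (lam := lam) (r := r) (m i) (m i)
    refine (((k 0).add (k 1)).add (k 2)).congr (Eventually.of_forall fun x => ?_)
    simp only [Pi.add_apply]; ring
  -- half of `|D²u|²` is sacrificed to the lower order terms, hence the factor `4 = 2 * 2`
  have key := (((n01.add n02).add n12).const_mul 4).posInt.integral_le iH
    ((iL.const_mul 2).add (iG.const_mul (64 * lam ^ 2 * (R + r) ^ 2))) (ae_cube fun x hx => by
      simp only [Fin.sum_univ_three, vert, Fin.reduceEq, if_true, if_false, h.symm2 1 0,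
        h.symm2 2 0, h.symm2 2 1, Pi.add_apply]
      have hp := phase_sq_le hr hx
      have hc : 0 ≤ carl lam r x ^ 2 := sq_nonneg _
      have q : ∀ a b : ℝ, -(8 * lam * phase r x * a * b) ≤ b ^ 2 + 64 * lam ^ 2 * (R + r) ^ 2 * a ^ 2 := by
        intro a b
        have h1 : 16 * lam ^ 2 * phase r x ^ 2 * a ^ 2 ≤ 64 * lam ^ 2 * (R + r) ^ 2 * a ^ 2 := by
          nlinarith [mul_le_mul_of_nonneg_left hp (show 0 ≤ 16 * lam ^ 2 * a ^ 2 by positivity)]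
        nlinarith [sq_nonneg (b + 4 * lam * phase r x * a)]
      have q1 := q (u1 0 x) (u2 0 2 x)
      have q2 := q (u1 1 x) (u2 1 2 x)
      have s : 0 ≤ 64 * lam ^ 2 * (R + r) ^ 2 * u1 2 x ^ 2 := by positivity
      have s2 := sq_nonneg (u2 0 0 x)
      have s3 := sq_nonneg (u2 1 1 x)
      have s4 := sq_nonneg (u2 2 2 x)
      have s5 := sq_nonneg (u2 0 1 x)
      have s6 := sq_nonneg (u2 0 2 x)
      have s7 := sq_nonneg (u2 1 2 x)
      have main : 0 ≤ carl lam r x ^ 2 * (u2 0 0 x ^ 2 + u2 1 1 x ^ 2 + u2 2 2 x ^ 2 +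
        2 * u2 0 1 x ^ 2 + 2 * u2 0 2 x ^ 2 + 2 * u2 1 2 x ^ 2 +
        64 * lam ^ 2 * (R + r) ^ 2 * (u1 0 x ^ 2 + u1 1 x ^ 2 + u1 2 x ^ 2) +
        8 * lam * phase r x * u1 0 x * u2 0 2 x + 8 * lam * phase r x * u1 1 x * u2 1 2 x) :=
        mul_nonneg hc (by nlinarith)
      nlinarith [main])
  rw [integral_add' (iL.const_mul 2) (iG.const_mul _), integral_const_mul,
    integral_const_mul] at key
  exact key

/-! ### The Carleman estimate -/

/-- Hölder's inequality with the exponents `3/2` and `3`. -/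
theorem lintegral_pow_four_mul_sq_le {X : Type*} [MeasurableSpace X] {μ : Measure X} {g v : X → ℝ}
    (hg : AEStronglyMeasurable g μ) (hv : AEStronglyMeasurable v μ) :
    ∫⁻ x, ‖g x‖ₑ ^ 4 * ‖v x‖ₑ ^ 2 ∂μ ≤ eLpNorm g 6 μ ^ 4 * eLpNorm v 6 μ ^ 2 := by
  have hpq : (3 / 2 : ℝ).HolderConjugate 3 := by
    rw [Real.holderConjugate_iff]; norm_num
  have h := ENNReal.lintegral_mul_le_Lp_mul_Lq μ hpq (hg.enorm.pow_const 4) (hv.enorm.pow_const 2)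
  refine h.trans (le_of_eq ?_)
  have e1 : ∀ x, (‖g x‖ₑ ^ 4) ^ (3 / 2 : ℝ) = ‖g x‖ₑ ^ 6 := fun x => by
    rw [← ENNReal.rpow_natCast, ← ENNReal.rpow_mul, ← ENNReal.rpow_natCast]; norm_num
  have e2 : ∀ x, (‖v x‖ₑ ^ 2) ^ (3 : ℝ) = ‖v x‖ₑ ^ 6 := fun x => by
    rw [← ENNReal.rpow_natCast, ← ENNReal.rpow_mul, ← ENNReal.rpow_natCast]; norm_num
  simp only [e1, e2]
  rw [← eLpNorm_six_pow, ← eLpNorm_six_pow]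
  congr 1
  · rw [← ENNReal.rpow_natCast, ← ENNReal.rpow_mul, ← ENNReal.rpow_natCast]; norm_num
  · rw [← ENNReal.rpow_natCast, ← ENNReal.rpow_mul, ← ENNReal.rpow_natCast]; norm_num

theorem integrable_pow_four_mul_sq {X : Type*} [MeasurableSpace X] {μ : Measure X} {g v : X → ℝ}
    (hg : MemLp g 6 μ) (hv : MemLp v 6 μ) : Integrable (fun x => g x ^ 4 * v x ^ 2) μ := by
  refine ⟨(hg.1.pow 4).mul (hv.1.pow 2), ?_⟩
  rw [hasFiniteIntegral_iff_enorm]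
  have := lintegral_pow_four_mul_sq_le hg.1 hv.1
  simp only [enorm_mul, enorm_pow]
  exact this.trans_lt (ENNReal.mul_lt_top (ENNReal.pow_lt_top hg.2) (ENNReal.pow_lt_top hv.2))

theorem integral_pow_four_mul_sq_le {X : Type*} [MeasurableSpace X] {μ : Measure X} {g v : X → ℝ}
    (hg : AEStronglyMeasurable g μ) (hv : AEStronglyMeasurable v μ) {A B : ℝ} (hA : 0 ≤ A)
    (hB : 0 ≤ B) (gA : eLpNorm g 6 μ ≤ ENNReal.ofReal A) (vB : eLpNorm v 6 μ ≤ ENNReal.ofReal B) :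
    ∫ x, g x ^ 4 * v x ^ 2 ∂μ ≤ A ^ 4 * B ^ 2 := by
  rw [integral_eq_lintegral_of_nonneg_ae (Eventually.of_forall fun x => by positivity)
    (show AEStronglyMeasurable (fun x => g x ^ 4 * v x ^ 2) μ from (hg.pow 4).mul (hv.pow 2))]
  refine ENNReal.toReal_le_of_le_ofReal (by positivity) ?_
  have e : ∀ x, ENNReal.ofReal (g x ^ 4 * v x ^ 2) = ‖g x‖ₑ ^ 4 * ‖v x‖ₑ ^ 2 := fun x => by
    rw [← enorm_pow, ← enorm_pow, ← enorm_mul, Real.enorm_eq_ofReal (by positivity)]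
  simp only [e]
  refine (lintegral_pow_four_mul_sq_le hg hv).trans ?_
  rw [ENNReal.ofReal_mul (by positivity), ENNReal.ofReal_pow hA, ENNReal.ofReal_pow hB]
  gcongr

theorem eLpNorm_two_le_sqrt {X : Type*} [MeasurableSpace X] {μ : Measure X} {v : X → ℝ}
    (hv : MemLp v 2 μ) {Y : ℝ} (h : ∫ x, v x ^ 2 ∂μ ≤ Y) :
    eLpNorm v 2 μ ≤ ENNReal.ofReal (Real.sqrt Y) := by
  have h1 : eLpNorm v 2 μ ^ 2 ≤ ENNReal.ofReal (Real.sqrt Y) ^ 2 := by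
    have hY : 0 ≤ Y := (integral_nonneg fun x => sq_nonneg _).trans h
    rw [eLpNorm_two_sq, ← ENNReal.ofReal_pow (Real.sqrt_nonneg _), Real.sq_sqrt hY]
    refine le_trans (le_of_eq ?_) (ENNReal.ofReal_le_ofReal h)
    rw [ofReal_integral_eq_lintegral_ofReal hv.integrable_sq
      (Eventually.of_forall fun x => sq_nonneg _)]
    refine lintegral_congr fun x => ?_
    rw [← enorm_pow, Real.enorm_eq_ofReal (sq_nonneg _)]
  exact (ENNReal.pow_right_strictMono two_ne_zero).le_iff_le.1 h1

theorem H3Fun.integrable_weighted_grad {R : ℝ} {u : Space → ℝ}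
    {u1 : Fin 3 → Space → ℝ} {u2 : Fin 3 → Fin 3 → Space → ℝ}
    {u3 : Fin 3 → Fin 3 → Fin 3 → Space → ℝ} (h : H3Fun R u u1 u2 u3) (lam r : ℝ) :
    Integrable (fun x => carl lam r x ^ 2 * ∑ i, u1 i x ^ 2) (cubeMeasure R) := by
  simp only [Finset.mul_sum]
  exact integrable_finsetSum _ fun i _ =>
    (integrable_weight_mul (lam := lam) (r := r) ((h.adm1 i).memLp 2) ((h.adm1 i).memLp 2)).congr
      (Eventually.of_forall fun x => by ring)

theorem H3Fun.integrable_weighted_hess {R : ℝ} {u : Space → ℝ}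
    {u1 : Fin 3 → Space → ℝ} {u2 : Fin 3 → Fin 3 → Space → ℝ}
    {u3 : Fin 3 → Fin 3 → Fin 3 → Space → ℝ} (h : H3Fun R u u1 u2 u3) (lam r : ℝ) :
    Integrable (fun x => carl lam r x ^ 2 * ∑ i, ∑ j, u2 i j x ^ 2) (cubeMeasure R) := by
  simp only [Finset.mul_sum]
  exact integrable_finsetSum _ fun i _ => integrable_finsetSum _ fun j _ =>
    (integrable_weight_mul (lam := lam) (r := r) (h.weak2 i j).1 (h.weak2 i j).1).congr
      (Eventually.of_forall fun x => by ring)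

theorem H3Fun.integral_weighted_hess_le {R r lam : ℝ} (hr : R < r) {u : Space → ℝ}
    {u1 : Fin 3 → Space → ℝ} {u2 : Fin 3 → Fin 3 → Space → ℝ}
    {u3 : Fin 3 → Fin 3 → Fin 3 → Space → ℝ} (h : H3Fun R u u1 u2 u3) (i j : Fin 3) :
    ∫ x in cube R, (carl lam r x * u2 i j x +
        vert j * (lam * phase r x * carl lam r x) * u1 i x) ^ 2 ≤
      2 * (∫ x in cube R, carl lam r x ^ 2 * ∑ i, ∑ j, u2 i j x ^ 2) +
        8 * lam ^ 2 * (R + r) ^ 2 * ∫ x in cube R, carl lam r x ^ 2 * ∑ i, u1 i x ^ 2 := by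
  have hv := (adm_carl R lam r).mul (h.adm1 i)
  have iG := h.integrable_weighted_grad lam r
  have iH := h.integrable_weighted_hess lam r
  rw [← integral_const_mul, ← integral_const_mul, ← integral_add (iH.const_mul 2) (iG.const_mul _)]
  refine integral_mono_ae ((hv.1 j).integrable_sq) ((iH.const_mul 2).add (iG.const_mul _))
    (ae_cube fun x hx => ?_)
  have s1 : u1 i x ^ 2 ≤ ∑ i, u1 i x ^ 2 :=
    Finset.single_le_sum (f := fun i => u1 i x ^ 2) (fun _ _ => sq_nonneg _) (Finset.mem_univ i)
  have s2 : u2 i j x ^ 2 ≤ ∑ i, ∑ j, u2 i j x ^ 2 :=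
    (Finset.single_le_sum (f := fun j => u2 i j x ^ 2)
      (fun _ _ => sq_nonneg _) (Finset.mem_univ j)).trans
      (Finset.single_le_sum (f := fun i => ∑ j, u2 i j x ^ 2)
      (fun _ _ => Finset.sum_nonneg fun _ _ => sq_nonneg _) (Finset.mem_univ i))
  have hv : vert j ^ 2 ≤ 1 := by unfold vert; split_ifs <;> norm_num
  have hvp : vert j ^ 2 * phase r x ^ 2 ≤ 1 * (4 * (R + r) ^ 2) :=
    mul_le_mul hv (phase_sq_le hr hx) (sq_nonneg _) zero_le_one
  have s4 : (vert j * lam * phase r x * u1 i x) ^ 2 ≤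
      4 * lam ^ 2 * (R + r) ^ 2 * ∑ i, u1 i x ^ 2 := by
    calc _ = (vert j ^ 2 * phase r x ^ 2) * (lam ^ 2 * u1 i x ^ 2) := by ring
      _ ≤ (1 * (4 * (R + r) ^ 2)) * (lam ^ 2 * ∑ i, u1 i x ^ 2) := by gcongr
      _ = _ := by ring
  have s5 := sq_nonneg (u2 i j x - vert j * lam * phase r x * u1 i x)
  have s6 := mul_le_mul_of_nonneg_left (show (u2 i j x + vert j * lam * phase r x * u1 i x) ^ 2 ≤
    2 * ∑ i, ∑ j, u2 i j x ^ 2 + 8 * lam ^ 2 * (R + r) ^ 2 * ∑ i, u1 i x ^ 2 by linarith)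
    (sq_nonneg (carl lam r x))
  refine le_trans (le_of_eq ?_) (s6.trans (le_of_eq ?_)) <;> ring

/-- The bound that trades `√λ |g|` for `λ + g⁴/λ`; the fourth power of an `L⁶` function can be paired
with the square of an `L⁶` function. -/
theorem sqrt_mul_abs_le {lam : ℝ} (hl : 0 < lam) (t : ℝ) :
    Real.sqrt lam * |t| ≤ lam + t ^ 4 / lam := by
  have hs := Real.sqrt_pos.2 hl
  have e := Real.sq_sqrt hl.le
  have ht := abs_nonneg t
  rcases le_total |t| (Real.sqrt lam) with h | h
  · have : 0 ≤ t ^ 4 / lam := by positivity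
    nlinarith
  · have : Real.sqrt lam * |t| ≤ t ^ 4 / lam := by
      rw [le_div_iff₀ hl]
      have h4 : t ^ 4 = |t| * |t| ^ 3 := by
        rw [← pow_succ']; exact (Even.pow_abs (by decide) t).symm
      rw [h4]
      calc Real.sqrt lam * |t| * lam = |t| * Real.sqrt lam ^ 3 := by
            nth_rewrite 2 [← e]; ring
        _ ≤ |t| * |t| ^ 3 := by gcongr
    linarith

/-- The Carleman estimate with the weight `exp(2λ(z - r)²)`. The last part absorbs a coefficient
that is only in `L⁶`, at the price of half of the power of `λ`. -/
theorem carleman {R r : ℝ} (hR : 0 < R) (hr : R < r) : ∃ K : ℝ, 0 < K ∧ ∃ lam₁ : ℝ, 1 ≤ lam₁ ∧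
    ∀ lam, lam₁ ≤ lam → ∀ (u : Space → ℝ) (u1 : Fin 3 → Space → ℝ)
      (u2 : Fin 3 → Fin 3 → Space → ℝ) (u3 : Fin 3 → Fin 3 → Fin 3 → Space → ℝ),
    H3Fun R u u1 u2 u3 → ZeroData R u u1 →
    lam * (∫ x in cube R, weight lam r (x 2) * ∑ i, u1 i x ^ 2) ≤
        K * (∫ x in cube R, weight lam r (x 2) * (∑ i, u2 i i x) ^ 2) ∧
    (∫ x in cube R, weight lam r (x 2) * (u x ^ 2 + ∑ i, u1 i x ^ 2 + ∑ i, ∑ j, u2 i j x ^ 2)) ≤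
        K * lam * (∫ x in cube R, weight lam r (x 2) * (∑ i, u2 i i x) ^ 2) ∧
    ∀ (g : Space → ℝ) (B : ℝ), 0 ≤ B → AEStronglyMeasurable g (cubeMeasure R) →
      eLpNorm g 6 (cubeMeasure R) ≤ ENNReal.ofReal B →
      Real.sqrt lam * (∫ x in cube R, weight lam r (x 2) * (|g x| * ∑ i, u1 i x ^ 2)) ≤
        K * (1 + B ^ 4) * (∫ x in cube R, weight lam r (x 2) * (∑ i, u2 i i x) ^ 2) := by
  obtain ⟨C, hC⟩ := WeakH1.eLpNorm_six_le hR
  set P := (R + r) ^ 2 with hP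
  have hP0 : 0 ≤ P := sq_nonneg _
  refine ⟨10 + 256 * P + 48 * (C : ℝ) ^ 2 * (8 + 544 * P), by positivity,
    max 1 (1 / (4 * (r - R) ^ 2)), le_max_left _ _, fun lam hlam u u1 u2 u3 h hb => ?_⟩
  have hl : 1 ≤ lam := (le_max_left _ _).trans hlam
  have hl0 : 0 < lam := by linarith
  have hlr : 1 ≤ lam * (4 * (r - R) ^ 2) := by
    have h1 : 0 < 4 * (r - R) ^ 2 := by have := sub_pos.2 hr; positivity
    rw [← div_le_iff₀ h1]; exact (le_max_right _ _).trans hlam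
  have cg := carleman_gradient hR hr hl hlr h hb
  have ch := carleman_hessian hR hr hl h hb
  have hE := adm_carl R lam r
  have hp := adm_phase R r
  have es1 : ∀ x, u1 0 x ^ 2 + u1 1 x ^ 2 + u1 2 x ^ 2 = ∑ i, u1 i x ^ 2 := fun x =>
    (Fin.sum_univ_three fun i => u1 i x ^ 2).symm
  have es2 : ∀ x, u2 0 0 x + u2 1 1 x + u2 2 2 x = ∑ i, u2 i i x := fun x =>
    (Fin.sum_univ_three fun i => u2 i i x).symm
  simp only [es1, es2] at cg ch
  simp only [← carl_sq]
  set I := ∫ x in cube R, carl lam r x ^ 2 * (∑ i, u2 i i x) ^ 2 with hI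
  set G := ∫ x in cube R, carl lam r x ^ 2 * ∑ i, u1 i x ^ 2 with hG
  set H := ∫ x in cube R, carl lam r x ^ 2 * ∑ i, ∑ j, u2 i j x ^ 2 with hH
  set Z := ∫ x in cube R, carl lam r x ^ 2 * u x ^ 2 with hZ
  have I0 : 0 ≤ I := integral_nonneg fun x => by positivity
  have G0 : 0 ≤ G := integral_nonneg fun x => by positivity
  have Z0 : 0 ≤ Z := integral_nonneg fun x => by positivity
  have iG := h.integrable_weighted_grad lam r
  have iH := h.integrable_weighted_hess lam r
  have iZ : Integrable (fun x => carl lam r x ^ 2 * u x ^ 2) (cubeMeasure R) :=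
    (integrable_weight_mul (lam := lam) (r := r) (h.adm.memLp 2) (h.adm.memLp 2)).congr
      (Eventually.of_forall fun x => by ring)
  -- all bounds are in terms of `λ I`, where `I` is the weighted integral of `(Δu)²`
  have bG : lam * G ≤ 4 * I := by nlinarith [mul_nonneg (sq_nonneg lam) Z0]
  have bG2 : lam ^ 2 * G ≤ 4 * (lam * I) := by nlinarith
  have bI : I ≤ lam * I := by nlinarith
  have bG1 : G ≤ 4 * (lam * I) := by nlinarith
  have bZ : Z ≤ 4 * (lam * I) := by
    have h2 : Z ≤ lam ^ 2 * Z := le_mul_of_one_le_left Z0 (one_le_pow₀ hl)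
    linarith [mul_nonneg hl0.le G0]
  have bH : H ≤ (2 + 256 * P) * (lam * I) := by
    have := mul_le_mul_of_nonneg_left bG2 (show 0 ≤ 64 * P by positivity)
    nlinarith
  have lI : 0 ≤ lam * I := by positivity
  refine ⟨?_, ?_, fun g B hB mg gB => ?_⟩
  · have : 0 ≤ (6 + 256 * P + 48 * (C : ℝ) ^ 2 * (8 + 544 * P)) * I := by positivity
    nlinarith
  · have e : (∫ x in cube R, carl lam r x ^ 2 * (u x ^ 2 + ∑ i, u1 i x ^ 2 +
        ∑ i, ∑ j, u2 i j x ^ 2)) = Z + G + H := by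
      simp only [mul_add]
      rw [integral_add (show Integrable (fun x => carl lam r x ^ 2 * u x ^ 2 +
        carl lam r x ^ 2 * ∑ i, u1 i x ^ 2) (cubeMeasure R) from iZ.add iG) iH, integral_add iZ iG]
    rw [e]
    have : 0 ≤ (48 * (C : ℝ) ^ 2 * (8 + 544 * P)) * (lam * I) := by positivity
    nlinarith
  -- the first two parts bound `exp(λ(z - r)²) ∇u` in `W^{1,2}`, hence in `L⁶`, by `√(λ I)`
  · set Y := (8 + 544 * P) * (lam * I) with hY
    have hY0 : 0 ≤ Y := by positivity
    have six : ∀ i, eLpNorm (fun x => carl lam r x * u1 i x) 6 (cubeMeasure R) ≤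
        ENNReal.ofReal (C * (4 * Real.sqrt Y)) := by
      intro i
      have hv := hE.mul (h.adm1 i)
      have b0 : ∫ x in cube R, (carl lam r x * u1 i x) ^ 2 ≤ Y := by
        refine le_trans (integral_mono ((hv.memLp 2).integrable_sq) iG fun x => ?_)
          (bG1.trans ?_)
        · simp only [mul_pow]
          exact mul_le_mul_of_nonneg_left (Finset.single_le_sum (f := fun i => u1 i x ^ 2)
            (fun _ _ => sq_nonneg _) (Finset.mem_univ i)) (sq_nonneg _)
        · have : 0 ≤ (4 + 544 * P) * (lam * I) := by positivity
          nlinarith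
      have b1 : ∀ j, ∫ x in cube R, (carl lam r x * u2 i j x +
          vert j * (lam * phase r x * carl lam r x) * u1 i x) ^ 2 ≤ Y := by
        intro j
        refine (h.integral_weighted_hess_le hr i j).trans ?_
        have := mul_le_mul_of_nonneg_left bG2 (show 0 ≤ 8 * P by positivity)
        have : 0 ≤ lam * I * P := by positivity
        nlinarith
      have h6 := hC _ _ hv.weakH1
      refine h6.trans ?_
      rw [ENNReal.ofReal_mul (NNReal.coe_nonneg C), ENNReal.ofReal_coe_nnreal]
      refine mul_le_mul' le_rfl ?_
      calc _ ≤ ENNReal.ofReal (Real.sqrt Y) + ∑ _i : Fin 3, ENNReal.ofReal (Real.sqrt Y) :=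
            add_le_add (eLpNorm_two_le_sqrt (hv.memLp 2) b0)
              (Finset.sum_le_sum fun j _ => eLpNorm_two_le_sqrt (hv.1 j) (b1 j))
        _ = _ := by
          rw [ENNReal.ofReal_mul (by norm_num)]
          simp; ring
    have m6 : MemLp g 6 (cubeMeasure R) := ⟨mg, gB.trans_lt ENNReal.ofReal_lt_top⟩
    have iq : ∀ i, Integrable (fun x => g x ^ 4 * (carl lam r x * u1 i x) ^ 2) (cubeMeasure R) :=
      fun i => integrable_pow_four_mul_sq m6 ((hE.mul (h.adm1 i)).memLp 6)
    have bq : ∀ i, ∫ x in cube R, g x ^ 4 * (carl lam r x * u1 i x) ^ 2 ≤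
        B ^ 4 * (16 * (C : ℝ) ^ 2 * Y) := fun i => by
      refine (integral_pow_four_mul_sq_le mg (hE.mul (h.adm1 i)).aestronglyMeasurable hB
        (by positivity) gB (six i)).trans (le_of_eq ?_)
      rw [mul_pow, mul_pow, Real.sq_sqrt hY0]; ring
    rw [← integral_const_mul]
    have big : ∫ x in cube R, Real.sqrt lam * (carl lam r x ^ 2 * (|g x| * ∑ i, u1 i x ^ 2)) ≤
        ∫ x in cube R, (lam * (carl lam r x ^ 2 * ∑ i, u1 i x ^ 2) +
          (1 / lam) * ∑ i, g x ^ 4 * (carl lam r x * u1 i x) ^ 2) := by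
      refine integral_mono_of_nonneg (Eventually.of_forall fun x => by positivity)
        ((iG.const_mul _).add ((integrable_finsetSum _ fun i _ => iq i).const_mul _))
        (Eventually.of_forall fun x => ?_)
      have := mul_le_mul_of_nonneg_right (sqrt_mul_abs_le hl0 (g x))
        (show 0 ≤ carl lam r x ^ 2 * ∑ i, u1 i x ^ 2 by positivity)
      simp only [mul_pow, ← Finset.mul_sum]
      refine le_trans (le_of_eq (by ring)) (this.trans (le_of_eq (by ring)))
    refine big.trans ?_
    rw [integral_add (iG.const_mul _) ((integrable_finsetSum _ fun i _ => iq i).const_mul _),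
      integral_const_mul, integral_const_mul, integral_finsetSum _ fun i _ => iq i]
    have bs : ∑ i, ∫ x in cube R, g x ^ 4 * (carl lam r x * u1 i x) ^ 2 ≤
        lam * (48 * (C : ℝ) ^ 2 * (8 + 544 * P) * B ^ 4 * I) := by
      refine (Finset.sum_le_sum fun i _ => bq i).trans (le_of_eq ?_)
      simp [hY]; ring
    have bs' : 1 / lam * ∑ i, ∫ x in cube R, g x ^ 4 * (carl lam r x * u1 i x) ^ 2 ≤
        48 * (C : ℝ) ^ 2 * (8 + 544 * P) * B ^ 4 * I := by
      rw [one_div, inv_mul_le_iff₀ hl0]; exact bs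
    have n1 : 0 ≤ (6 + 256 * P + 48 * (C : ℝ) ^ 2 * (8 + 544 * P)) * I := by positivity
    have n2 : 0 ≤ (10 + 256 * P) * B ^ 4 * I := by positivity
    have e : (10 + 256 * P + 48 * (C : ℝ) ^ 2 * (8 + 544 * P)) * (1 + B ^ 4) * I =
        4 * I + 48 * (C : ℝ) ^ 2 * (8 + 544 * P) * B ^ 4 * I +
        (6 + 256 * P + 48 * (C : ℝ) ^ 2 * (8 + 544 * P)) * I + (10 + 256 * P) * B ^ 4 * I := by
      ring
    rw [e]
    linarith

/-! ### Representatives of Sobolev functions -/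

theorem norm_coord_le {R : ℝ} {N : ℕ} (V : H3 R N) (q : Fin N × MultiIndex 3) :
    ‖V.1 q‖ ≤ ‖V‖ := PiLp.norm_apply_le V.1 q

theorem isJet_part {R : ℝ} {N : ℕ} (V : H3 R N) (n : Fin N) (l : ℂ →L[ℝ] ℝ) :
    IsJet R (fun α x => l (V.1 (n, α) x)) := by
  refine ⟨fun α => l.comp_memLp' (Lp.memLp (V.1 (n, α))), fun α φ hφ => ?_⟩
  have h0 : ∫ x in cube R, multiDeriv α φ x • V.1 (n, idxZero) x =
      (-1 : ℝ) ^ α.order • ∫ x in cube R, φ x • V.1 (n, α) x := V.2 n α φ hφ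
  have h := congrArg l h0
  rw [map_smul, ← l.integral_comp_comm (integrable_test_smul
    (smooth_multiDeriv α ⟨hφ.smooth, hφ.compact⟩) _), ← l.integral_comp_comm
    (integrable_test_smul ⟨hφ.smooth, hφ.compact⟩ _)] at h
  simpa only [map_smul, smul_eq_mul] using h

theorem eLpNorm_part_le {R : ℝ} {N : ℕ} (V : H3 R N) (n : Fin N) {l : ℂ →L[ℝ] ℝ}
    (hl : ∀ z, |l z| ≤ ‖z‖) (α : MultiIndex 3) :
    eLpNorm (fun x => l (V.1 (n, α) x)) 2 (cubeMeasure R) ≤ ENNReal.ofReal ‖V‖ := by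
  refine (eLpNorm_mono fun x => hl _).trans ?_
  rw [← Lp.enorm_def, ← ofReal_norm]
  exact ENNReal.ofReal_le_ofReal (norm_coord_le V _)

/-- The Sobolev embeddings for the real part or the imaginary part of a component. -/
theorem exists_rep {R : ℝ} (hR : 0 < R) : ∃ C : ℝ, 0 ≤ C ∧ ∀ (N : ℕ) (V : H3 R N) (n : Fin N)
    (l : ℂ →L[ℝ] ℝ), (∀ z, |l z| ≤ ‖z‖) → ∃ (u : Space → ℝ) (u1 : Fin 3 → Space → ℝ),
      H3Fun R u u1 (fun i j x => l (V.1 (n, idx2 i j) x))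
        (fun i j k x => l (V.1 (n, idx3 i j k) x)) ∧
      (u =ᵐ[cubeMeasure R] fun x => l (comp V n x)) ∧
      (∀ i, u1 i =ᵐ[cubeMeasure R] fun x => l (grad V n i x)) ∧
      (∀ x ∈ closedCube R, |u x| ≤ C * ‖V‖) ∧
      (∀ i, ∀ x ∈ closedCube R, |u1 i x| ≤ C * ‖V‖) ∧
      ∀ i j, eLpNorm (fun x => l (V.1 (n, idx2 i j) x)) 6 (cubeMeasure R) ≤
        ENNReal.ofReal (C * ‖V‖) := by
  obtain ⟨C, hC⟩ := IsJet.exists_rep hR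
  refine ⟨C * Fintype.card (MultiIndex 3), by positivity, fun N V n l hl => ?_⟩
  obtain ⟨u, u1, h, e0, e1, b0, b1, b2⟩ := hC _ (isJet_part V n l)
  have hle : C * ∑ α, eLpNorm (fun x => l (V.1 (n, α) x)) 2 (cubeMeasure R) ≤
      ENNReal.ofReal (C * Fintype.card (MultiIndex 3) * ‖V‖) := by
    calc _ ≤ C * ∑ _α : MultiIndex 3, ENNReal.ofReal ‖V‖ :=
          mul_le_mul' le_rfl (Finset.sum_le_sum fun α _ => eLpNorm_part_le V n hl α)
      _ = _ := by
          rw [Finset.sum_const, Finset.card_univ, nsmul_eq_mul, ENNReal.ofReal_mul (by positivity),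
            ENNReal.ofReal_mul (NNReal.coe_nonneg C), ENNReal.ofReal_coe_nnreal,
            ENNReal.ofReal_natCast, mul_assoc]
  have hreal : ∀ y : ℝ, ‖y‖ₑ ≤ C * ∑ α, eLpNorm (fun x => l (V.1 (n, α) x)) 2 (cubeMeasure R) →
      |y| ≤ C * Fintype.card (MultiIndex 3) * ‖V‖ := by
    intro y hy
    have := hy.trans hle
    rw [Real.enorm_eq_ofReal_abs] at this
    exact (ENNReal.ofReal_le_ofReal_iff (by positivity)).1 this
  exact ⟨u, u1, h, e0, e1, fun x hx => hreal _ (b0 x hx), fun i x hx => hreal _ (b1 i x hx),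
    fun i j => (b2 i j).trans hle⟩

theorem closure_cube {R : ℝ} (hR : 0 < R) : closure (cube R) = closedCube R := by
  refine Subset.antisymm (closure_minimal (cube_subset_closedCube R)
    (isCompact_closedCube R).isClosed) fun x hx => ?_
  have h1 : Tendsto (fun t : ℝ => t • x) (𝓝[<] 1) (𝓝 ((1 : ℝ) • x)) :=
    ((continuous_id.smul continuous_const).tendsto 1).mono_left nhdsWithin_le_nhds
  rw [one_smul] at h1
  refine mem_closure_of_tendsto h1 ?_
  filter_upwards [self_mem_nhdsWithin,
    mem_nhdsWithin_of_mem_nhds (lt_mem_nhds (zero_lt_one' ℝ))] with t ht ht0 i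
  have : |x i| ≤ R := hx i
  simp only [PiLp.smul_apply, smul_eq_mul, abs_mul, abs_of_pos ht0]
  have ht1 : t < 1 := ht
  nlinarith [abs_nonneg (x i)]

theorem mem_frontier_cube {R : ℝ} (hR : 0 < R) {x : Space} (hx : x ∈ closedCube R) {i : Fin 3}
    (hi : |x i| = R) : x ∈ frontier (cube R) := by
  rw [frontier, closure_cube hR, (isOpen_cube R).interior_eq]
  exact ⟨hx, fun h => (h i).ne hi⟩

/-- Continuous representatives on the closed cube are unique. -/
theorem eqOn_closedCube {R : ℝ} (hR : 0 < R) {f g : Space → ℝ} (h : f =ᵐ[cubeMeasure R] g)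
    (hf : ContinuousOn f (closedCube R)) (hg : ContinuousOn g (closedCube R)) :
    EqOn f g (closedCube R) := by
  have h1 := Measure.eqOn_open_of_ae_eq h (isOpen_cube R) (hf.mono (cube_subset_closedCube R))
    (hg.mono (cube_subset_closedCube R))
  exact h1.of_subset_closure hf hg (cube_subset_closedCube R) (closure_cube hR).ge

theorem part_sub {R : ℝ} (l : ℂ →L[ℝ] ℝ) (v w : L2 R) :
    (fun x => l ((v - w : L2 R) x)) =ᵐ[cubeMeasure R] fun x => l (v x) - l (w x) := by
  filter_upwards [Lp.coeFn_sub v w] with x hx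
  rw [hx, Pi.sub_apply, map_sub]

/-- The difference of two elements of the closure of `B(M)` has zero boundary data, in the sense of
the continuous representatives of the function and of its gradient. On the edges of the lower face,
where no data are given, the normal derivative vanishes as a tangential derivative for another
face. -/
theorem zeroData_sub {R : ℝ} (hR : 0 < R) {N : ℕ} {M : ℝ} {ψ₀ ψ₁ : Fin N → Space → ℂ}
    {V₁ V₂ : H3 R N} (h₁ : V₁ ∈ closure (ball R N M ψ₀ ψ₁)) (h₂ : V₂ ∈ closure (ball R N M ψ₀ ψ₁))
    (n : Fin N) {l : ℂ →L[ℝ] ℝ} (hl : ∀ z, |l z| ≤ ‖z‖)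
    {u : Space → ℝ} {u1 : Fin 3 → Space → ℝ} {u2 : Fin 3 → Fin 3 → Space → ℝ}
    {u3 : Fin 3 → Fin 3 → Fin 3 → Space → ℝ} (h : H3Fun R u u1 u2 u3)
    (e0 : u =ᵐ[cubeMeasure R] fun x => l (comp (V₂ - V₁) n x))
    (e1 : ∀ i, u1 i =ᵐ[cubeMeasure R] fun x => l (grad (V₂ - V₁) n i x)) : ZeroData R u u1 := by
  obtain ⟨C, hC0, hC⟩ := exists_rep hR
  -- the boundary values of `V₂ - V₁` are as small as its distance from the differences in `B(M)`
  have approx : ∀ ε > 0, ∃ A ∈ ball R N M ψ₀ ψ₁, ∃ B ∈ ball R N M ψ₀ ψ₁,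
      ‖(V₂ - V₁) - (B - A)‖ ≤ ε := by
    intro ε hε
    obtain ⟨A, hA, hA'⟩ := Metric.mem_closure_iff.1 h₁ (ε / 2) (by positivity)
    obtain ⟨B, hB, hB'⟩ := Metric.mem_closure_iff.1 h₂ (ε / 2) (by positivity)
    refine ⟨A, hA, B, hB, ?_⟩
    rw [dist_eq_norm] at hA' hB'
    have e : (V₂ - V₁) - (B - A) = (V₂ - B) - (V₁ - A) := by abel
    rw [e]
    linarith [norm_sub_le (V₂ - B) (V₁ - A)]
  have small : ∀ {y : ℝ}, (∀ ε > 0, |y| ≤ C * ε) → y = 0 := by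
    intro y hy
    by_contra hne
    have hp : 0 < |y| := abs_pos.2 hne
    have := hy (|y| / (2 * (C + 1))) (by positivity)
    have h2 : C * (|y| / (2 * (C + 1))) = |y| * (C / (2 * (C + 1))) := by ring
    have h3 : C / (2 * (C + 1)) ≤ 1 / 2 := by
      rw [div_le_div_iff₀ (by positivity) (by norm_num)]; linarith
    nlinarith
  -- the argument for `V` and for its derivatives
  have main : ∀ (q : H3 R N → L2 R) (S : Set Space) (ψ : Space → ℂ) (v : Space → ℝ),
      (∀ A B : H3 R N, q (A - B) = q A - q B) →
      (∀ A ∈ ball R N M ψ₀ ψ₁, HasBoundaryValue (q A) S ψ) →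
      (∀ V : H3 R N, ∃ w : Space → ℝ, ContinuousOn w (closedCube R) ∧
        (w =ᵐ[cubeMeasure R] fun x => l (q V x)) ∧ ∀ x ∈ closedCube R, |w x| ≤ C * ‖V‖) →
      ContinuousOn v (closedCube R) → (v =ᵐ[cubeMeasure R] fun x => l (q (V₂ - V₁) x)) →
      ∀ x ∈ closedCube R, x ∈ S → v x = 0 := by
    intro q S ψ v hq hb hrep hv hve x hx hxS
    refine small fun ε hε => ?_
    obtain ⟨A, hA, B, hB, hAB⟩ := approx ε hε
    obtain ⟨wA, cA, eA, bA⟩ := hb A hA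
    obtain ⟨wB, cB, eB, bB⟩ := hb B hB
    rw [closure_cube hR] at cA cB
    obtain ⟨w, cw, ew, bw⟩ := hrep ((V₂ - V₁) - (B - A))
    have hw := eqOn_closedCube hR (f := w) (g := fun x => v x - l (wB x - wA x)) (by
      have s1 := part_sub l (q (V₂ - V₁)) (q B - q A)
      have s2 := part_sub l (q B) (q A)
      rw [hq, hq B A] at ew
      filter_upwards [ew, hve, s1, s2, eA, eB] with y y1 y2 y3 y4 y5 y6
      rw [y1, y3, y4, y2, y5, y6, map_sub]) cw
      (hv.sub (l.continuous.comp_continuousOn (cB.sub cA))) hx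
    change w x = v x - l (wB x - wA x) at hw
    have hbx := bw x hx
    rw [hw, bA x hxS, bB x hxS, sub_self, map_zero, sub_zero] at hbx
    exact hbx.trans (by gcongr)
  have z0 : ∀ x ∈ closedCube R, ∀ i, |x i| = R → u x = 0 := fun x hx i hi =>
    main (fun V => comp V n) _ (ψ₀ n) u (fun _ _ => rfl) (fun A hA => hA.2.1 n) (fun V => by
      obtain ⟨w, w1, hw, a, _, b, _⟩ := hC N V n l hl
      exact ⟨w, hw.adm.continuousOn, a, b⟩) h.adm.continuousOn e0 x hx (mem_frontier_cube hR hx hi)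
  refine ⟨z0, fun x hx hx2 => ?_⟩
  by_cases hx0 : |x 0| = R
  · exact h.tangential hR z0 (i := 0) (by decide) hx hx0
  by_cases hx1 : |x 1| = R
  · exact h.tangential hR z0 (i := 1) (by decide) hx hx1
  exact main (fun V => grad V n 2) _ (ψ₁ n) (u1 2) (fun _ _ => rfl) (fun A hA => hA.2.2 n) (fun V => by
      obtain ⟨w, w1, hw, _, a, _, b, _⟩ := hC N V n l hl
      exact ⟨w1 2, (hw.adm1 2).continuousOn, a 2, b 2⟩) (h.adm1 2).continuousOn (e1 2) x hx
      ⟨lt_of_le_of_ne (hx 0) hx0, lt_of_le_of_ne (hx 1) hx1, hx2⟩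

theorem abs_re_le (z : ℂ) : |Complex.reCLM z| ≤ ‖z‖ := Complex.abs_re_le_norm z

theorem abs_im_le (z : ℂ) : |Complex.imCLM z| ≤ ‖z‖ := Complex.abs_im_le_norm z

/-- `H³ ⊂ C¹` and `H³ ⊂ W^{2,6}` for complex components. -/
theorem exists_sobolev_bound {R : ℝ} (hR : 0 < R) : ∃ C : ℝ, 0 ≤ C ∧ ∀ (N : ℕ) (V : H3 R N)
    (n : Fin N), (∀ i, ∀ᵐ x ∂(cubeMeasure R), ‖grad V n i x‖ ≤ C * ‖V‖) ∧
      eLpNorm (lap V n) 6 (cubeMeasure R) ≤ ENNReal.ofReal (C * ‖V‖) := by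
  obtain ⟨C, hC0, hC⟩ := exists_rep hR
  refine ⟨6 * C, by positivity, fun N V n => ?_⟩
  obtain ⟨u, u1, hu, -, a, -, b, c⟩ := hC N V n _ abs_re_le
  obtain ⟨v, v1, hv, -, a', -, b', c'⟩ := hC N V n _ abs_im_le
  have hCV : 0 ≤ C * ‖V‖ := by positivity
  refine ⟨fun i => ?_, ?_⟩
  · filter_upwards [a i, a' i, ae_restrict_mem (measurableSet_cube R)] with x h1 h2 hx
    have h3 := b i x (cube_subset_closedCube R hx)
    have h4 := b' i x (cube_subset_closedCube R hx)
    rw [h1] at h3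
    rw [h2] at h4
    have := Complex.norm_le_abs_re_add_abs_im (grad V n i x)
    simp only [Complex.reCLM_apply, Complex.imCLM_apply] at h3 h4
    linarith
  · have m : ∀ q, AEStronglyMeasurable (V.1 q) (cubeMeasure R) := fun q => Lp.aestronglyMeasurable _
    have h1 : ∀ i, eLpNorm (V.1 (n, idxTwo i)) 6 (cubeMeasure R) ≤
        ENNReal.ofReal (2 * C * ‖V‖) := by
      intro i
      have s : ∀ l : ℂ →L[ℝ] ℝ, AEStronglyMeasurable (fun x => |l (V.1 (n, idxTwo i) x)|)
          (cubeMeasure R) := fun l => (l.continuous.comp_aestronglyMeasurable (m _)).norm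
      have h2 : eLpNorm (V.1 (n, idxTwo i)) 6 (cubeMeasure R) ≤
          eLpNorm ((fun x => |Complex.reCLM (V.1 (n, idxTwo i) x)|) +
            fun x => |Complex.imCLM (V.1 (n, idxTwo i) x)|) 6 (cubeMeasure R) :=
        eLpNorm_mono fun x => by
          simp only [Pi.add_apply, Real.norm_eq_abs]
          exact (Complex.norm_le_abs_re_add_abs_im _).trans (le_abs_self _)
      refine h2.trans ((eLpNorm_add_le (s _) (s _) (by norm_num)).trans ?_)
      have r1 := c i i
      have r2 := c' i i
      rw [← eLpNorm_norm] at r1 r2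
      simp only [idx2_self, Real.norm_eq_abs] at r1 r2
      refine (add_le_add r1 r2).trans (le_of_eq ?_)
      rw [← ENNReal.ofReal_add hCV hCV]; ring_nf
    have h3 : lap V n = ∑ i, (fun x => V.1 (n, idxTwo i) x) := by
      ext x; simp [lap]
    rw [h3]
    refine (eLpNorm_sum_le (fun i _ => m _) (by norm_num)).trans ?_
    refine (Finset.sum_le_sum fun i _ => h1 i).trans (le_of_eq ?_)
    rw [Finset.sum_const, Finset.card_univ, nsmul_eq_mul, Fintype.card_fin,
      show 6 * C * ‖V‖ = 3 * (2 * C * ‖V‖) by ring, ENNReal.ofReal_mul (p := 3) (by norm_num)]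
    congr 1
    simp

/-! ### The coefficients of the quasilinear operator -/

theorem contDiff_psi (a : ℝ) (n : ℕ) : ContDiff ℝ ∞ (psi a n) := by
  induction n using Nat.strong_induction_on with
  | _ n ih =>
    rw [psi]
    refine ContDiff.div_const (ContDiff.sub ?_ (ContDiff.sum fun m _ => ?_)) _
    · unfold basisFun; fun_prop
    · exact contDiff_const.mul (ih m.1 m.2)

theorem continuous_psi (a : ℝ) (n : ℕ) : Continuous (psi a n) := (contDiff_psi a n).continuous

theorem continuous_deriv_psi (a : ℝ) (n : ℕ) : Continuous (deriv (psi a n)) :=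
  (contDiff_psi a n).continuous_deriv (by simp)

/-- The distance to the source, truncated from below away from the cube in order to be positive
everywhere. -/
def truncDist (R d t : ℝ) (x : Space) : ℝ := max ‖shift d t x‖ (d - R)

theorem truncDist_eq {R d : ℝ} (t : ℝ) {x : Space} (hx : x ∈ cube R) : truncDist R d t x = ‖shift d t x‖ := by
  refine max_eq_left ?_
  have h1 : |shift d t x 2| ≤ ‖shift d t x‖ := PiLp.norm_apply_le (shift d t x) 2
  have h2 : shift d t x 2 = x 2 + d := rfl
  have h3 := (abs_lt.1 (hx 2)).1
  have h4 := le_abs_self (shift d t x 2)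
  rw [h2] at h4 h1
  linarith

theorem continuous_shift (d : ℝ) : Continuous fun p : Space × ℝ => shift d p.2 p.1 := by
  unfold shift
  refine (PiLp.continuous_toLp 2 _).comp (continuous_pi fun i => ?_)
  fin_cases i
  · exact (show Continuous fun p : Space × ℝ => p.1 0 - p.2 by fun_prop)
  · exact (show Continuous fun p : Space × ℝ => p.1 1 by fun_prop)
  · exact (show Continuous fun p : Space × ℝ => p.1 2 + d by fun_prop)

theorem continuous_truncDist (R d : ℝ) : Continuous fun p : Space × ℝ => truncDist R d p.2 p.1 :=
  (continuous_shift d).norm.max continuous_const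

theorem truncDist_pos {R d : ℝ} (hd : R < d) (t : ℝ) (x : Space) : 0 < truncDist R d t x :=
  (sub_pos.2 hd).trans_le (le_max_right _ _)

/-- The vector `x̃_α`, with the truncated distance. -/
def truncXTilde (R k d α : ℝ) (x : Space) (i : Fin 3) : ℂ :=
  Complex.I * k * (shift d α x i) / truncDist R d α x - (shift d α x i) / truncDist R d α x ^ 2

/-- The vector `x̂_α`, with the truncated distance. -/
def truncXHat (R k d α : ℝ) (x : Space) (i : Fin 3) : ℂ :=
  Complex.I * k / truncDist R d α x ^ 3 *
      (![-(x 1) ^ 2 - (x 2 + d) ^ 2, (x 0 - α) * x 1, (x 0 - α) * (x 2 + d)] i : ℝ) -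
    1 / truncDist R d α x ^ 4 *
      (![(x 0 - α) ^ 2 - (x 1) ^ 2 - (x 2 + d) ^ 2, 2 * (x 0 - α) * x 1,
        2 * (x 0 - α) * (x 2 + d)] i : ℝ)

theorem continuous_truncXTilde {R d : ℝ} (hd : R < d) (k : ℝ) (i : Fin 3) :
    Continuous fun p : Space × ℝ => truncXTilde R k d p.2 p.1 i := by
  have h1 : Continuous fun p : Space × ℝ => ((shift d p.2 p.1 i : ℝ) : ℂ) :=
    Complex.continuous_ofReal.comp
      ((EuclideanSpace.proj i : Space →L[ℝ] ℝ).continuous.comp (continuous_shift d))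
  have h2 : Continuous fun p : Space × ℝ => ((truncDist R d p.2 p.1 : ℝ) : ℂ) :=
    Complex.continuous_ofReal.comp (continuous_truncDist R d)
  have h3 : ∀ p : Space × ℝ, ((truncDist R d p.2 p.1 : ℝ) : ℂ) ≠ 0 := fun p =>
    Complex.ofReal_ne_zero.2 (truncDist_pos hd _ _).ne'
  unfold truncXTilde
  exact ((continuous_const.mul h1).div h2 h3).sub (h1.div (h2.pow 2) fun p => pow_ne_zero _ (h3 p))

theorem continuous_truncXHat {R d : ℝ} (hd : R < d) (k : ℝ) (i : Fin 3) :
    Continuous fun p : Space × ℝ => truncXHat R k d p.2 p.1 i := by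
  have h2 : Continuous fun p : Space × ℝ => ((truncDist R d p.2 p.1 : ℝ) : ℂ) :=
    Complex.continuous_ofReal.comp (continuous_truncDist R d)
  have h3 : ∀ p : Space × ℝ, ((truncDist R d p.2 p.1 : ℝ) : ℂ) ≠ 0 := fun p =>
    Complex.ofReal_ne_zero.2 (truncDist_pos hd _ _).ne'
  unfold truncXHat
  refine ((continuous_const.div (h2.pow 3) fun p => pow_ne_zero _ (h3 p)).mul
    (Complex.continuous_ofReal.comp ?_)).sub
    ((continuous_const.div (h2.pow 4) fun p => pow_ne_zero _ (h3 p)).mul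
    (Complex.continuous_ofReal.comp ?_))
  · fin_cases i
    · exact (show Continuous fun p : Space × ℝ => -(p.1 1) ^ 2 - (p.1 2 + d) ^ 2 by fun_prop)
    · exact (show Continuous fun p : Space × ℝ => (p.1 0 - p.2) * p.1 1 by fun_prop)
    · exact (show Continuous fun p : Space × ℝ => (p.1 0 - p.2) * (p.1 2 + d) by fun_prop)
  · fin_cases i
    · exact (show Continuous fun p : Space × ℝ =>
        (p.1 0 - p.2) ^ 2 - (p.1 1) ^ 2 - (p.1 2 + d) ^ 2 by fun_prop)
    · exact (show Continuous fun p : Space × ℝ => 2 * (p.1 0 - p.2) * p.1 1 by fun_prop)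
    · exact (show Continuous fun p : Space × ℝ => 2 * (p.1 0 - p.2) * (p.1 2 + d) by fun_prop)

/-- The coefficient of `∂ᵢvₙ` in `fₘ(∇V)/2`. -/
def fieldCoef (R a d k : ℝ) (m n : ℕ) (i : Fin 3) (x : Space) : ℂ :=
  (∫ t in -a..a, ((psi a m t * deriv (psi a n) t : ℝ) : ℂ) * truncXTilde R k d t x i) +
    ∫ t in -a..a, ((psi a m t * psi a n t : ℝ) : ℂ) * truncXHat R k d t x i

theorem continuous_fieldCoef {R d : ℝ} (hd : R < d) (a k : ℝ) (m n : ℕ) (i : Fin 3) :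
    Continuous (fieldCoef R a d k m n i) := by
  refine Continuous.add ?_ ?_
  · refine intervalIntegral.continuous_parametric_intervalIntegral_of_continuous' ?_ _ _
    exact (Complex.continuous_ofReal.comp (((continuous_psi a m).mul
      (continuous_deriv_psi a n)).comp continuous_snd)).mul (continuous_truncXTilde hd k i)
  · refine intervalIntegral.continuous_parametric_intervalIntegral_of_continuous' ?_ _ _
    exact (Complex.continuous_ofReal.comp (((continuous_psi a m).mul
      (continuous_psi a n)).comp continuous_snd)).mul (continuous_truncXHat hd k i)

theorem integral_mul_sum {a : ℝ} {c : ℝ → ℂ} {X : ℝ → Fin 3 → ℂ} (hc : Continuous c)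
    (hX : ∀ i, Continuous fun t => X t i) (p : Fin 3 → ℂ) :
    ∫ t in -a..a, c t * ∑ i, p i * X t i = ∑ i, (∫ t in -a..a, c t * X t i) * p i := by
  have e : ∀ t, c t * ∑ i, p i * X t i = ∑ i, c t * X t i * p i := fun t => by
    rw [Finset.mul_sum]; exact Finset.sum_congr rfl fun i _ => by ring
  simp only [e]
  have hi : ∀ i, Continuous fun t => c t * X t i * p i := fun i =>
    (hc.mul (hX i)).mul continuous_const
  rw [intervalIntegral.integral_finsetSum fun i _ => (hi i).intervalIntegrable _ _]
  simp only [intervalIntegral.integral_mul_const]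

/-- The nonlinearity as a quadratic polynomial in the gradient matrix. -/
theorem nonlin_eq {R d : ℝ} (hd : R < d) (a k : ℝ) (N : ℕ) {x : Space} (hx : x ∈ cube R)
    (P : Fin N → Fin 3 → ℂ) (m : Fin N) :
    nonlin a d k N x P m = 2 * (∑ n : Fin N, ∑ l : Fin N, (∑ i, P n i * P l i) *
      ((∫ t in -a..a, psi a m t * psi a n t * deriv (psi a l) t : ℝ) : ℂ)) +
      2 * ∑ n : Fin N, ∑ i, fieldCoef R a d k m n i x * P n i := by
  have e1 : ∀ t i, xTilde k d t x i = truncXTilde R k d t x i := fun t i => by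
    rw [xTilde, truncXTilde, truncDist_eq t hx]
  have e2 : ∀ t i, xHat k d t x i = truncXHat R k d t x i := fun t i => by
    rw [xHat, truncXHat, truncDist_eq t hx]
  have h1 : ∀ n : Fin N, ∫ t in -a..a, ((psi a m t * deriv (psi a n) t : ℝ) : ℂ) *
      ∑ i, P n i * xTilde k d t x i = ∑ i, (∫ t in -a..a,
        ((psi a m t * deriv (psi a n) t : ℝ) : ℂ) * truncXTilde R k d t x i) * P n i := by
    intro n
    simp only [e1]
    exact integral_mul_sum (Complex.continuous_ofReal.comp ((continuous_psi a m).mul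
      (continuous_deriv_psi a n))) (fun i => (continuous_truncXTilde hd k i).comp
        (by fun_prop : Continuous fun t : ℝ => (x, t))) _
  have h2 : ∀ n : Fin N, ∫ t in -a..a, ((psi a m t * psi a n t : ℝ) : ℂ) *
      ∑ i, xHat k d t x i * P n i = ∑ i, (∫ t in -a..a,
        ((psi a m t * psi a n t : ℝ) : ℂ) * truncXHat R k d t x i) * P n i := by
    intro n
    simp only [e2, mul_comm (truncXHat _ _ _ _ _ _) (P _ _)]
    exact integral_mul_sum (Complex.continuous_ofReal.comp ((continuous_psi a m).mul
      (continuous_psi a n))) (fun i => (continuous_truncXHat hd k i).comp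
        (by fun_prop : Continuous fun t : ℝ => (x, t))) _
  simp only [nonlin, h1, h2, fieldCoef, add_mul, Finset.sum_add_distrib]
  ring

/-- The coefficients of the quadratic part of `K(∇V) = S_N⁻¹ f(∇V)`. -/
def quadCoef (a : ℝ) (N : ℕ) (m n l : Fin N) : ℂ :=
  2 * ∑ j, (((matS a N)⁻¹ m j : ℝ) : ℂ) *
    ((∫ t in -a..a, psi a j t * psi a n t * deriv (psi a l) t : ℝ) : ℂ)

/-- The coefficients of the linear part of `K(∇V) = S_N⁻¹ f(∇V)`. -/
def linCoef (R a d k : ℝ) (N : ℕ) (m n : Fin N) (i : Fin 3) (x : Space) : ℂ :=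
  2 * ∑ j, (((matS a N)⁻¹ m j : ℝ) : ℂ) * fieldCoef R a d k j n i x

theorem continuous_linCoef {R d : ℝ} (hd : R < d) (a k : ℝ) {N : ℕ} (m n : Fin N) (i : Fin 3) :
    Continuous (linCoef R a d k N m n i) :=
  continuous_const.mul (continuous_finsetSum _ fun j _ =>
    continuous_const.mul (continuous_fieldCoef hd a k j n i))

/-- On the cube, `L(V)` is a quadratic polynomial in the derivatives of `V` with bounded
coefficients. -/
theorem opL_eq {R d : ℝ} (hd : R < d) (a k : ℝ) {N : ℕ} (V : H3 R N) {x : Space} (hx : x ∈ cube R)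
    (m : Fin N) :
    opL a d k V x m = (lap V m x + ∑ n, ∑ i, linCoef R a d k N m n i x * grad V n i x) +
      ∑ n, ∑ l, quadCoef a N m n l * ∑ i, grad V n i x * grad V l i x := by
  simp only [opL, nonlin_eq hd a k N hx, linCoef, quadCoef, mul_add, Finset.sum_add_distrib]
  have e1 : ∑ j, (((matS a N)⁻¹ m j : ℝ) : ℂ) * (2 * ∑ n : Fin N, ∑ l : Fin N,
      (∑ i, grad V n i x * grad V l i x) *
      ((∫ t in -a..a, psi a j t * psi a n t * deriv (psi a l) t : ℝ) : ℂ)) =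
      ∑ n : Fin N, ∑ l : Fin N, 2 * (∑ j : Fin N, (((matS a N)⁻¹ m j : ℝ) : ℂ) *
      ((∫ t in -a..a, psi a j t * psi a n t * deriv (psi a l) t : ℝ) : ℂ)) *
        ∑ i, grad V n i x * grad V l i x := by
    simp only [Finset.mul_sum (s := (Finset.univ : Finset (Fin N))),
      Finset.sum_mul (s := (Finset.univ : Finset (Fin N)))]
    rw [Finset.sum_comm]
    refine Finset.sum_congr rfl fun n _ => ?_
    rw [Finset.sum_comm]
    exact Finset.sum_congr rfl fun l _ => Finset.sum_congr rfl fun j _ => by ring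
  have e2 : ∑ j : Fin N, (((matS a N)⁻¹ m j : ℝ) : ℂ) * (2 * ∑ n : Fin N, ∑ i,
      fieldCoef R a d k j n i x * grad V n i x) = ∑ n : Fin N, ∑ i, 2 * (∑ j : Fin N,
      (((matS a N)⁻¹ m j : ℝ) : ℂ) * fieldCoef R a d k j n i x) * grad V n i x := by
    simp only [Finset.mul_sum, Finset.sum_mul]
    rw [Finset.sum_comm]
    refine Finset.sum_congr rfl fun n _ => ?_
    rw [Finset.sum_comm]
    exact Finset.sum_congr rfl fun i _ => Finset.sum_congr rfl fun j _ => by ring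
  rw [e1, e2]
  ring

/-! ### The operator as a continuous quadratic map into `L²` -/

section
variable {X Y : Type*} [NormedAddCommGroup X] [NormedSpace ℝ X] [NormedAddCommGroup Y]
  [InnerProductSpace ℝ Y]

/-- The squared norm of a quadratic map. -/
theorem hasFDerivAt_norm_sq_quadratic (T : X →L[ℝ] Y) (B : X →L[ℝ] X →L[ℝ] Y) (V : X) :
    HasFDerivAt (fun W => ‖T W + B W W‖ ^ 2)
      (2 • (innerSL ℝ (T V + B V V)).comp (T + (B V + B.flip V))) V := by
  have h : HasFDerivAt (fun W => T W + B W W) (T + (B V + B.flip V)) V := by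
    refine T.hasFDerivAt.add ?_
    have := B.hasFDerivAt_of_bilinear (hasFDerivAt_id V) (hasFDerivAt_id V)
    refine this.congr_fderiv ?_
    ext h
    simp
  exact h.norm_sq

/-- The exact second order Taylor remainder of the squared norm of a quadratic map. -/
theorem norm_sq_quadratic_expand (T : X →L[ℝ] Y) (B : X →L[ℝ] X →L[ℝ] Y) (V W : X) :
    ‖T W + B W W‖ ^ 2 - ‖T V + B V V‖ ^ 2 -
      (2 • (innerSL ℝ (T V + B V V)).comp (T + (B V + B.flip V))) (W - V) =
    ‖T (W - V) + B V (W - V) + B (W - V) V + B (W - V) (W - V)‖ ^ 2 +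
      2 * inner ℝ (T V + B V V) (B (W - V) (W - V)) := by
  obtain ⟨h, rfl⟩ : ∃ h, W = V + h := ⟨W - V, by abel⟩
  have e : T (V + h) + B (V + h) (V + h) =
      (T V + B V V) + (T h + B V h + B h V + B h h) := by
    simp only [map_add, add_apply]; abel
  rw [add_sub_cancel_left, e, norm_add_sq_real]
  simp only [smul_apply, ContinuousLinearMap.comp_apply, innerSL_apply_apply,
    add_apply, ContinuousLinearMap.flip_apply, inner_add_right]
  simp only [nsmul_eq_mul, Nat.cast_ofNat]
  ring

end

/-- Multiplication of an `L²` function by a bounded one. -/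
def mulInf (R : ℝ) : Lp ℂ ⊤ (cubeMeasure R) →L[ℝ] L2 R →L[ℝ] L2 R :=
  (ContinuousLinearMap.mul ℝ ℂ).holderL (cubeMeasure R) ⊤ 2 2

theorem coeFn_mulInf {R : ℝ} (f : Lp ℂ ⊤ (cubeMeasure R)) (g : L2 R) :
    mulInf R f g =ᵐ[cubeMeasure R] fun x => f x * g x :=
  (ContinuousLinearMap.mul ℝ ℂ).coeFn_holder f g

/-- The coordinates of `H³`. -/
def coordL (R : ℝ) (N : ℕ) (q : Fin N × MultiIndex 3) : H3 R N →L[ℝ] L2 R :=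
  (PiLp.proj 2 (fun _ : Fin N × MultiIndex 3 => L2 R) q : _ →L[ℝ] L2 R).comp
    (Sobolev R N 3).subtypeL

theorem coordL_apply {R : ℝ} {N : ℕ} (q : Fin N × MultiIndex 3) (V : H3 R N) :
    coordL R N q V = V.1 q := rfl

/-- `H³ ⊂ W^{1,∞}`, as a continuous linear map. -/
theorem exists_gradInf {R : ℝ} (hR : 0 < R) {N : ℕ} (n : Fin N) (i : Fin 3) :
    ∃ G : H3 R N →L[ℝ] Lp ℂ ⊤ (cubeMeasure R), ∀ V, G V =ᵐ[cubeMeasure R] grad V n i := by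
  obtain ⟨C, hC0, hC⟩ := exists_sobolev_bound hR
  have hm : ∀ V : H3 R N, MemLp (grad V n i) ⊤ (cubeMeasure R) := fun V =>
    MemLp.of_bound (Lp.aestronglyMeasurable _) (C * ‖V‖) ((hC N V n).1 i)
  refine ⟨LinearMap.mkContinuous
    { toFun := fun V => (hm V).toLp _
      map_add' := fun V W => ?_
      map_smul' := fun c V => ?_ } C fun V => ?_, fun V => (hm V).coeFn_toLp⟩
  · rw [← MemLp.toLp_add]
    exact MemLp.toLp_congr _ _ (Lp.coeFn_add (grad V n i) (grad W n i))
  · rw [RingHom.id_apply, ← MemLp.toLp_const_smul]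
    exact MemLp.toLp_congr _ _ (Lp.coeFn_smul c (grad V n i))
  · change ‖(hm V).toLp _‖ ≤ _
    rw [Lp.norm_toLp, eLpNorm_exponent_top]
    exact ENNReal.toReal_le_of_le_ofReal (by positivity)
      (eLpNormEssSup_le_of_ae_bound ((hC N V n).1 i))

theorem exists_lpInf {R : ℝ} {f : Space → ℂ} (hf : Continuous f) :
    ∃ F : Lp ℂ ⊤ (cubeMeasure R), F =ᵐ[cubeMeasure R] f := by
  obtain ⟨C, hC⟩ := (isCompact_closedCube R).exists_bound_of_continuousOn hf.continuousOn
  have : MemLp f ⊤ (cubeMeasure R) := MemLp.of_bound hf.aestronglyMeasurable C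
    (ae_cube fun x hx => hC x (cube_subset_closedCube R hx))
  exact ⟨this.toLp f, this.coeFn_toLp⟩

/-- The linear part of `L(V)`. -/
def linPart (a d k : ℝ) {R : ℝ} {N : ℕ} (V : H3 R N) (m : Fin N) (x : Space) : ℂ :=
  lap V m x + ∑ n, ∑ i, linCoef R a d k N m n i x * grad V n i x

/-- The polar form of the quadratic part of `L(V)`. -/
def quadPart (a : ℝ) {R : ℝ} {N : ℕ} (V W : H3 R N) (m : Fin N) (x : Space) : ℂ :=
  ∑ n, ∑ l, quadCoef a N m n l * ∑ i, grad V n i x * grad W l i x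

theorem coeFn_sum {R : ℝ} {ι : Type*} (s : Finset ι) (f : ι → L2 R) :
    (∑ i ∈ s, f i : L2 R) =ᵐ[cubeMeasure R] fun x => ∑ i ∈ s, f i x := by
  classical
  induction s using Finset.induction_on with
  | empty => simp only [Finset.sum_empty]; exact Lp.coeFn_zero ℂ 2 (cubeMeasure R)
  | insert i s hi ih =>
    rw [Finset.sum_insert hi]
    filter_upwards [Lp.coeFn_add (f i) (∑ i ∈ s, f i), ih] with x h1 h2
    rw [h1, Pi.add_apply, h2, Finset.sum_insert hi]

/-- The parts of `L`, multiplied by the square root of the Carleman weight, are continuous linear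
and bilinear maps into `L²`. -/
theorem exists_operators {R d : ℝ} (hR : 0 < R) (hd : R < d) (a k r lam : ℝ) (N : ℕ) :
    ∃ (T : Fin N → H3 R N →L[ℝ] L2 R) (B : Fin N → H3 R N →L[ℝ] H3 R N →L[ℝ] L2 R),
      (∀ m V, T m V =ᵐ[cubeMeasure R] fun x => (carl lam r x : ℂ) * linPart a d k V m x) ∧
      ∀ m V W, B m V W =ᵐ[cubeMeasure R] fun x => (carl lam r x : ℂ) * quadPart a V W m x := by
  have hE : Continuous fun x : Space => (carl lam r x : ℂ) := by unfold carl; fun_prop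
  obtain ⟨E, hE⟩ := exists_lpInf (R := R) hE
  have hb := fun m n i => exists_lpInf (R := R) (continuous_linCoef hd a k (N := N) m n i)
  choose b hb using hb
  have hq := fun m n l => exists_lpInf (R := R)
    (continuous_const : Continuous fun _ : Space => quadCoef a N m n l)
  choose q hq using hq
  have hG := fun n i => exists_gradInf hR (N := N) n i
  choose G hG using hG
  have hmul : ∀ (f : Lp ℂ ⊤ (cubeMeasure R)) (v : L2 R) (f' v' : Space → ℂ),
      f =ᵐ[cubeMeasure R] f' → v =ᵐ[cubeMeasure R] v' →
      mulInf R f v =ᵐ[cubeMeasure R] fun x => f' x * v' x := by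
    intro f v f' v' h1 h2
    filter_upwards [coeFn_mulInf f v, h1, h2] with x h3 h4 h5
    rw [h3, h4, h5]
  have hsum : ∀ {ι : Type} [Fintype ι] (f : ι → L2 R) (f' : ι → Space → ℂ),
      (∀ i, f i =ᵐ[cubeMeasure R] f' i) →
      (∑ i, f i : L2 R) =ᵐ[cubeMeasure R] fun x => ∑ i, f' i x := by
    intro ι _ f f' h
    filter_upwards [coeFn_sum Finset.univ f, ae_all_iff.2 h] with x h1 h2
    rw [h1]
    exact Finset.sum_congr rfl fun i _ => h2 i
  refine ⟨fun m => (mulInf R E).comp (∑ i, coordL R N (m, idxTwo i) +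
      ∑ n, ∑ i, (mulInf R (b m n i)).comp (coordL R N (n, idxOne i))),
    fun m => ((ContinuousLinearMap.compL ℝ (H3 R N) (L2 R) (L2 R)) (mulInf R E)).comp
      (∑ n, ∑ l, ((ContinuousLinearMap.compL ℝ (H3 R N) (L2 R) (L2 R)) (mulInf R (q m n l))).comp
        (∑ i, (mulInf R).bilinearComp (G n i) (coordL R N (l, idxOne i)))), fun m V => ?_,
    fun m V W => ?_⟩
  · simp only [ContinuousLinearMap.comp_apply, add_apply,
      _root_.sum_apply, coordL_apply]
    refine hmul _ _ _ _ hE ?_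
    have h1 := hsum (fun i => V.1 (m, idxTwo i)) (fun i x => V.1 (m, idxTwo i) x) fun _ => EventuallyEq.rfl
    have h2 := hsum (fun n => ∑ i, mulInf R (b m n i) (V.1 (n, idxOne i))) _ fun n =>
      hsum _ _ fun i => hmul _ _ _ _ (hb m n i) EventuallyEq.rfl
    filter_upwards [Lp.coeFn_add (∑ i, V.1 (m, idxTwo i))
      (∑ n, ∑ i, mulInf R (b m n i) (V.1 (n, idxOne i))), h1, h2] with x h3 h4 h5
    rw [h3, Pi.add_apply, h4, h5]
    rfl
  · simp only [ContinuousLinearMap.comp_apply, _root_.sum_apply,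
      ContinuousLinearMap.compL_apply, ContinuousLinearMap.bilinearComp_apply, coordL_apply]
    exact hmul _ _ _ _ hE (hsum _ _ fun n => hsum _ _ fun l => hmul _ _ _ _ (hq m n l)
      (hsum _ _ fun i => hmul _ _ _ _ (hG n i V) EventuallyEq.rfl))

/-! ### The Carleman estimate for differences of elements of `B(M)` -/

theorem L2_norm_sq {R : ℝ} (f : L2 R) : ‖f‖ ^ 2 = ∫ x in cube R, ‖f x‖ ^ 2 := by
  rw [← real_inner_self_eq_norm_sq, L2.inner_def]
  simp only [real_inner_self_eq_norm_sq]

theorem L2_inner {R : ℝ} (f g : L2 R) : inner ℝ f g = ∫ x in cube R, inner ℝ (f x) (g x) :=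
  L2.inner_def f g

theorem integrable_norm_sq {R : ℝ} (f : L2 R) :
    Integrable (fun x => ‖f x‖ ^ 2) (cubeMeasure R) :=
  (Lp.memLp f).norm.integrable_sq

theorem integrable_weight {R : ℝ} (lam r : ℝ) {f : Space → ℝ} (hf : Integrable f (cubeMeasure R)) :
    Integrable (fun x => weight lam r (x 2) * f x) (cubeMeasure R) := by
  obtain ⟨C, -, hC⟩ := ((adm_carl R lam r).mul (adm_carl R lam r)).bounded
  have hm := ((adm_carl R lam r).mul (adm_carl R lam r)).aestronglyMeasurable
  simp only [← pow_two, carl_sq] at hm hC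
  exact hf.bdd_mul hm (ae_cube fun x hx => hC x (cube_subset_closedCube R hx))

theorem weight_pos (lam r z : ℝ) : 0 < weight lam r z := Real.exp_pos _

theorem norm_sq_eq_parts (z : ℂ) : ‖z‖ ^ 2 = Complex.reCLM z ^ 2 + Complex.imCLM z ^ 2 := by
  rw [Complex.sq_norm, Complex.normSq_apply]
  simp [pow_two]

/-- The Carleman estimate for the components of a difference of two elements of the closure of
`B(M)`, from those for its real and imaginary parts. -/
theorem carleman_component {R r : ℝ} (hR : 0 < R) (hr : R < r) : ∃ K : ℝ, 0 < K ∧ ∃ lam₁ : ℝ,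
    1 ≤ lam₁ ∧ ∀ lam, lam₁ ≤ lam → ∀ (N : ℕ) (M : ℝ) (ψ₀ ψ₁ : Fin N → Space → ℂ),
    ∀ V₁ ∈ closure (ball R N M ψ₀ ψ₁), ∀ V₂ ∈ closure (ball R N M ψ₀ ψ₁), ∀ h : H3 R N,
    h = V₂ - V₁ → ∀ n,
    lam * (∫ x in cube R, weight lam r (x 2) * ∑ i, ‖grad h n i x‖ ^ 2) ≤
        K * (∫ x in cube R, weight lam r (x 2) * ‖lap h n x‖ ^ 2) ∧
    (∫ x in cube R, weight lam r (x 2) * (‖comp h n x‖ ^ 2 + ∑ i, ‖grad h n i x‖ ^ 2 +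
        ∑ i, ∑ j, ‖h.1 (n, idx2 i j) x‖ ^ 2)) ≤
        K * lam * (∫ x in cube R, weight lam r (x 2) * ‖lap h n x‖ ^ 2) ∧
    ∀ (g : Space → ℝ) (B : ℝ), 0 ≤ B → AEStronglyMeasurable g (cubeMeasure R) →
      eLpNorm g 6 (cubeMeasure R) ≤ ENNReal.ofReal B →
      Integrable (fun x => weight lam r (x 2) * (|g x| * ∑ i, ‖grad h n i x‖ ^ 2))
        (cubeMeasure R) ∧
      Real.sqrt lam * (∫ x in cube R, weight lam r (x 2) * (|g x| * ∑ i, ‖grad h n i x‖ ^ 2)) ≤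
        K * (1 + B ^ 4) * (∫ x in cube R, weight lam r (x 2) * ‖lap h n x‖ ^ 2) := by
  obtain ⟨K, hK, lam₁, hlam₁, hcarl⟩ := carleman hR hr
  obtain ⟨C, hC0, hC⟩ := exists_rep hR
  refine ⟨K, hK, lam₁, hlam₁, fun lam hlam N M ψ₀ ψ₁ V₁ h₁ V₂ h₂ h hh n => ?_⟩
  obtain ⟨u, u1, hu, u0e, u1e, -⟩ := hC N h n _ abs_re_le
  obtain ⟨v, v1, hv, v0e, v1e, -⟩ := hC N h n _ abs_im_le
  have zu : ZeroData R u u1 := zeroData_sub hR h₁ h₂ n abs_re_le hu (hh ▸ u0e) (hh ▸ u1e)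
  have zv : ZeroData R v v1 := zeroData_sub hR h₁ h₂ n abs_im_le hv (hh ▸ v0e) (hh ▸ v1e)
  obtain ⟨au, bu, cu⟩ := hcarl lam hlam _ _ _ _ hu zu
  obtain ⟨av, bv, cv⟩ := hcarl lam hlam _ _ _ _ hv zv
  set u2 : Fin 3 → Fin 3 → Space → ℝ := fun i j x => Complex.reCLM (h.1 (n, idx2 i j) x) with hu2
  set v2 : Fin 3 → Fin 3 → Space → ℝ := fun i j x => Complex.imCLM (h.1 (n, idx2 i j) x) with hv2
  have sq : ∀ {w : Space → ℝ} {w1 : Fin 3 → Space → ℝ}, Adm R w w1 →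
      Integrable (fun x => w x ^ 2) (cubeMeasure R) := fun hw => (hw.memLp 2).integrable_sq
  have iu1 : Integrable (fun x => ∑ i, u1 i x ^ 2) (cubeMeasure R) :=
    integrable_finsetSum _ fun i _ => sq (hu.adm1 i)
  have iv1 : Integrable (fun x => ∑ i, v1 i x ^ 2) (cubeMeasure R) :=
    integrable_finsetSum _ fun i _ => sq (hv.adm1 i)
  have iu2 : Integrable (fun x => (∑ i, u2 i i x) ^ 2) (cubeMeasure R) :=
    (memLp_finsetSum _ fun i _ => (hu.weak2 i i).1).integrable_sq
  have iv2 : Integrable (fun x => (∑ i, v2 i i x) ^ 2) (cubeMeasure R) :=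
    (memLp_finsetSum _ fun i _ => (hv.weak2 i i).1).integrable_sq
  have ju : Integrable (fun x => u x ^ 2 + ∑ i, u1 i x ^ 2 + ∑ i, ∑ j, u2 i j x ^ 2)
      (cubeMeasure R) := ((sq hu.adm).add iu1).add (integrable_finsetSum _ fun i _ =>
        integrable_finsetSum _ fun j _ => (hu.weak2 i j).1.integrable_sq)
  have jv : Integrable (fun x => v x ^ 2 + ∑ i, v1 i x ^ 2 + ∑ i, ∑ j, v2 i j x ^ 2)
      (cubeMeasure R) := ((sq hv.adm).add iv1).add (integrable_finsetSum _ fun i _ =>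
        integrable_finsetSum _ fun j _ => (hv.weak2 i j).1.integrable_sq)
  -- the three integrands are the sums of those for the real and for the imaginary part
  have eg : ∀ᵐ x ∂(cubeMeasure R), ∑ i, ‖grad h n i x‖ ^ 2 =
      ∑ i, u1 i x ^ 2 + ∑ i, v1 i x ^ 2 := by
    filter_upwards [ae_all_iff.2 u1e, ae_all_iff.2 v1e] with x h3 h4
    rw [← Finset.sum_add_distrib]
    exact Finset.sum_congr rfl fun i _ => by rw [norm_sq_eq_parts, h3 i, h4 i]
  have e1 : ∫ x in cube R, weight lam r (x 2) * ∑ i, ‖grad h n i x‖ ^ 2 =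
      (∫ x in cube R, weight lam r (x 2) * ∑ i, u1 i x ^ 2) +
        ∫ x in cube R, weight lam r (x 2) * ∑ i, v1 i x ^ 2 := by
    rw [← integral_add (integrable_weight lam r iu1) (integrable_weight lam r iv1)]
    refine integral_congr_ae ?_
    filter_upwards [eg] with x hx
    rw [hx, mul_add]
  have e2 : ∫ x in cube R, weight lam r (x 2) * ‖lap h n x‖ ^ 2 =
      (∫ x in cube R, weight lam r (x 2) * (∑ i, u2 i i x) ^ 2) +
        ∫ x in cube R, weight lam r (x 2) * (∑ i, v2 i i x) ^ 2 := by
    rw [← integral_add (integrable_weight lam r iu2) (integrable_weight lam r iv2)]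
    refine integral_congr_ae (Eventually.of_forall fun x => ?_)
    simp only [norm_sq_eq_parts, lap, map_sum, mul_add, hu2, hv2, idx2_self]
  have e3 : ∫ x in cube R, weight lam r (x 2) * (‖comp h n x‖ ^ 2 + ∑ i, ‖grad h n i x‖ ^ 2 +
        ∑ i, ∑ j, ‖h.1 (n, idx2 i j) x‖ ^ 2) =
      (∫ x in cube R, weight lam r (x 2) * (u x ^ 2 + ∑ i, u1 i x ^ 2 + ∑ i, ∑ j, u2 i j x ^ 2)) +
      ∫ x in cube R, weight lam r (x 2) * (v x ^ 2 + ∑ i, v1 i x ^ 2 + ∑ i, ∑ j, v2 i j x ^ 2) := by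
    rw [← integral_add (integrable_weight lam r ju) (integrable_weight lam r jv)]
    refine integral_congr_ae ?_
    filter_upwards [eg, u0e, v0e] with x hx h3 h4
    rw [hx, norm_sq_eq_parts, ← h3, ← h4]
    simp only [norm_sq_eq_parts, Finset.sum_add_distrib, hu2, hv2]
    ring
  refine ⟨by rw [e1, e2]; linarith, by rw [e2, e3]; linarith, fun g B hB mg gB => ?_⟩
  have hg1 : Integrable (fun x => |g x|) (cubeMeasure R) := by
    have m6 : MemLp g 6 (cubeMeasure R) := ⟨mg, gB.trans_lt ENNReal.ofReal_lt_top⟩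
    exact (m6.integrable (by norm_num)).norm
  have bd : ∀ {w : Fin 3 → Space → ℝ} {w' : Fin 3 → Fin 3 → Space → ℝ}, (∀ i, Adm R (w i) (w' i)) →
      Integrable (fun x => weight lam r (x 2) * (|g x| * ∑ i, w i x ^ 2)) (cubeMeasure R) := by
    intro w w' hw
    have hc : ContinuousOn (fun x => ∑ i, w i x ^ 2) (closedCube R) :=
      continuousOn_finsetSum _ fun i _ => (hw i).continuousOn.pow 2
    obtain ⟨D, hD⟩ := (isCompact_closedCube R).exists_bound_of_continuousOn hc
    exact integrable_weight lam r (hg1.mul_bdd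
      ((hc.mono (cube_subset_closedCube R)).aestronglyMeasurable (measurableSet_cube R))
      (ae_cube fun x hx => hD x (cube_subset_closedCube R hx)))
  have e4 : (fun x => weight lam r (x 2) * (|g x| * ∑ i, ‖grad h n i x‖ ^ 2)) =ᵐ[cubeMeasure R]
      fun x => weight lam r (x 2) * (|g x| * ∑ i, u1 i x ^ 2) +
        weight lam r (x 2) * (|g x| * ∑ i, v1 i x ^ 2) := by
    filter_upwards [eg] with x hx
    rw [hx]; ring
  refine ⟨((bd hu.adm1).add (bd hv.adm1)).congr e4.symm, ?_⟩
  rw [integral_congr_ae e4, integral_add (bd hu.adm1) (bd hv.adm1), e2]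
  have q1 := cu g B hB mg gB
  have q2 := cv g B hB mg gB
  linarith

theorem low_order_multiIndex (α : MultiIndex 3) (h : α.order ≤ 2) :
    α = idxZero ∨ (∃ i, α = idxOne i) ∨ ∃ i j, α = idx2 i j := by
  revert α; decide

theorem sum_low_order_le {F : MultiIndex 3 → ℝ} (hF : ∀ α, 0 ≤ F α) :
    ∑ α : MultiIndex 3 with α.order ≤ 2, F α ≤
      F idxZero + ∑ i, F (idxOne i) + ∑ i, ∑ j, F (idx2 i j) := by
  classical
  set ρ : Option (Fin 3 ⊕ Fin 3 × Fin 3) → MultiIndex 3 := fun o =>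
    o.elim idxZero fun s => s.elim idxOne fun p => idx2 p.1 p.2 with hρ
  have e : F idxZero + ∑ i, F (idxOne i) + ∑ i, ∑ j, F (idx2 i j) = ∑ o, F (ρ o) := by
    rw [Fintype.sum_option, Fintype.sum_sum_type, Fintype.sum_prod_type, add_assoc]
    rfl
  rw [e]
  have hsub : (Finset.univ.filter fun α : MultiIndex 3 => α.order ≤ 2) ⊆ Finset.univ.image ρ := by
    intro α hα
    rcases low_order_multiIndex α (Finset.mem_filter.1 hα).2 with rfl | ⟨i, rfl⟩ | ⟨i, j, rfl⟩
    · exact Finset.mem_image.2 ⟨none, Finset.mem_univ _, rfl⟩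
    · exact Finset.mem_image.2 ⟨some (Sum.inl i), Finset.mem_univ _, rfl⟩
    · exact Finset.mem_image.2 ⟨some (Sum.inr (i, j)), Finset.mem_univ _, rfl⟩
  refine (Finset.sum_le_sum_of_subset_of_nonneg hsub fun α _ _ => hF α).trans ?_
  exact Finset.sum_image_le_of_nonneg fun o _ => hF _

/-- The `H²` norm is controlled by the weighted integrals, because the weight is at least
`exp(2λ(r - R)²)` on the cube. -/
theorem normSqH2_le {R r lam : ℝ} (hr : R < r) (hl : 0 ≤ lam) {N : ℕ} (h : H3 R N) :
    Real.exp (2 * lam * (r - R) ^ 2) * normSqH2 h ≤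
      ∑ n, ∫ x in cube R, weight lam r (x 2) * (‖comp h n x‖ ^ 2 + ∑ i, ‖grad h n i x‖ ^ 2 +
        ∑ i, ∑ j, ‖h.1 (n, idx2 i j) x‖ ^ 2) := by
  rw [normSqH2, Finset.mul_sum]
  refine Finset.sum_le_sum fun n _ => ?_
  have i1 : Integrable (fun x => ‖comp h n x‖ ^ 2 + ∑ i, ‖grad h n i x‖ ^ 2 +
        ∑ i, ∑ j, ‖h.1 (n, idx2 i j) x‖ ^ 2) (cubeMeasure R) :=
    ((integrable_norm_sq _).add (integrable_finsetSum _ fun i _ => integrable_norm_sq _)).add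
      (integrable_finsetSum _ fun i _ => integrable_finsetSum _ fun j _ => integrable_norm_sq _)
  have e : ‖h.1 (n, idxZero)‖ ^ 2 + ∑ i, ‖h.1 (n, idxOne i)‖ ^ 2 +
      ∑ i, ∑ j, ‖h.1 (n, idx2 i j)‖ ^ 2 = ∫ x in cube R, (‖comp h n x‖ ^ 2 +
        ∑ i, ‖grad h n i x‖ ^ 2 + ∑ i, ∑ j, ‖h.1 (n, idx2 i j) x‖ ^ 2) := by
    rw [integral_add, integral_add, integral_finsetSum, integral_finsetSum]
    · simp only [L2_norm_sq]
      congr 1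
      refine Finset.sum_congr rfl fun i _ => ?_
      rw [integral_finsetSum _ fun j _ => integrable_norm_sq _]
    · exact fun i _ => integrable_finsetSum _ fun j _ => integrable_norm_sq _
    · exact fun i _ => integrable_norm_sq _
    · exact integrable_norm_sq _
    · exact integrable_finsetSum _ fun i _ => integrable_norm_sq _
    · exact (integrable_norm_sq _).add (integrable_finsetSum _ fun i _ => integrable_norm_sq _)
    · exact integrable_finsetSum _ fun i _ => integrable_finsetSum _ fun j _ => integrable_norm_sq _
  calc Real.exp (2 * lam * (r - R) ^ 2) * ∑ α : MultiIndex 3 with α.order ≤ 2, ‖h.1 (n, α)‖ ^ 2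
      ≤ Real.exp (2 * lam * (r - R) ^ 2) * (‖h.1 (n, idxZero)‖ ^ 2 + ∑ i, ‖h.1 (n, idxOne i)‖ ^ 2 +
      ∑ i, ∑ j, ‖h.1 (n, idx2 i j)‖ ^ 2) := by
        refine mul_le_mul_of_nonneg_left ?_ (Real.exp_pos _).le
        exact sum_low_order_le (F := fun α => ‖h.1 (n, α)‖ ^ 2) fun α => sq_nonneg _
    _ = ∫ x in cube R, Real.exp (2 * lam * (r - R) ^ 2) * (‖comp h n x‖ ^ 2 +
        ∑ i, ‖grad h n i x‖ ^ 2 + ∑ i, ∑ j, ‖h.1 (n, idx2 i j) x‖ ^ 2) := by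
        rw [e, integral_const_mul]
    _ ≤ _ := by
        refine integral_mono_ae (i1.const_mul _) (integrable_weight lam r i1) (ae_cube fun x hx => ?_)
        refine mul_le_mul_of_nonneg_right ?_ (by positivity)
        rw [weight]
        refine Real.exp_le_exp.2 ?_
        have h2 := (abs_lt.1 (hx 2)).2
        have h3 : (r - R) ^ 2 ≤ (x 2 - r) ^ 2 := by nlinarith
        nlinarith

/-! ### The functional -/

section Pointwise
variable {N : ℕ}

theorem norm_quad_le {q : Fin N → Fin N → ℂ} {κ Λ : ℝ} (hκ : 0 ≤ κ) (hq : ∀ n l, ‖q n l‖ ≤ κ)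
    {P p : Fin N → Fin 3 → ℂ} (hP : ∀ n i, ‖P n i‖ ≤ Λ) :
    ‖∑ n, ∑ l, q n l * ∑ i, P n i * p l i‖ ≤ N * κ * Λ * ∑ l, ∑ i, ‖p l i‖ := by
  have h : ∀ n l, ‖q n l * ∑ i, P n i * p l i‖ ≤ κ * Λ * ∑ i, ‖p l i‖ := by
    intro n l
    rw [norm_mul, mul_assoc]
    refine mul_le_mul (hq n l) ((norm_sum_le _ _).trans ?_) (norm_nonneg _) hκ
    rw [Finset.mul_sum]
    refine Finset.sum_le_sum fun i _ => ?_
    rw [norm_mul]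
    exact mul_le_mul_of_nonneg_right (hP n i) (norm_nonneg _)
  calc _ ≤ ∑ n : Fin N, ∑ l, κ * Λ * ∑ i, ‖p l i‖ :=
        (norm_sum_le _ _).trans (Finset.sum_le_sum fun n _ =>
          (norm_sum_le _ _).trans (Finset.sum_le_sum fun l _ => h n l))
    _ = _ := by
        rw [Finset.sum_const, Finset.card_univ, Fintype.card_fin, nsmul_eq_mul, ← Finset.mul_sum]
        ring

/-- The bound with the roles of the two arguments exchanged. -/
theorem norm_quad_le' {q : Fin N → Fin N → ℂ} {κ Λ : ℝ} (hκ : 0 ≤ κ) (hq : ∀ n l, ‖q n l‖ ≤ κ)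
    {P p : Fin N → Fin 3 → ℂ} (hp : ∀ n i, ‖p n i‖ ≤ Λ) :
    ‖∑ n, ∑ l, q n l * ∑ i, P n i * p l i‖ ≤ N * κ * Λ * ∑ n, ∑ i, ‖P n i‖ := by
  rw [Finset.sum_comm]
  simp only [mul_comm (P _ _) (p _ _)]
  exact norm_quad_le (q := fun l n => q n l) hκ (fun n l => hq l n) hp

theorem norm_lin_le {b : Fin N → Fin 3 → ℂ} {β : ℝ} (hb : ∀ n i, ‖b n i‖ ≤ β)
    (p : Fin N → Fin 3 → ℂ) : ‖∑ n, ∑ i, b n i * p n i‖ ≤ β * ∑ n, ∑ i, ‖p n i‖ := by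
  simp only [Finset.mul_sum]
  refine (norm_sum_le _ _).trans (Finset.sum_le_sum fun n _ =>
    (norm_sum_le _ _).trans (Finset.sum_le_sum fun i _ => ?_))
  rw [norm_mul]
  exact mul_le_mul_of_nonneg_right (hb n i) (norm_nonneg _)

theorem sum_norm_sq_le (p : Fin N → Fin 3 → ℂ) :
    (∑ n, ∑ i, ‖p n i‖) ^ 2 ≤ 3 * N * ∑ n, ∑ i, ‖p n i‖ ^ 2 := by
  rw [← Fintype.sum_prod_type', ← Fintype.sum_prod_type' (f := fun n i => ‖p n i‖ ^ 2)]
  have := sq_sum_le_card_mul_sum_sq (s := (Finset.univ : Finset (Fin N × Fin 3)))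
    (f := fun y => ‖p y.1 y.2‖)
  simpa [mul_comm] using this

theorem norm_le_sum (p : Fin N → Fin 3 → ℂ) (n : Fin N) (i : Fin 3) :
    ‖p n i‖ ≤ ∑ n, ∑ i, ‖p n i‖ :=
  (Finset.single_le_sum (f := fun i => ‖p n i‖) (fun _ _ => norm_nonneg _)
    (Finset.mem_univ i)).trans (Finset.single_le_sum (f := fun n => ∑ i, ‖p n i‖)
    (fun _ _ => Finset.sum_nonneg fun _ _ => norm_nonneg _) (Finset.mem_univ n))

end Pointwise

theorem norm_le_sum_norm {ι : Type*} [Fintype ι] (f : ι → ℂ) (i : ι) : ‖f i‖ ≤ ∑ i, ‖f i‖ :=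
  Finset.single_le_sum (f := fun i => ‖f i‖) (fun _ _ => norm_nonneg _) (Finset.mem_univ i)

theorem le_sum_abs {ι : Type*} [Fintype ι] (f : ι → ℝ) (i : ι) : f i ≤ ∑ i, |f i| :=
  (le_abs_self _).trans (Finset.single_le_sum (f := fun i => |f i|) (fun _ _ => abs_nonneg _)
    (Finset.mem_univ i))

theorem exists_coef_bounds {R d : ℝ} (hd : R < d) (a k : ℝ) (N : ℕ) : ∃ κ β : ℝ, 0 ≤ κ ∧ 0 ≤ β ∧
    (∀ m n l, ‖quadCoef a N m n l‖ ≤ κ) ∧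
    ∀ m n i, ∀ x ∈ cube R, ‖linCoef R a d k N m n i x‖ ≤ β := by
  have hb : ∀ y : Fin N × Fin N × Fin 3, ∃ β, ∀ x ∈ closedCube R,
      ‖linCoef R a d k N y.1 y.2.1 y.2.2 x‖ ≤ β := fun y =>
    (isCompact_closedCube R).exists_bound_of_continuousOn
      (continuous_linCoef hd a k y.1 y.2.1 y.2.2).continuousOn
  choose β hβ using hb
  refine ⟨∑ y : Fin N × Fin N × Fin N, ‖quadCoef a N y.1 y.2.1 y.2.2‖, ∑ y, |β y|,
    Finset.sum_nonneg fun _ _ => norm_nonneg _, Finset.sum_nonneg fun _ _ => abs_nonneg _,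
    fun m n l => ?_, fun m n i x hx => ?_⟩
  · exact norm_le_sum_norm (fun y : Fin N × Fin N × Fin N => quadCoef a N y.1 y.2.1 y.2.2) (m, n, l)
  · exact (hβ (m, n, i) x (cube_subset_closedCube R hx)).trans (le_sum_abs β (m, n, i))

set_option maxHeartbeats 1000000 in
/-- The Taylor remainder of `|L|²` of second order is bounded from below by the principal part of
the linearization, up to terms with the gradient; the coefficient `ΔV` in the last one comes from
the product of `L(V)` with the quadratic part of `L`. -/
theorem exists_pointwise_lower {R d : ℝ} (hR : 0 < R) (hd : R < d) (a k : ℝ) (N : ℕ) {M : ℝ}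
    (hM : 0 < M) : ∃ A : ℝ, 0 ≤ A ∧ ∀ V h : H3 R N, ‖V‖ ≤ M → ‖h‖ ≤ 2 * M →
    ∀ᵐ x ∂(cubeMeasure R), ∀ m,
      1 / 2 * ‖lap h m x‖ ^ 2 - A * (1 + ‖lap V m x‖) * ∑ n, ∑ i, ‖grad h n i x‖ ^ 2 ≤
      ‖linPart a d k h m x + quadPart a V h m x + quadPart a h V m x + quadPart a h h m x‖ ^ 2 +
        2 * inner ℝ (linPart a d k V m x + quadPart a V V m x) (quadPart a h h m x) := by
  obtain ⟨C, hC0, hC⟩ := exists_sobolev_bound hR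
  obtain ⟨κ, β, hκ, hβ, hq, hb⟩ := exists_coef_bounds hd a k N
  set c₁ := β + 4 * (N * κ * (C * M)) with hc₁
  set c₂ := (β + N * κ * (C * M)) * (3 * N * (C * M)) with hc₂
  set c₃ := (N : ℝ) * κ * (3 * N) with hc₃
  have h1 : 0 ≤ c₁ := by positivity
  have h2 : 0 ≤ c₂ := by positivity
  have h3 : 0 ≤ c₃ := by positivity
  refine ⟨c₁ ^ 2 * (3 * N) + 2 * c₂ * c₃ + 2 * c₃, by positivity, fun V h hV hh => ?_⟩
  filter_upwards [ae_all_iff.2 fun n => ae_all_iff.2 (hC N V n).1,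
    ae_all_iff.2 fun n => ae_all_iff.2 (hC N h n).1, ae_restrict_mem (measurableSet_cube R)]
    with x gV gh hx m
  have gV' : ∀ n i, ‖grad V n i x‖ ≤ C * M := fun n i => (gV n i).trans (by gcongr)
  have gh' : ∀ n i, ‖grad h n i x‖ ≤ C * (2 * M) := fun n i => (gh n i).trans (by gcongr)
  set s := ∑ n, ∑ i, ‖grad h n i x‖ ^ 2 with hs
  set t := ∑ n, ∑ i, ‖grad h n i x‖ with ht
  have s0 : 0 ≤ s := by positivity
  have t0 : 0 ≤ t := by positivity
  have ts : t ^ 2 ≤ 3 * N * s := sum_norm_sq_le fun n i => grad h n i x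
  have tV : ∑ n, ∑ i, ‖grad V n i x‖ ≤ 3 * N * (C * M) := by
    calc _ ≤ ∑ _n : Fin N, ∑ _i : Fin 3, C * M :=
          Finset.sum_le_sum fun n _ => Finset.sum_le_sum fun i _ => gV' n i
      _ = _ := by simp; ring
  -- the lower order part of the increment
  set ρ := (∑ n, ∑ i, linCoef R a d k N m n i x * grad h n i x) + quadPart a V h m x +
    quadPart a h V m x + quadPart a h h m x with hρ
  have bl := norm_lin_le (fun n i => hb m n i x hx) fun n i => grad h n i x
  have b1 : ‖quadPart a V h m x‖ ≤ N * κ * (C * M) * t := norm_quad_le hκ (hq m) gV'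
  have b2 : ‖quadPart a h V m x‖ ≤ N * κ * (C * M) * t := norm_quad_le' hκ (hq m) gV'
  have b3 : ‖quadPart a h h m x‖ ≤ N * κ * (C * (2 * M)) * t := norm_quad_le hκ (hq m) gh'
  have b4 : ‖quadPart a h h m x‖ ≤ c₃ * s := by
    refine (norm_quad_le hκ (hq m) (norm_le_sum fun n i => grad h n i x)).trans ?_
    change N * κ * t * t ≤ _
    calc N * κ * t * t = N * κ * t ^ 2 := by ring
      _ ≤ N * κ * (3 * N * s) := by gcongr
      _ = c₃ * s := by rw [hc₃]; ring
  have bρ : ‖ρ‖ ≤ c₁ * t := by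
    refine (norm_add_le _ _).trans ((add_le_add ((norm_add_le _ _).trans
      (add_le_add ((norm_add_le _ _).trans (add_le_add bl b1)) b2)) b3).trans (le_of_eq ?_))
    rw [hc₁]; ring
  have bL : ‖linPart a d k V m x + quadPart a V V m x‖ ≤ ‖lap V m x‖ + c₂ := by
    have l1 := norm_lin_le (fun n i => hb m n i x hx) fun n i => grad V n i x
    have l2 : ‖quadPart a V V m x‖ ≤ _ := norm_quad_le hκ (hq m) gV'
    refine (norm_add_le _ _).trans ((add_le_add (norm_add_le _ _) le_rfl).trans ?_)
    have l3 := mul_le_mul_of_nonneg_left tV (show 0 ≤ β + N * κ * (C * M) by positivity)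
    rw [hc₂]
    linarith
  have e : linPart a d k h m x + quadPart a V h m x + quadPart a h V m x + quadPart a h h m x =
      lap h m x + ρ := by rw [hρ, linPart]; ring
  -- `|Δh|² ≤ 2 |Δh + ρ|² + 2 |ρ|²`
  have low : 1 / 2 * ‖lap h m x‖ ^ 2 - c₁ ^ 2 * (3 * N) * s ≤ ‖lap h m x + ρ‖ ^ 2 := by
    have n1 : ‖lap h m x‖ ≤ ‖lap h m x + ρ‖ + ‖ρ‖ := by
      simpa using norm_sub_le (lap h m x + ρ) ρ
    have n2 : ‖ρ‖ ^ 2 ≤ c₁ ^ 2 * (3 * N * s) := by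
      calc ‖ρ‖ ^ 2 ≤ (c₁ * t) ^ 2 := by gcongr
        _ = c₁ ^ 2 * t ^ 2 := by ring
        _ ≤ _ := by gcongr
    have n3 : ‖lap h m x‖ ^ 2 ≤ (‖lap h m x + ρ‖ + ‖ρ‖) ^ 2 := by gcongr
    nlinarith [sq_nonneg (‖lap h m x + ρ‖ - ‖ρ‖)]
  have low2 : -((‖lap V m x‖ + c₂) * (c₃ * s)) ≤
      inner ℝ (linPart a d k V m x + quadPart a V V m x) (quadPart a h h m x) := by
    have := (abs_le.1 (abs_real_inner_le_norm (linPart a d k V m x + quadPart a V V m x)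
      (quadPart a h h m x))).1
    have := mul_le_mul bL b4 (norm_nonneg _) (by positivity)
    linarith
  rw [e]
  have p1 : 0 ≤ c₁ ^ 2 * (3 * N) * ‖lap V m x‖ * s := by positivity
  have p2 : 0 ≤ c₂ * c₃ * ‖lap V m x‖ * s := by positivity
  have p3 : 0 ≤ c₃ * s := by positivity
  nlinarith

theorem norm_sq_eq_sum {R : ℝ} {N : ℕ} (V : H3 R N) : ‖V‖ ^ 2 = ∑ q, ‖coordL R N q V‖ ^ 2 :=
  PiLp.norm_sq_eq_of_L2 _ V.1

theorem norm_sq_carl_mul (lam r : ℝ) (x : Space) (z : ℂ) :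
    ‖(carl lam r x : ℂ) * z‖ ^ 2 = weight lam r (x 2) * ‖z‖ ^ 2 := by
  rw [norm_mul, mul_pow, Complex.norm_real, Real.norm_eq_abs, sq_abs, carl_sq]

theorem inner_carl_mul (lam r : ℝ) (x : Space) (z w : ℂ) :
    inner ℝ ((carl lam r x : ℂ) * z) ((carl lam r x : ℂ) * w) =
      weight lam r (x 2) * inner ℝ z w := by
  rw [← Complex.real_smul, ← Complex.real_smul, real_inner_smul_left, real_inner_smul_right,
    ← carl_sq]
  ring

/-- The integral in the functional converges. -/
theorem integrable_integrand {R d : ℝ} (hR : 0 < R) (hd : R < d) (a k r lam : ℝ) {N : ℕ}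
    (V : H3 R N) : Integrable (integrand a d k r lam V) (cubeMeasure R) := by
  obtain ⟨T, B, hT, hB⟩ := exists_operators hR hd a k r lam N
  refine (integrable_finsetSum Finset.univ fun m _ => integrable_norm_sq (T m V + B m V V)).congr ?_
  filter_upwards [ae_all_iff.2 fun m => hT m V, ae_all_iff.2 fun m => hB m V V,
    ae_all_iff.2 fun m => Lp.coeFn_add (T m V) (B m V V),
    ae_restrict_mem (measurableSet_cube R)] with x h1 h2 h3 hx
  simp only [integrand, Finset.sum_mul]
  refine Finset.sum_congr rfl fun m _ => ?_
  rw [h3 m, Pi.add_apply, h1 m, h2 m, ← mul_add, norm_sq_carl_mul, opL_eq hd a k V hx, mul_comm]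
  rfl

/-- The functional in terms of the operators into `L²`. -/
theorem functionalJ_eq {R d : ℝ} (hd : R < d) (a k r lam γ : ℝ) {N : ℕ}
    {T : Fin N → H3 R N →L[ℝ] L2 R} {B : Fin N → H3 R N →L[ℝ] H3 R N →L[ℝ] L2 R}
    (hT : ∀ m V, T m V =ᵐ[cubeMeasure R] fun x => (carl lam r x : ℂ) * linPart a d k V m x)
    (hB : ∀ m V W, B m V W =ᵐ[cubeMeasure R] fun x => (carl lam r x : ℂ) * quadPart a V W m x)
    (V : H3 R N) : functionalJ a d k r lam γ V =
      Real.exp (-2 * lam * (R + r) ^ 2) * ∑ m, ‖T m V + B m V V‖ ^ 2 +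
        γ * ∑ q, ‖coordL R N q V‖ ^ 2 := by
  rw [functionalJ, norm_sq_eq_sum]
  congr 2
  simp only [L2_norm_sq]
  rw [← integral_finsetSum _ fun m _ => integrable_norm_sq _]
  refine integral_congr_ae ?_
  filter_upwards [ae_all_iff.2 fun m => hT m V, ae_all_iff.2 fun m => hB m V V,
    ae_all_iff.2 fun m => Lp.coeFn_add (T m V) (B m V V),
    ae_restrict_mem (measurableSet_cube R)] with x h1 h2 h3 hx
  simp only [integrand, Finset.sum_mul]
  refine Finset.sum_congr rfl fun m _ => ?_
  rw [h3 m, Pi.add_apply, h1 m, h2 m, ← mul_add, norm_sq_carl_mul, opL_eq hd a k V hx, mul_comm]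
  rfl

theorem norm_sq_linear_expand {X Y : Type*} [NormedAddCommGroup X] [NormedSpace ℝ X]
    [NormedAddCommGroup Y] [InnerProductSpace ℝ Y] (T : X →L[ℝ] Y) (V W : X) :
    ‖T W‖ ^ 2 - ‖T V‖ ^ 2 - (2 • (innerSL ℝ (T V)).comp T) (W - V) = ‖T (W - V)‖ ^ 2 := by
  simpa using norm_sq_quadratic_expand T 0 V W

/-- The second order Taylor remainder of one of the terms `‖T W + B W W‖²`, as a weighted integral. -/
theorem taylor_component {R a d k r lam : ℝ} {N : ℕ} {m : Fin N} {T : H3 R N →L[ℝ] L2 R}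
    {B : H3 R N →L[ℝ] H3 R N →L[ℝ] L2 R}
    (hT : ∀ V, T V =ᵐ[cubeMeasure R] fun x => (carl lam r x : ℂ) * linPart a d k V m x)
    (hB : ∀ V W, B V W =ᵐ[cubeMeasure R] fun x => (carl lam r x : ℂ) * quadPart a V W m x)
    (V W : H3 R N) :
    ‖T W + B W W‖ ^ 2 - ‖T V + B V V‖ ^ 2 -
        (2 • (innerSL ℝ (T V + B V V)).comp (T + (B V + B.flip V))) (W - V) =
      ∫ x in cube R, weight lam r (x 2) * (‖linPart a d k (W - V) m x + quadPart a V (W - V) m x +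
        quadPart a (W - V) V m x + quadPart a (W - V) (W - V) m x‖ ^ 2 +
        2 * inner ℝ (linPart a d k V m x + quadPart a V V m x)
          (quadPart a (W - V) (W - V) m x)) ∧
      Integrable (fun x => weight lam r (x 2) * (‖linPart a d k (W - V) m x +
        quadPart a V (W - V) m x + quadPart a (W - V) V m x +
        quadPart a (W - V) (W - V) m x‖ ^ 2 +
        2 * inner ℝ (linPart a d k V m x + quadPart a V V m x)
          (quadPart a (W - V) (W - V) m x))) (cubeMeasure R) := by
  rw [norm_sq_quadratic_expand]
  generalize W - V = h
  have i1 := integrable_norm_sq (T h + B V h + B h V + B h h)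
  have i2 : Integrable (fun x => inner ℝ ((T V + B V V : L2 R) x) (B h h x))
      (cubeMeasure R) := L2.integrable_inner _ _
  have ae : (fun x => ‖(T h + B V h + B h V + B h h : L2 R) x‖ ^ 2 +
      2 * inner ℝ ((T V + B V V : L2 R) x) (B h h x)) =ᵐ[cubeMeasure R]
      fun x => weight lam r (x 2) * (‖linPart a d k h m x + quadPart a V h m x +
      quadPart a h V m x + quadPart a h h m x‖ ^ 2 +
      2 * inner ℝ (linPart a d k V m x + quadPart a V V m x) (quadPart a h h m x)) := by
    filter_upwards [hT h, hT V, hB V h, hB h V, hB h h, hB V V,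
      Lp.coeFn_add (T h + B V h + B h V) (B h h),
      Lp.coeFn_add (T h + B V h) (B h V), Lp.coeFn_add (T h) (B V h),
      Lp.coeFn_add (T V) (B V V)] with x h1 h2 h3 h4 h5 h6 h7 h8 h9 h10
    rw [h7, Pi.add_apply, h8, Pi.add_apply, h9, Pi.add_apply, h10, Pi.add_apply, h1, h2, h3, h4,
      h5, h6, ← mul_add, ← mul_add, ← mul_add, ← mul_add, norm_sq_carl_mul, inner_carl_mul]
    ring
  refine ⟨?_, (i1.add (i2.const_mul 2)).congr ae⟩
  rw [L2_norm_sq, L2_inner, ← integral_const_mul,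
    ← integral_add i1 (i2.const_mul 2)]
  exact integral_congr_ae ae

/-- The integrand of the second order Taylor remainder of the functional. -/
def remainder (a d k : ℝ) {R : ℝ} {N : ℕ} (V h : H3 R N) (x : Space) : ℝ :=
  ∑ m, (‖linPart a d k h m x + quadPart a V h m x + quadPart a h V m x + quadPart a h h m x‖ ^ 2 +
    2 * inner ℝ (linPart a d k V m x + quadPart a V V m x) (quadPart a h h m x))

/-- The functional is differentiable, with an explicit second order Taylor remainder. -/
theorem exists_hasFDerivAt {R d : ℝ} (hR : 0 < R) (hd : R < d) (a k r lam γ : ℝ) {N : ℕ}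
    (V : H3 R N) : ∃ A : H3 R N →L[ℝ] ℝ,
      HasFDerivAt (fun W : H3 R N => functionalJ a d k r lam γ W) A V ∧ ∀ W : H3 R N,
      Integrable (fun x => weight lam r (x 2) * remainder a d k V (W - V) x) (cubeMeasure R) ∧
      functionalJ a d k r lam γ W - functionalJ a d k r lam γ V - A (W - V) =
        Real.exp (-2 * lam * (R + r) ^ 2) *
          (∫ x in cube R, weight lam r (x 2) * remainder a d k V (W - V) x) +
        γ * ‖W - V‖ ^ 2 := by
  obtain ⟨T, B, hT, hB⟩ := exists_operators hR hd a k r lam N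
  have hJ := functionalJ_eq hd a k r lam γ hT hB
  set A₁ : Fin N → H3 R N →L[ℝ] ℝ := fun m =>
    2 • (innerSL ℝ (T m V + B m V V)).comp (T m + (B m V + (B m).flip V)) with hA₁
  set A₂ : Fin N × MultiIndex 3 → H3 R N →L[ℝ] ℝ := fun q =>
    2 • (innerSL ℝ (coordL R N q V)).comp (coordL R N q) with hA₂
  refine ⟨Real.exp (-2 * lam * (R + r) ^ 2) • ∑ m, A₁ m + γ • ∑ q, A₂ q, ?_, fun W => ?_⟩
  · rw [funext hJ]
    refine ((HasFDerivAt.fun_sum fun m _ => hasFDerivAt_norm_sq_quadratic (T m) (B m) V).const_mul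
      _).add ((HasFDerivAt.fun_sum fun q _ => ?_).const_mul _)
    exact (coordL R N q).hasFDerivAt.norm_sq
  set h := W - V with hh
  have e1 := fun m => taylor_component (hT m) (hB m) V W
  have e2 : ∀ q, ‖coordL R N q W‖ ^ 2 - ‖coordL R N q V‖ ^ 2 - A₂ q h = ‖coordL R N q h‖ ^ 2 :=
    fun q => norm_sq_linear_expand (coordL R N q) V W
  have i : Integrable (fun x => weight lam r (x 2) * remainder a d k V h x) (cubeMeasure R) := by
    simp only [remainder, Finset.mul_sum]
    exact integrable_finsetSum _ fun m _ => (e1 m).2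
  refine ⟨i, ?_⟩
  have e3 : ∫ x in cube R, weight lam r (x 2) * remainder a d k V h x =
      ∑ m, (‖T m W + B m W W‖ ^ 2 - ‖T m V + B m V V‖ ^ 2 - A₁ m h) := by
    simp only [remainder, Finset.mul_sum]
    rw [integral_finsetSum _ fun m _ => (e1 m).2]
    exact Finset.sum_congr rfl fun m _ => (e1 m).1.symm
  rw [e3, hJ W, hJ V, norm_sq_eq_sum h, ← Finset.sum_congr rfl fun q _ => e2 q]
  simp only [Finset.sum_sub_distrib, add_apply, smul_apply, _root_.sum_apply, smul_eq_mul]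
  ring

/-! ### Strict convexity -/

theorem norm_le_of_mem_closure_ball {R : ℝ} {N : ℕ} {M : ℝ} {ψ₀ ψ₁ : Fin N → Space → ℂ}
    {V : H3 R N} (h : V ∈ closure (ball R N M ψ₀ ψ₁)) : ‖V‖ ≤ M := by
  have hs : ball R N M ψ₀ ψ₁ ⊆ {V | ‖V‖ ≤ M} := fun W hW => hW.1.le
  exact closure_minimal hs (isClosed_le continuous_norm continuous_const) h

/-- Boundary values are preserved under affine combinations. -/
theorem HasBoundaryValue.convex {R : ℝ} {S : Set Space} {g : Space → ℂ} {v w : L2 R}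
    (hv : HasBoundaryValue v S g) (hw : HasBoundaryValue w S g) {s t : ℝ} (hst : s + t = 1) :
    HasBoundaryValue (s • v + t • w) S g := by
  obtain ⟨f₁, c₁, e₁, b₁⟩ := hv
  obtain ⟨f₂, c₂, e₂, b₂⟩ := hw
  refine ⟨fun x => s • f₁ x + t • f₂ x, (c₁.const_smul s).add (c₂.const_smul t), ?_,
    fun x hx => ?_⟩
  · filter_upwards [e₁, e₂, Lp.coeFn_add (s • v) (t • w), Lp.coeFn_smul s v, Lp.coeFn_smul t w]
      with x h1 h2 h3 h4 h5
    rw [h3, Pi.add_apply, h4, h5, Pi.smul_apply, Pi.smul_apply, h1, h2]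
  · simp only [b₁ x hx, b₂ x hx]
    rw [← add_smul, hst, one_smul]

theorem ball_convex (R : ℝ) (N : ℕ) (M : ℝ) (ψ₀ ψ₁ : Fin N → Space → ℂ) :
    Convex ℝ (ball R N M ψ₀ ψ₁) := by
  intro V hV W hW s t hs ht hst
  refine ⟨?_, fun n => (hV.2.1 n).convex (hW.2.1 n) hst, fun n => (hV.2.2 n).convex (hW.2.2 n) hst⟩
  have h := (convex_ball (0 : H3 R N) M) (mem_ball_zero_iff.2 hV.1) (mem_ball_zero_iff.2 hW.1)
    hs ht hst
  exact mem_ball_zero_iff.1 h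

/-- A first order criterion for strict convexity. -/
theorem strictConvexOn_of_forall_lt {X : Type*} [AddCommGroup X] [Module ℝ X] {s : Set X}
    (hs : Convex ℝ s) {f : X → ℝ} (h : ∀ x ∈ s, ∃ A : X →ₗ[ℝ] ℝ, ∀ y ∈ s, y ≠ x →
      f x + A (y - x) < f y) : StrictConvexOn ℝ s f := by
  refine ⟨hs, fun x hx y hy hxy p q hp hq hpq => ?_⟩
  obtain ⟨A, hA⟩ := h (p • x + q • y) (hs hx hy hp.le hq.le hpq)
  have e1 : x - (p • x + q • y) = q • (x - y) := by
    rw [eq_sub_of_add_eq' hpq]; module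
  have e2 : y - (p • x + q • y) = -(p • (x - y)) := by
    rw [eq_sub_of_add_eq' hpq]; module
  have d0 : x - y ≠ 0 := sub_ne_zero.2 hxy
  have h1 := hA x hx fun h0 => smul_ne_zero hq.ne' d0 (by rw [← e1]; exact sub_eq_zero.2 h0)
  have h2 := hA y hy fun h0 => smul_ne_zero hp.ne' d0 (by
    rw [← neg_eq_zero, ← e2]; exact sub_eq_zero.2 h0)
  rw [e1, map_smul, smul_eq_mul] at h1
  rw [e2, map_neg, map_smul, smul_eq_mul] at h2
  have h3 := add_lt_add (mul_lt_mul_of_pos_left h1 hp) (mul_lt_mul_of_pos_left h2 hq)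
  have h4 : p * (f (p • x + q • y) + q * A (x - y)) + q * (f (p • x + q • y) + -(p * A (x - y))) =
      (p + q) * f (p • x + q • y) := by ring
  rw [h4, hpq, one_mul] at h3
  exact h3

theorem normSqH2_nonneg {R : ℝ} {N : ℕ} (V : H3 R N) : 0 ≤ normSqH2 V :=
  Finset.sum_nonneg fun _ _ => Finset.sum_nonneg fun _ _ => sq_nonneg _

/-- The Carleman estimate absorbs the lower order terms of the Taylor remainder. -/
theorem exists_remainder_lower {R r d : ℝ} (hR : 0 < R) (hr : R < r) (hd : R < d) (a k : ℝ)
    (N : ℕ) {M : ℝ} (hM : 0 < M) : ∃ K : ℝ, 0 < K ∧ ∃ lam₁ : ℝ, 1 ≤ lam₁ ∧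
    ∀ lam, lam₁ ≤ lam → ∀ (ψ₀ ψ₁ : Fin N → Space → ℂ), ∀ V₁ ∈ closure (ball R N M ψ₀ ψ₁),
    ∀ V₂ ∈ closure (ball R N M ψ₀ ψ₁),
    Integrable (fun x => weight lam r (x 2) * remainder a d k V₁ (V₂ - V₁) x) (cubeMeasure R) →
    K * (Real.exp (2 * lam * (r - R) ^ 2) / lam) * normSqH2 (V₂ - V₁) ≤
      ∫ x in cube R, weight lam r (x 2) * remainder a d k V₁ (V₂ - V₁) x := by
  obtain ⟨K, hK, lam₁, hlam₁, hcarl⟩ := carleman_component hR hr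
  obtain ⟨C, hC0, hC⟩ := exists_sobolev_bound hR
  obtain ⟨A, hA, hlow⟩ := exists_pointwise_lower hR hd a k N hM
  set B := C * M with hB
  have hB0 : 0 ≤ B := by positivity
  set D := 4 * (N * A * K * (2 + B ^ 4)) with hD
  have hD0 : 0 ≤ D := by positivity
  refine ⟨1 / (4 * K), by positivity, max lam₁ (D ^ 2), hlam₁.trans (le_max_left _ _),
    fun lam hlam ψ₀ ψ₁ V₁ h₁ V₂ h₂ hint => ?_⟩
  have hl1 : lam₁ ≤ lam := (le_max_left _ _).trans hlam
  have hl : 1 ≤ lam := hlam₁.trans hl1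
  have hl0 : 0 < lam := by linarith
  -- `√λ ≥ D` makes the lower order terms at most half of `½ ∑ ∫ |Δhₙ|²`, weighted
  have hDl : D ≤ Real.sqrt lam := Real.le_sqrt_of_sq_le ((le_max_right _ _).trans hlam)
  have hs1 : 1 ≤ Real.sqrt lam := Real.one_le_sqrt.2 hl
  have hss : Real.sqrt lam ≤ lam := by
    nlinarith [Real.sq_sqrt hl0.le]
  have hV₁ := norm_le_of_mem_closure_ball h₁
  have hh : ‖V₂ - V₁‖ ≤ 2 * M := by
    linarith [norm_sub_le V₂ V₁, norm_le_of_mem_closure_ball h₂]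
  set h := V₂ - V₁ with hh'
  have hc := fun n => hcarl lam hl1 N M ψ₀ ψ₁ V₁ h₁ V₂ h₂ h hh' n
  set I : Fin N → ℝ := fun n => ∫ x in cube R, weight lam r (x 2) * ‖lap h n x‖ ^ 2 with hI
  set S : Fin N → ℝ := fun n =>
    ∫ x in cube R, weight lam r (x 2) * ∑ i, ‖grad h n i x‖ ^ 2 with hS
  set U : Fin N → Fin N → ℝ := fun m n =>
    ∫ x in cube R, weight lam r (x 2) * (|‖lap V₁ m x‖| * ∑ i, ‖grad h n i x‖ ^ 2) with hU
  have hI0 : ∀ n, 0 ≤ I n := fun n => integral_nonneg fun x =>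
    mul_nonneg (weight_pos _ _ _).le (sq_nonneg _)
  have hS0 : ∀ n, 0 ≤ S n := fun n => integral_nonneg fun x =>
    mul_nonneg (weight_pos _ _ _).le (Finset.sum_nonneg fun _ _ => sq_nonneg _)
  have mlap : ∀ (V : H3 R N) m, MemLp (lap V m) 2 (cubeMeasure R) := fun V m =>
    memLp_finsetSum _ fun i _ => Lp.memLp (V.1 (m, idxTwo i))
  have hlapU : ∀ m n, _ := fun m n => (hc n).2.2 (fun x => ‖lap V₁ m x‖) B hB0
    (mlap V₁ m).1.norm (by
      rw [eLpNorm_norm]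
      exact ((hC N V₁ m).2).trans (ENNReal.ofReal_le_ofReal (by rw [hB]; gcongr)))
  have iI : ∀ n, Integrable (fun x => weight lam r (x 2) * ‖lap h n x‖ ^ 2) (cubeMeasure R) :=
    fun n => integrable_weight lam r (mlap h n).norm.integrable_sq
  have iS : ∀ n, Integrable (fun x => weight lam r (x 2) * ∑ i, ‖grad h n i x‖ ^ 2)
      (cubeMeasure R) := fun n =>
    integrable_weight lam r (integrable_finsetSum _ fun i _ => integrable_norm_sq _)
  have iU : ∀ m n, Integrable (fun x => weight lam r (x 2) *
      (|‖lap V₁ m x‖| * ∑ i, ‖grad h n i x‖ ^ 2)) (cubeMeasure R) := fun m n => (hlapU m n).1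
  -- integrate the pointwise inequality
  have key : ∑ m, (1 / 2 * I m - A * ∑ n, S n - A * ∑ n, U m n) ≤
      ∫ x in cube R, weight lam r (x 2) * remainder a d k V₁ h x := by
    have iG : ∀ m, Integrable (fun x => 1 / 2 * (weight lam r (x 2) * ‖lap h m x‖ ^ 2) -
        A * ∑ n, weight lam r (x 2) * ∑ i, ‖grad h n i x‖ ^ 2) (cubeMeasure R) := fun m =>
      ((iI m).const_mul _).sub ((integrable_finsetSum _ fun n _ => iS n).const_mul _)
    have iF : ∀ m, Integrable (fun x => 1 / 2 * (weight lam r (x 2) * ‖lap h m x‖ ^ 2) -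
        A * ∑ n, weight lam r (x 2) * ∑ i, ‖grad h n i x‖ ^ 2 -
        A * ∑ n, weight lam r (x 2) * (|‖lap V₁ m x‖| * ∑ i, ‖grad h n i x‖ ^ 2))
        (cubeMeasure R) := fun m =>
      (iG m).sub ((integrable_finsetSum _ fun n _ => iU m n).const_mul _)
    have e : ∀ m, 1 / 2 * I m - A * ∑ n, S n - A * ∑ n, U m n = ∫ x in cube R,
        (1 / 2 * (weight lam r (x 2) * ‖lap h m x‖ ^ 2) -
        A * ∑ n, weight lam r (x 2) * ∑ i, ‖grad h n i x‖ ^ 2 -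
        A * ∑ n, weight lam r (x 2) * (|‖lap V₁ m x‖| * ∑ i, ‖grad h n i x‖ ^ 2)) := by
      intro m
      rw [integral_sub (iG m) ((integrable_finsetSum _ fun n _ => iU m n).const_mul _),
        integral_sub ((iI m).const_mul _) ((integrable_finsetSum _ fun n _ => iS n).const_mul _),
        integral_const_mul, integral_const_mul, integral_const_mul,
        integral_finsetSum _ fun n _ => iS n, integral_finsetSum _ fun n _ => iU m n]
    rw [Finset.sum_congr rfl fun m _ => e m, ← integral_finsetSum _ fun m _ => iF m]
    refine integral_mono_ae (integrable_finsetSum _ fun m _ => iF m) hint ?_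
    filter_upwards [hlow V₁ h hV₁ hh] with x hx
    simp only [remainder, Finset.mul_sum (s := (Finset.univ : Finset (Fin N)))
      (a := weight lam r (x 2))]
    refine Finset.sum_le_sum fun m _ => ?_
    have := mul_le_mul_of_nonneg_left (hx m) (weight_pos lam r (x 2)).le
    refine le_trans (le_of_eq ?_) this
    simp only [abs_norm, ← Finset.mul_sum]
    ring
  have q1 : ∀ n, Real.sqrt lam * S n ≤ K * I n := fun n =>
    (mul_le_mul_of_nonneg_right hss (hS0 n)).trans (hc n).1
  have q2 : ∀ m n, Real.sqrt lam * U m n ≤ K * (1 + B ^ 4) * I n := fun m n => (hlapU m n).2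
  set It := ∑ n, I n with hIt
  have hIt0 : 0 ≤ It := Finset.sum_nonneg fun n _ => hI0 n
  have low : 1 / 4 * It ≤ ∫ x in cube R, weight lam r (x 2) * remainder a d k V₁ h x := by
    refine le_trans ?_ key
    have s1 : Real.sqrt lam * ∑ n, S n ≤ K * It := by
      rw [Finset.mul_sum, hIt, Finset.mul_sum]; exact Finset.sum_le_sum fun n _ => q1 n
    have s2 : ∀ m, Real.sqrt lam * ∑ n, U m n ≤ K * (1 + B ^ 4) * It := fun m => by
      rw [Finset.mul_sum, hIt, Finset.mul_sum]; exact Finset.sum_le_sum fun n _ => q2 m n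
    have s3 : Real.sqrt lam * ∑ m, (A * ∑ n, S n + A * ∑ n, U m n) ≤
        N * (A * (K * (2 + B ^ 4) * It)) := by
      rw [Finset.mul_sum]
      refine (Finset.sum_le_sum (g := fun _ => A * (K * (2 + B ^ 4) * It)) fun m _ => ?_).trans
        (le_of_eq (by simp))
      have := mul_le_mul_of_nonneg_left (add_le_add s1 (s2 m)) hA
      linarith
    have s4 : ∑ m, (A * ∑ n, S n + A * ∑ n, U m n) ≤ 1 / 4 * It := by
      have h5 : N * (A * (K * (2 + B ^ 4) * It)) = D * (1 / 4 * It) := by rw [hD]; ring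
      have h6 : D * (1 / 4 * It) ≤ Real.sqrt lam * (1 / 4 * It) := by gcongr
      exact le_of_mul_le_mul_left (s3.trans (h5.trans_le h6)) (by linarith)
    have e : ∑ m, (1 / 2 * I m - A * ∑ n, S n - A * ∑ n, U m n) =
        1 / 2 * It - ∑ m, (A * ∑ n, S n + A * ∑ n, U m n) := by
      rw [hIt, Finset.mul_sum _ I, ← Finset.sum_sub_distrib]
      exact Finset.sum_congr rfl fun m _ => by ring
    rw [e]
    linarith
  have hH : Real.exp (2 * lam * (r - R) ^ 2) * normSqH2 h ≤ K * lam * It := by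
    refine (normSqH2_le hr hl0.le h).trans ?_
    rw [hIt, Finset.mul_sum]
    exact Finset.sum_le_sum fun n _ => (hc n).2.1
  refine le_trans ?_ low
  have e : 1 / (4 * K) * (Real.exp (2 * lam * (r - R) ^ 2) / lam) * normSqH2 h =
      (Real.exp (2 * lam * (r - R) ^ 2) * normSqH2 h) / (4 * (K * lam)) := by
    field_simp
  rw [e, div_le_iff₀ (by positivity)]
  linarith

end Convexification

end

theorem theorem5p1 (R r a d k : ℝ) (hR : 0 < R) (hr : R < r) (ha : 0 < a) (hd : R < d)
    (hk : 0 < k) (N : ℕ) (hN : 1 ≤ N) (M : ℝ) (hM : 0 < M) :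
    (∀ (lam γ : ℝ), 0 < lam → 0 < γ → γ < 1 →
      (∀ V : Convexification.H3 R N, MeasureTheory.IntegrableOn
        (Convexification.integrand a d k r lam V) (Convexification.cube R)) ∧
      ∀ (ψ₀ ψ₁ : Fin N → Convexification.Space → ℂ),
        ∀ V ∈ closure (Convexification.ball R N M ψ₀ ψ₁),
          DifferentiableAt ℝ
            (fun W : Convexification.H3 R N => Convexification.functionalJ a d k r lam γ W) V) ∧
    (∀ lam₀ : ℝ, 1 < lam₀ → ∃ lam₂ : ℝ, lam₀ ≤ lam₂ ∧ ∃ C : ℝ, 0 < C ∧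
      ∀ (lam γ : ℝ), lam₂ ≤ lam → 0 < γ → γ < 1 →
      ∀ (ψ₀ ψ₁ : Fin N → Convexification.Space → ℂ),
        StrictConvexOn ℝ (closure (Convexification.ball R N M ψ₀ ψ₁))
          (fun W : Convexification.H3 R N => Convexification.functionalJ a d k r lam γ W) ∧
        ∀ V₁ ∈ closure (Convexification.ball R N M ψ₀ ψ₁),
        ∀ V₂ ∈ closure (Convexification.ball R N M ψ₀ ψ₁),
          Convexification.functionalJ a d k r lam γ V₂
              - Convexification.functionalJ a d k r lam γ V₁
              - fderiv ℝ (fun W : Convexification.H3 R N =>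
                  Convexification.functionalJ a d k r lam γ W) V₁ (V₂ - V₁)
            ≥ C * (Real.exp (-8 * lam * R * r) / lam) * Convexification.normSqH2 (V₂ - V₁)
              + γ * ‖V₂ - V₁‖ ^ 2) := by
  refine ⟨fun lam γ _ _ _ => ⟨fun V => Convexification.integrable_integrand hR hd a k r lam V,
    fun ψ₀ ψ₁ V _ => ?_⟩, fun lam₀ hlam₀ => ?_⟩
  · obtain ⟨A, hA, -⟩ := Convexification.exists_hasFDerivAt hR hd a k r lam γ V
    exact hA.differentiableAt
  obtain ⟨K, hK, lam₁, hlam₁, hlow⟩ :=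
    Convexification.exists_remainder_lower hR hr hd a k N hM
  refine ⟨max lam₀ lam₁, le_max_left _ _, K, hK, fun lam γ hlam hγ _ ψ₀ ψ₁ => ?_⟩
  have hl0 : 0 < lam := by linarith [(le_max_left lam₀ lam₁).trans hlam]
  have main : ∀ V₁ ∈ closure (Convexification.ball R N M ψ₀ ψ₁),
      ∀ V₂ ∈ closure (Convexification.ball R N M ψ₀ ψ₁),
      Convexification.functionalJ a d k r lam γ V₂ - Convexification.functionalJ a d k r lam γ V₁
        - fderiv ℝ (fun W : Convexification.H3 R N =>
          Convexification.functionalJ a d k r lam γ W) V₁ (V₂ - V₁) ≥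
        K * (Real.exp (-8 * lam * R * r) / lam) * Convexification.normSqH2 (V₂ - V₁)
          + γ * ‖V₂ - V₁‖ ^ 2 := by
    intro V₁ h₁ V₂ h₂
    obtain ⟨A, hA, hJ⟩ := Convexification.exists_hasFDerivAt hR hd a k r lam γ V₁
    obtain ⟨hi, he⟩ := hJ V₂
    rw [hA.fderiv, he]
    have h3 := mul_le_mul_of_nonneg_left
      (hlow lam ((le_max_right _ _).trans hlam) ψ₀ ψ₁ V₁ h₁ V₂ h₂ hi)
      (Real.exp_pos (-2 * lam * (R + r) ^ 2)).le
    have h4 : Real.exp (-8 * lam * R * r) =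
        Real.exp (-2 * lam * (R + r) ^ 2) * Real.exp (2 * lam * (r - R) ^ 2) := by
      rw [← Real.exp_add]; congr 1; ring
    rw [h4]
    refine add_le_add_left (le_trans (le_of_eq ?_) h3) _
    ring
  refine ⟨Convexification.strictConvexOn_of_forall_lt
    (Convexification.ball_convex R N M ψ₀ ψ₁).closure fun V₁ h₁ => ⟨(fderiv ℝ
      (fun W : Convexification.H3 R N => Convexification.functionalJ a d k r lam γ W) V₁ :
      Convexification.H3 R N →ₗ[ℝ] ℝ), fun V₂ h₂ hne => ?_⟩, main⟩
  have h3 := main V₁ h₁ V₂ h₂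
  have h4 : 0 < γ * ‖V₂ - V₁‖ ^ 2 :=
    mul_pos hγ (pow_pos (norm_pos_iff.2 (sub_ne_zero.2 hne)) 2)
  have h5 : 0 ≤ K * (Real.exp (-8 * lam * R * r) / lam) * Convexification.normSqH2 (V₂ - V₁) :=
    mul_nonneg (mul_nonneg hK.le (div_nonneg (Real.exp_pos _).le hl0.le))
      (Convexification.normSqH2_nonneg _)
  change _ + fderiv ℝ _ V₁ (V₂ - V₁) < _
  linarith
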